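/- Let $a_1,\dots,a_J$ ($J\ge 1$) be the annihilation operators of $J$ bosonic modes on the Fock space $\ell^2(\mathbb{N}^J)$. A $J$-mode Gaussian unitary operator is a unitary $W$ on this space such that $$W^\dagger a_j W=\sum_{k}\big(\overline{C_{jk}}\,a_k+S_{jk}\,a_k^\dagger\big)+d_j\qquad(j=1,\dots,J)$$ for some $J\times J$ complex matrices $C,S$ with $CC^\dagger-(SS^\dagger)^*=\mathbb{I}$ and $(SC^\dagger)^{T}=SC^\dagger$ and some $d\in\mathbb{C}^J$, where $W$ maps the common domain of the $a_j,a_j^\dagger$ (the domain of $(\sum_j a_j^\dagger a_j)^{1/2}$) onto itself and the relation holds on this domain; $\mathcal{U}^G_J$ denotes the set of these operators. A single-mode state $\rho$ is Gaussian if its characteristic function $\xi\mapsto\mathrm{tr}(\rho\, e^{\xi a^\dagger-\bar\xi a})$ is a Gaussian, i.e. equals $\exp(\xi\bar\alpha-\bar\xi\alpha-\mu|\xi|^2+\mathrm{Re}(\nu\bar\xi^2))$ for some $\alpha,\nu\in\mathbb{C}$, $\mu\in\mathbb{R}$. The thermal excitation of a single-mode state $\rho$ is $$\mathfrak{n}(\rho)=\min_{U\in\mathcal{U}^G_1}\mathrm{tr}(a^\dagger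 a\,U\rho U^\dagger).$$ Let $\rho_1,\dots,\rho_J$ be single-mode Gaussian states and $\rho_J^{\mathrm{tot}}=\bigotimes_{j=1}^J\rho_j$. Let $\mathrm{tr}_{\backslash 1}$ denote the partial trace over all modes except mode $1$. Then 1. for every $j$, the minimum defining $\mathfrak{n}(\rho_j)$ is attained, and it is finite; the minimum defining $\mathfrak{n}\big(\mathrm{tr}_{\backslash 1}(W\rho_J^{\mathrm{tot}}W^\dagger)\big)$ is attained for every $W\in\mathcal{U}^G_J$; 2. the minimum of the thermal excitation of mode $1$ in the output over all global Gaussian unitary operators exists and is $$\min_{W\in\mathcal{U}^G_J}\mathfrak{n}\big(\mathrm{tr}_{\backslash 1}(W\rho_J^{\mathrm{tot}}W^\dagger)\big)=\min_{1\le j\le J}\mathfrak{n}(\rho_j);$$ 3. for every $j$ with $\mathfrak{n}(\rho_j)=\min_i\mathfrak{n}(\rho_i)$, the swap of modes $1$ and $j$ belongs to $\mathcal{U}^G_J$ and attains this minimum. -/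

import Mathlib

open scoped ENNReal InnerProductSpace ComplexConjugate

namespace Bosonic

noncomputable section

/-! ### Fock space -/

/-- The Hilbert space of `J` bosonic modes in the occupation-number representation: square-summable
functions of `n = (n_1, …, n_J) ∈ ℕ^J`, where `ψ n` is the amplitude of `ψ` on the number state `|n⟩`. -/
abbrev Fock (J : ℕ) : Type := lp (fun _ : Fin J → ℕ => ℂ) 2

/-- Bounded operators on the Fock space of `J` modes. -/
abbrev Op (J : ℕ) : Type := Fock J →L[ℂ] Fock J

/-- The number state `|n⟩`. -/
def numberState {J : ℕ} (n : Fin J → ℕ) : Fock J := lp.single 2 n (1 : ℂ)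

/-- The matrix element `⟨m|A|n⟩` of a bounded operator in the number basis. -/
def entry {J : ℕ} (A : Op J) (m n : Fin J → ℕ) : ℂ := ⟪numberState m, A (numberState n)⟫_ℂ

theorem memlp_iff {α : Type*} (f : α → ℂ) :
    Memℓp f 2 ↔ Summable fun i => ‖f i‖ ^ 2 := by
  rw [memℓp_gen_iff (by norm_num)]
  simp

theorem summable_sq {α : Type*} (ψ : lp (fun _ : α => ℂ) 2) : Summable fun i => ‖ψ i‖ ^ 2 :=
  (memlp_iff _).1 (lp.memℓp ψ)

theorem norm_sq_eq {α : Type*} (ψ : lp (fun _ : α => ℂ) 2) : ‖ψ‖ ^ 2 = ∑' i, ‖ψ i‖ ^ 2 := by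
  have h := lp.norm_rpow_eq_tsum (p := 2) (by norm_num) ψ
  simpa using h

/-! ### Annihilation and creation operators -/

/-- The common domain of the annihilation and creation operators of all modes: the vectors with a
finite expectation of the total number of excitations, i.e. the domain of the square root of
`∑ j, a_j† a_j`. -/
def excitationDomain (J : ℕ) : Submodule ℂ (Fock J) where
  carrier := {ψ | Summable fun n : Fin J → ℕ => ((∑ j, n j : ℕ) : ℝ) * ‖ψ n‖ ^ 2}
  zero_mem' := by simp [summable_zero]
  add_mem' := by
    intro φ ψ hφ hψ
    refine Summable.of_nonneg_of_le (fun n => by positivity) (fun n => ?_)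
      ((hφ.add hψ).mul_left 2)
    have h1 : ‖(φ + ψ) n‖ ≤ ‖φ n‖ + ‖ψ n‖ := norm_add_le _ _
    have h2 : ‖(φ + ψ) n‖ ^ 2 ≤ 2 * (‖φ n‖ ^ 2 + ‖ψ n‖ ^ 2) := by
      have := pow_le_pow_left₀ (norm_nonneg _) h1 2
      nlinarith [sq_nonneg (‖φ n‖ - ‖ψ n‖)]
    have h3 := mul_le_mul_of_nonneg_left h2 (Nat.cast_nonneg (α := ℝ) (∑ j, n j))
    linarith
  smul_mem' := by
    intro c ψ hψ
    have h := (show Summable _ from hψ).mul_left (‖c‖ ^ 2)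
    refine h.congr fun n => ?_
    have : ‖(c • ψ) n‖ = ‖c‖ * ‖ψ n‖ := norm_mul _ _
    rw [this]; ring

theorem summable_mode {J : ℕ} (j : Fin J) {ψ : Fock J} (hψ : ψ ∈ excitationDomain J) :
    Summable fun n : Fin J → ℕ => (n j : ℝ) * ‖ψ n‖ ^ 2 := by
  refine Summable.of_nonneg_of_le (fun n => by positivity) (fun n => ?_) hψ
  have : n j ≤ ∑ i, n i := Finset.single_le_sum (fun _ _ => Nat.zero_le _) (Finset.mem_univ j)
  gcongr

theorem injective_add_single {J : ℕ} (j : Fin J) :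
    Function.Injective fun n : Fin J → ℕ => n + Pi.single j 1 :=
  fun _ _ h => add_right_cancel h

/-- The annihilation operator `a_j`: `(a_j ψ)(n) = √(n_j + 1) ψ(n + e_j)`, that is,
`a_j |n⟩ = √n_j |n - e_j⟩`. -/
def annihilate {J : ℕ} (j : Fin J) : excitationDomain J →ₗ[ℂ] Fock J where
  toFun ψ := ⟨fun n => (Real.sqrt (n j + 1) : ℂ) * (ψ : Fock J) (n + Pi.single j 1), by
    refine (memlp_iff _).2 ?_
    have h := (summable_mode j ψ.2).comp_injective (injective_add_single j)
    refine h.congr fun n => ?_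
    rw [norm_mul, mul_pow, Complex.norm_real, Real.norm_eq_abs, sq_abs,
      Real.sq_sqrt (by positivity)]
    simp⟩
  map_add' φ ψ := by
    ext n
    exact mul_add _ _ _
  map_smul' c ψ := by
    ext n
    exact mul_left_comm _ _ _

/-- The creation operator `a_j†`: `(a_j† ψ)(n) = √n_j ψ(n - e_j)`, which is zero if `n_j = 0`; that
is, `a_j† |n⟩ = √(n_j + 1) |n + e_j⟩`. -/
def create {J : ℕ} (j : Fin J) : excitationDomain J →ₗ[ℂ] Fock J where
  toFun ψ := ⟨fun n => (Real.sqrt (n j) : ℂ) * (ψ : Fock J) (n - Pi.single j 1), by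
    refine (memlp_iff _).2 ?_
    refine ((injective_add_single j).summable_iff ?_).1 ?_
    · intro n hn
      have h0 : n j = 0 := by
        by_contra h
        refine hn ⟨n - Pi.single j 1, ?_⟩
        funext i
        by_cases hi : i = j
        · subst hi
          simp only [Pi.add_apply, Pi.sub_apply, Pi.single_eq_same]
          omega
        · simp [hi]
      simp [h0]
    · refine ((summable_mode j ψ.2).add (summable_sq (ψ : Fock J))).congr fun n => ?_
      have hs : n + Pi.single j 1 - Pi.single j 1 = n := by
        funext i; simp
      simp only [Function.comp_apply]
      rw [hs, norm_mul, mul_pow, Complex.norm_real, Real.norm_eq_abs, sq_abs,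
        Real.sq_sqrt (by positivity)]
      simp
      ring⟩
  map_add' φ ψ := by
    ext n
    exact mul_add _ _ _
  map_smul' c ψ := by
    ext n
    exact mul_left_comm _ _ _

/-! ### Gaussian unitary operators -/

/-- A `J`-mode Gaussian unitary operator: a unitary operator which acts on the annihilation operators
as an affine Bogoliubov transformation
`W† a_j W = ∑ k, (conj (C j k) • a_k + S j k • a_k†) + d j`,
where `C`, `S` satisfy `C C† - (S S†)^* = 1` and `(S C†)ᵀ = S C†`. The relation between the unbounded
operators is understood on their common domain, which `W` maps onto itself. -/
structure IsGaussianUnitary {J : ℕ} (W : Op J) : Prop where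
  unitary : W ∈ unitary (Op J)
  mem_iff : ∀ ψ : Fock J, W ψ ∈ excitationDomain J ↔ ψ ∈ excitationDomain J
  bogoliubov : ∃ (C S : Matrix (Fin J) (Fin J) ℂ) (d : Fin J → ℂ),
    C * C.conjTranspose - (S * S.conjTranspose).map conj = 1 ∧
    (S * C.conjTranspose).transpose = S * C.conjTranspose ∧
    ∀ (j : Fin J) (ψ : excitationDomain J),
      annihilate j ⟨W ψ, (mem_iff ψ).2 ψ.2⟩ =
        W (∑ k, (conj (C j k) • annihilate k ψ + S j k • create k ψ) + d j • (ψ : Fock J))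

/-- The set of `J`-mode Gaussian unitary operators. -/
def gaussianUnitaries (J : ℕ) : Set (Op J) := {W | IsGaussianUnitary W}

/-! ### States -/

/-- A state (density operator): a positive operator of trace one. -/
structure IsState {J : ℕ} (ρ : Op J) : Prop where
  pos : ρ.IsPositive
  trace : HasSum (fun n : Fin J → ℕ => entry ρ n n) 1

/-- The transformed operator `W ρ W†`. -/
def evolve {J : ℕ} (W ρ : Op J) : Op J := W * ρ * star W

/-- The matrix element `⟨m|D(ξ)|n⟩` of the single-mode displacement operator
`D(ξ) = exp(ξ a† - conj ξ a) = exp(-|ξ|² / 2) exp(ξ a†) exp(-conj ξ a)`. -/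
def displacementEntry (ξ : ℂ) (m n : ℕ) : ℂ :=
  Complex.exp (-(‖ξ‖ ^ 2 / 2 : ℝ)) *
    ∑ k ∈ Finset.range (min m n + 1),
      (Real.sqrt (m.factorial * n.factorial) : ℂ) /
          (k.factorial * (m - k).factorial * (n - k).factorial) *
        ξ ^ (m - k) * (-conj ξ) ^ (n - k)

/-- The characteristic function `χ(ξ) = tr(ρ D(ξ))` of a single-mode state. -/
def charFun (ρ : Op 1) (ξ : ℂ) : ℂ :=
  ∑' n : ℕ, ∑' m : ℕ, entry ρ (fun _ => n) (fun _ => m) * displacementEntry ξ m n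

/-- A single-mode Gaussian state: a state with a Gaussian characteristic function. The parameters are
the moments `α = ⟨a⟩`, `μ = ⟨{a, a†}⟩ / 2 - |⟨a⟩|²` and `ν = ⟨a²⟩ - ⟨a⟩²`. -/
structure IsGaussianState (ρ : Op 1) : Prop extends IsState ρ where
  gaussian : ∃ (α ν : ℂ) (μ : ℝ), ∀ ξ : ℂ,
    charFun ρ ξ = Complex.exp
      (ξ * conj α - conj ξ * α - μ * (‖ξ‖ ^ 2 : ℝ) + ((ν * conj ξ ^ 2).re : ℝ))

/-! ### Products and partial traces -/

/-- The splitting of the occupation numbers of `J` modes into that of mode `i` and those of the other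
modes. -/
def splitMode {J : ℕ} (i : Fin J) : (Fin J → ℕ) ≃ (Fin 1 → ℕ) × ({j : Fin J // j ≠ i} → ℕ) :=
  (Equiv.funSplitAt i ℕ).trans
    (Equiv.prodCongr (Equiv.funUnique (Fin 1) ℕ).symm (Equiv.refl _))

/-- The operator `ψ ↦ ψ ∘ f` between spaces of square-summable functions, for injective `f`. -/
def pullback {α β : Type*} (f : α → β) (hf : Function.Injective f) :
    lp (fun _ : β => ℂ) 2 →L[ℂ] lp (fun _ : α => ℂ) 2 :=
  LinearMap.mkContinuous
    { toFun := fun ψ => ⟨fun a => ψ (f a), (memlp_iff _).2 ((summable_sq ψ).comp_injective hf)⟩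
      map_add' := fun _ _ => rfl
      map_smul' := fun _ _ => rfl } 1 (by
    intro ψ
    rw [one_mul]
    refine le_of_sq_le_sq ?_ (norm_nonneg _)
    rw [norm_sq_eq, norm_sq_eq]
    exact Summable.tsum_le_tsum_of_inj f hf (fun _ _ => by positivity) (fun _ => le_rfl)
      ((summable_sq ψ).comp_injective hf) (summable_sq ψ))

/-- The partial inner product `⟨k| : Fock J → Fock 1` of all modes but `i` with the number state `|k⟩`
of these modes. -/
def slice {J : ℕ} (i : Fin J) (k : {j : Fin J // j ≠ i} → ℕ) : Fock J →L[ℂ] Fock 1 :=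
  pullback (fun m => (splitMode i).symm (m, k))
    fun _ _ h => (Prod.mk.inj ((splitMode i).symm.injective h)).1

/-- The reduced operator of mode `i`: the partial trace `∑ k, ⟨k|ρ|k⟩` over all other modes. -/
def reduced {J : ℕ} (i : Fin J) (ρ : Op J) : Op 1 :=
  ∑' k : {j : Fin J // j ≠ i} → ℕ, (slice i k) ∘L ρ ∘L (slice i k).adjoint

theorem summable_slice {J : ℕ} (i : Fin J) (ψ : Fock J) :
    Summable fun p : ({j : Fin J // j ≠ i} → ℕ) × (Fin 1 → ℕ) => ‖slice i p.1 ψ p.2‖ ^ 2 :=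
  (summable_sq ψ).comp_injective
    ((splitMode i).symm.injective.comp (Prod.swap_injective))

theorem hasSum_slice {J : ℕ} (i : Fin J) (ψ : Fock J) :
    HasSum (fun k => ‖slice i k ψ‖ ^ 2) (‖ψ‖ ^ 2) := by
  have h := summable_slice i ψ
  have h1 : ∀ k, HasSum (fun m => ‖slice i k ψ m‖ ^ 2) (‖slice i k ψ‖ ^ 2) := fun k => by
    rw [norm_sq_eq]; exact (summable_sq _).hasSum
  have h2 := h.hasSum.prod_fiberwise h1
  convert h2 using 1
  rw [norm_sq_eq]
  exact (((Equiv.prodComm _ _).trans (splitMode i).symm).tsum_eq fun n => ‖ψ n‖ ^ 2).symm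

theorem norm_sq_slice_le {J : ℕ} (i : Fin J) (A : Op 1) (ψ : Fock J)
    (k : {j : Fin J // j ≠ i} → ℕ) :
    ∑' m, ‖A (slice i k ψ) m‖ ^ 2 ≤ ‖A‖ ^ 2 * ‖slice i k ψ‖ ^ 2 := by
  rw [← norm_sq_eq, ← mul_pow]
  exact pow_le_pow_left₀ (norm_nonneg _) (A.le_opNorm (slice i k ψ)) 2

theorem summable_onMode {J : ℕ} (i : Fin J) (A : Op 1) (ψ : Fock J) :
    Summable fun p : ({j : Fin J // j ≠ i} → ℕ) × (Fin 1 → ℕ) =>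
      ‖A (slice i p.1 ψ) p.2‖ ^ 2 := by
  rw [summable_prod_of_nonneg (fun _ => by positivity)]
  constructor
  · intro k
    exact summable_sq (A (slice i k ψ))
  · exact Summable.of_nonneg_of_le (fun k => tsum_nonneg fun _ => by positivity)
      (fun k => norm_sq_slice_le i A ψ k) ((hasSum_slice i ψ).summable.mul_left (‖A‖ ^ 2))

/-- The function `n ↦ (A ⟨k|ψ)(m)`, where `m` is the occupation number of mode `i` in `n` and `k` those
of the other modes. -/
def onModeFun {J : ℕ} (i : Fin J) (A : Op 1) (ψ : Fock J) (n : Fin J → ℕ) : ℂ :=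
  A (slice i (splitMode i n).2 ψ) (splitMode i n).1

theorem memlp_onModeFun {J : ℕ} (i : Fin J) (A : Op 1) (ψ : Fock J) :
    Memℓp (onModeFun i A ψ) 2 := by
  rw [memlp_iff]
  have h := (Equiv.summable_iff ((splitMode i).trans (Equiv.prodComm _ _))).2
    (summable_onMode i A ψ)
  exact h

/-- The linear map underlying `onMode`. -/
def onModeLin {J : ℕ} (i : Fin J) (A : Op 1) : Fock J →ₗ[ℂ] Fock J where
  toFun ψ := ⟨onModeFun i A ψ, memlp_onModeFun i A ψ⟩
  map_add' φ ψ := by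
    refine Subtype.ext (funext fun n => ?_)
    change onModeFun i A (φ + ψ) n = onModeFun i A φ n + onModeFun i A ψ n
    rw [onModeFun, map_add, map_add]
    rfl
  map_smul' c ψ := by
    refine Subtype.ext (funext fun n => ?_)
    change onModeFun i A (c • ψ) n = c * onModeFun i A ψ n
    rw [onModeFun, map_smul, map_smul]
    rfl

theorem norm_onModeLin_le {J : ℕ} (i : Fin J) (A : Op 1) (ψ : Fock J) :
    ‖onModeLin i A ψ‖ ≤ ‖A‖ * ‖ψ‖ := by
  refine le_of_sq_le_sq ?_ (by positivity)
  have h1 : ‖onModeLin i A ψ‖ ^ 2 = ∑' p : ({j : Fin J // j ≠ i} → ℕ) × (Fin 1 → ℕ),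
      ‖A (slice i p.1 ψ) p.2‖ ^ 2 := by
    rw [norm_sq_eq, ← ((splitMode i).trans (Equiv.prodComm _ _)).tsum_eq
      fun p : ({j : Fin J // j ≠ i} → ℕ) × (Fin 1 → ℕ) => ‖A (slice i p.1 ψ) p.2‖ ^ 2]
    rfl
  rw [h1, mul_pow, (summable_onMode i A ψ).tsum_prod, ← (hasSum_slice i ψ).tsum_eq,
    ← tsum_mul_left]
  exact Summable.tsum_le_tsum (norm_sq_slice_le i A ψ) (summable_onMode i A ψ).prod
    ((hasSum_slice i ψ).summable.mul_left (‖A‖ ^ 2))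

/-- The operator of a `J`-mode system which acts as `A` on mode `i` and trivially on the others. -/
def onMode {J : ℕ} (i : Fin J) (A : Op 1) : Op J :=
  (onModeLin i A).mkContinuous ‖A‖ (norm_onModeLin_le i A)

/-- The tensor product `ρ_1 ⊗ ⋯ ⊗ ρ_J` of single-mode operators, as the product of the (commuting)
operators acting as `ρ_j` on mode `j`. -/
def tensor {J : ℕ} (ρ : Fin J → Op 1) : Op J :=
  (List.ofFn fun i => onMode i (ρ i)).prod

/-- The swap of modes `i` and `j`. -/
def swapModes {J : ℕ} (i j : Fin J) : Op J :=
  pullback (fun n => n ∘ Equiv.swap i j)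
    ((Equiv.swap i j).surjective.injective_comp_right)

/-! ### Excitation numbers -/

/-- The mean excitation number `tr(a† a ρ) = ∑ n, n ⟨n|ρ|n⟩` of a single-mode state, an element of
`[0, ∞]`. -/
def meanExcitation (ρ : Op 1) : ℝ≥0∞ :=
  ∑' n : ℕ, ENNReal.ofReal (n * (entry ρ (fun _ => n) (fun _ => n)).re)

/-- The thermal excitation of a single-mode state: the least mean excitation number that can be
reached by single-mode Gaussian unitary operators. -/
def thermalExcitation (ρ : Op 1) : ℝ≥0∞ :=
  ⨅ W ∈ gaussianUnitaries 1, meanExcitation (evolve W ρ)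

end

end Bosonic

/-! Every state is an ensemble `ρ = ∑ |ψ_i⟩⟨ψ_i|` (`IsState.exists_isEnsemble`), and tensor
products, unitary evolution and partial traces all act on ensembles. A Gaussian unitary replaces the
annihilation operator of a mode by an affine combination `b = ∑ (p_k a_k + q_k a_k†) + d` with `∑
(|p_k|² - |q_k|²) = 1`. The mean excitation after the transformation is therefore the quadratic
expression `∑ ‖b ψ_i‖²` in the original ensemble, and only the coefficients of `b` matter.

For one mode, collecting the ensemble into single vectors `f`, `x`, `y` of a direct sum turns this
expression into `‖c x + s y + d f‖²`. Its minimum under `|c|² - |s|² = 1` is found explicitly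
(`exists_isMin_bogoliubov`), and it is reached by an actual unitary because every such triple is
implemented (`exists_gaussianUnitary`). The moments are finite for a Gaussian state: its
characteristic function satisfies `2 - 2 Re χ(tξ) = O(t²)`, which bounds the difference quotients of
the displacement group and hence the field operators (`IsGaussianState.mem_and_summable`).

For a product state, centre the part of `b` belonging to each mode. The centred parts are
uncorrelated, so the expression is at least the sum of single-mode contributions
(`exists_sum_le_field`). If `|p_k|² > |q_k|²`, rescaling makes the contribution of mode `k` an
admissible single-mode expression, hence at least `(|p_k|² - |q_k|²) 𝔫(ρ_k)`; otherwise
nonnegativity suffices (`mul_le_single_field`). Replacing each `𝔫(ρ_k)` by the minimum and summing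
gives the lower bound, since the coefficients sum to one. Swapping the best mode into the first
position attains it. -/

namespace Bosonic

noncomputable section

/-! ### Matrix elements and ladder operators -/

theorem inner_numberState {J : ℕ} (n : Fin J → ℕ) (ψ : Fock J) : ⟪numberState n, ψ⟫_ℂ = ψ n := by
  rw [numberState, lp.inner_single_left]; simp

theorem numberState_apply {J : ℕ} (n m : Fin J → ℕ) :
    (numberState n : Fock J) m = if m = n then 1 else 0 := by
  rw [numberState, lp.single_apply, Pi.single_apply]

theorem entry_eq {J : ℕ} (A : Op J) (m n : Fin J → ℕ) : entry A m n = A (numberState n) m :=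
  inner_numberState _ _

theorem hasSum_norm_sq {α : Type*} (ψ : lp (fun _ : α => ℂ) 2) :
    HasSum (fun i => ‖ψ i‖ ^ 2) (‖ψ‖ ^ 2) := by
  rw [norm_sq_eq]; exact (summable_sq ψ).hasSum

theorem hasSum_inner_apply {α : Type*} (φ ψ : lp (fun _ : α => ℂ) 2) :
    HasSum (fun i => conj (φ i) * ψ i) ⟪φ, ψ⟫_ℂ := by
  have h : HasSum (fun i => ⟪φ i, ψ i⟫_ℂ) ⟪φ, ψ⟫_ℂ := lp.hasSum_inner φ ψ
  simpa only [RCLike.inner_apply, mul_comm] using h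

theorem numberState_mem {J : ℕ} (n : Fin J → ℕ) : numberState n ∈ excitationDomain J := by
  refine summable_of_ne_finset_zero (s := {n}) fun m hm => ?_
  rw [numberState_apply, if_neg (by simpa using hm)]
  simp

theorem ext_inner_numberState {J : ℕ} {φ ψ : Fock J}
    (h : ∀ n, ⟪numberState n, φ⟫_ℂ = ⟪numberState n, ψ⟫_ℂ) : φ = ψ := by
  ext n; simpa [inner_numberState] using h n

theorem hasSum_smul_numberState {J : ℕ} (ψ : Fock J) :
    HasSum (fun n => ψ n • numberState n) ψ := by
  convert lp.hasSum_single (p := 2) (E := fun _ : Fin J → ℕ => ℂ) (by norm_num) ψ using 2 with n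
  rw [numberState, ← lp.single_smul, smul_eq_mul, mul_one]

theorem op_ext {J : ℕ} {A B : Op J} (h : ∀ m n, entry A m n = entry B m n) : A = B := by
  ext1 ψ
  have hA := (hasSum_smul_numberState ψ).mapL A
  have hB := (hasSum_smul_numberState ψ).mapL B
  refine hA.unique ?_
  convert hB using 2 with n
  rw [map_smul, map_smul]
  congr 1
  ext m
  simpa [entry_eq] using h m n

@[simp] theorem annihilate_apply {J : ℕ} (j : Fin J) (ψ : excitationDomain J) (n : Fin J → ℕ) :
    annihilate j ψ n = (Real.sqrt (n j + 1) : ℂ) * (ψ : Fock J) (n + Pi.single j 1) := rfl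

@[simp] theorem create_apply {J : ℕ} (j : Fin J) (ψ : excitationDomain J) (n : Fin J → ℕ) :
    create j ψ n = (Real.sqrt (n j) : ℂ) * (ψ : Fock J) (n - Pi.single j 1) := rfl

theorem add_single_sub {J : ℕ} (j : Fin J) (n : Fin J → ℕ) :
    n + Pi.single j 1 - Pi.single j 1 = n := by
  funext i; simp

theorem notMem_range_add_single {J : ℕ} {j : Fin J} {n : Fin J → ℕ}
    (hn : n ∉ Set.range fun m : Fin J → ℕ => m + Pi.single j 1) : n j = 0 := by
  by_contra h
  refine hn ⟨n - Pi.single j 1, ?_⟩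
  funext i
  by_cases hi : i = j
  · subst hi
    simp only [Pi.add_apply, Pi.sub_apply, Pi.single_eq_same]
    omega
  · simp [hi]

/-- The shift by `e_j` matches the two series term by term; the terms it misses have `n j = 0` and
vanish through the factor `√(n j)`. -/
theorem inner_annihilate {J : ℕ} (j : Fin J) (φ ψ : excitationDomain J) :
    ⟪annihilate j φ, (ψ : Fock J)⟫_ℂ = ⟪(φ : Fock J), create j ψ⟫_ℂ := by
  have h1 := hasSum_inner_apply (annihilate j φ) (ψ : Fock J)
  have h2 := hasSum_inner_apply (φ : Fock J) (create j ψ)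
  rw [← (injective_add_single j).hasSum_iff (fun n hn => by
    simp [notMem_range_add_single hn])] at h2
  refine h1.unique ?_
  convert h2 using 2 with n
  simp only [Function.comp_apply, create_apply, annihilate_apply]
  rw [add_single_sub]
  simp
  ring

theorem inner_create {J : ℕ} (j : Fin J) (φ ψ : excitationDomain J) :
    ⟪create j φ, (ψ : Fock J)⟫_ℂ = ⟪(φ : Fock J), annihilate j ψ⟫_ℂ := by
  rw [← inner_conj_symm, ← inner_annihilate, inner_conj_symm]

theorem hasSum_norm_sq_annihilate {J : ℕ} (j : Fin J) (ψ : excitationDomain J) :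
    HasSum (fun n => (n j : ℝ) * ‖(ψ : Fock J) n‖ ^ 2) (‖annihilate j ψ‖ ^ 2) := by
  have h := hasSum_norm_sq (annihilate j ψ)
  rw [← (injective_add_single j).hasSum_iff (fun n hn => by
    simp [notMem_range_add_single hn])]
  convert h using 2 with n
  rw [annihilate_apply, norm_mul, mul_pow, Complex.norm_real, Real.norm_eq_abs, sq_abs,
    Real.sq_sqrt (by positivity)]
  simp

/-- This is the canonical commutation relation in quadratic form, valid on the whole domain, where
the product `a_j a_j†` need not be defined. It supplies the relation between `x` and `y` in the
one-mode minimisation. -/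
theorem norm_sq_create {J : ℕ} (j : Fin J) (ψ : excitationDomain J) :
    ‖create j ψ‖ ^ 2 = ‖annihilate j ψ‖ ^ 2 + ‖(ψ : Fock J)‖ ^ 2 := by
  have h := hasSum_norm_sq (create j ψ)
  rw [← (injective_add_single j).hasSum_iff (fun n hn => by
    simp [notMem_range_add_single hn])] at h
  refine h.unique ?_
  convert (hasSum_norm_sq_annihilate j ψ).add (hasSum_norm_sq (ψ : Fock J)) using 2 with n
  simp only [Function.comp_apply, create_apply]
  rw [add_single_sub, norm_mul, mul_pow, Complex.norm_real, Real.norm_eq_abs, sq_abs,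
    Real.sq_sqrt (by positivity)]
  simp
  ring

/-- Membership in the domain is square-summability of all the sequences defining `a_j ψ`. -/
theorem mem_excitationDomain_iff {J : ℕ} {ψ : Fock J} :
    ψ ∈ excitationDomain J ↔ ∀ j, Summable fun n : Fin J → ℕ => (n j : ℝ) * ‖ψ n‖ ^ 2 := by
  refine ⟨fun h j => summable_mode j h, fun h => ?_⟩
  change Summable _
  have := summable_sum (s := Finset.univ) fun j _ => h j
  refine this.congr fun n => ?_
  rw [← Finset.sum_mul]
  push_cast
  rfl

/-- The affine combination `∑ k, (p k • a_k + q k • a_k†) + d` of the ladder operators. -/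
def field {J : ℕ} (p q : Fin J → ℂ) (d : ℂ) : excitationDomain J →ₗ[ℂ] Fock J :=
  ∑ k, (p k • annihilate k + q k • create k) + d • (excitationDomain J).subtype

theorem field_apply {J : ℕ} (p q : Fin J → ℂ) (d : ℂ) (ψ : excitationDomain J) :
    field p q d ψ = ∑ k, (p k • annihilate k ψ + q k • create k ψ) + d • (ψ : Fock J) := by
  simp [field]

theorem field_add {J : ℕ} (p q p' q' : Fin J → ℂ) (d d' : ℂ) :
    field (p + p') (q + q') (d + d') = field p q d + field p' q' d' := by
  refine LinearMap.ext fun ψ => ?_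
  simp only [LinearMap.add_apply, field_apply, Pi.add_apply, add_smul, Finset.sum_add_distrib]
  abel

theorem field_smul {J : ℕ} (c : ℂ) (p q : Fin J → ℂ) (d : ℂ) :
    field (c • p) (c • q) (c * d) = c • field p q d := by
  refine LinearMap.ext fun ψ => ?_
  simp only [LinearMap.smul_apply, field_apply, Pi.smul_apply, smul_eq_mul, smul_add,
    Finset.smul_sum, mul_smul]

theorem inner_field {J : ℕ} (p q : Fin J → ℂ) (d : ℂ) (φ ψ : excitationDomain J) :
    ⟪field p q d φ, (ψ : Fock J)⟫_ℂ = ⟪(φ : Fock J), field (star q) (star p) (conj d) ψ⟫_ℂ := by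
  simp only [field_apply, inner_add_left, inner_add_right, sum_inner, inner_sum, inner_smul_left,
    inner_smul_right, inner_annihilate, inner_create, Pi.star_apply]
  congr 1
  refine Finset.sum_congr rfl fun k _ => ?_
  simp [add_comm]

/-! ### Ensembles -/

open InnerProductSpace in
/-- A decomposition `ρ = ∑ i, |ψ i⟩⟨ψ i|` with `∑ i, ‖ψ i‖ ^ 2 = 1`. -/
structure IsEnsemble {J : ℕ} {ι : Type*} (ψ : ι → Fock J) (ρ : Op J) : Prop where
  norm : HasSum (fun i => ‖ψ i‖ ^ 2) 1
  sum : HasSum (fun i => rankOne ℂ (ψ i) (ψ i)) ρ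

namespace IsEnsemble
open InnerProductSpace

variable {J : ℕ} {ι : Type*} {ψ : ι → Fock J} {ρ : Op J}

theorem summable_rankOne (h : Summable fun i => ‖ψ i‖ ^ 2) :
    Summable fun i => (rankOne ℂ (ψ i) (ψ i) : Op J) := by
  refine Summable.of_norm (h.congr fun i => ?_)
  rw [norm_rankOne, sq]

theorem hasSum_inner (h : IsEnsemble ψ ρ) (φ χ : Fock J) :
    HasSum (fun i => ⟪φ, ψ i⟫_ℂ * ⟪ψ i, χ⟫_ℂ) ⟪φ, ρ χ⟫_ℂ := by
  have h1 := (h.sum.mapL (ContinuousLinearMap.apply ℂ (Fock J) χ)).mapL (innerSL ℂ φ)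
  simpa [inner_smul_right, mul_comm] using h1

theorem hasSum_entry (h : IsEnsemble ψ ρ) (m n : Fin J → ℕ) :
    HasSum (fun i => ψ i m * conj (ψ i n)) (entry ρ m n) := by
  have h1 := h.hasSum_inner (numberState m) (numberState n)
  simp_rw [inner_numberState] at h1
  rw [entry, inner_numberState]
  refine h1.congr_fun fun i => ?_
  rw [← inner_conj_symm, inner_numberState]

/-- The rank-one operators are absolutely summable in norm, so they converge to some operator; its
matrix elements identify it with `ρ`. -/
theorem of_entry (hn : HasSum (fun i => ‖ψ i‖ ^ 2) 1)
    (h : ∀ m n, HasSum (fun i => ψ i m * conj (ψ i n)) (entry ρ m n)) : IsEnsemble ψ ρ := by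
  obtain ⟨ρ', h'⟩ := summable_rankOne hn.summable
  have : IsEnsemble ψ ρ' := ⟨hn, h'⟩
  rwa [op_ext fun m n => (h m n).unique (this.hasSum_entry m n)]

theorem evolve {W : Op J} (h : IsEnsemble ψ ρ) (hW : W ∈ unitary (Op J)) :
    IsEnsemble (fun i => W (ψ i)) (evolve W ρ) := by
  refine ⟨?_, ?_⟩
  · simpa only [ContinuousLinearMap.norm_map_of_mem_unitary hW] using h.norm
  · have := (h.sum.mul_left W).mul_right (star W)
    refine this.congr_fun fun i => ?_
    change _ = W ∘L rankOne ℂ (ψ i) (ψ i) ∘L star W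
    rw [ContinuousLinearMap.star_eq_adjoint, rankOne_comp, comp_rankOne]
    simp

theorem hasSum_diag_ennreal (h : IsEnsemble ψ ρ) (n : Fin J → ℕ) :
    ∑' i, ENNReal.ofReal (‖ψ i n‖ ^ 2) = ENNReal.ofReal (entry ρ n n).re := by
  have h1 := Complex.hasSum_re (h.hasSum_entry n n)
  rw [← h1.tsum_eq, ENNReal.ofReal_tsum_of_nonneg _ h1.summable]
  · congr! 3 with i
    rw [Complex.mul_conj, Complex.normSq_eq_norm_sq]; norm_cast
  · intro i
    rw [Complex.mul_conj, Complex.ofReal_re]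
    exact Complex.normSq_nonneg _

end IsEnsemble

theorem exists_eq_star_mul_self {A : Type*} [CStarAlgebra A] [PartialOrder A] [StarOrderedRing A]
    {a : A} (h : 0 ≤ a) : ∃ b, a = star b * b :=
  CStarAlgebra.nonneg_iff_eq_star_mul_self.1 h

-- Factor `ρ = B† B` and insert the resolution of the identity in the number basis between the
-- factors: the vectors are `B† |k⟩`. The trace condition becomes their normalisation after
-- exchanging two sums of nonnegative terms.
open InnerProductSpace in
theorem IsState.exists_isEnsemble {J : ℕ} {ρ : Op J} (h : IsState ρ) :
    ∃ ψ : (Fin J → ℕ) → Fock J, IsEnsemble ψ ρ := by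
  obtain ⟨B, hB⟩ := exists_eq_star_mul_self
    ((ContinuousLinearMap.nonneg_iff_isPositive ρ).2 h.pos)
  have hin : ∀ φ χ : Fock J, ⟪φ, ρ χ⟫_ℂ = ⟪B φ, B χ⟫_ℂ := fun φ χ => by
    rw [hB, mul_apply_eq_comp, ContinuousLinearMap.star_eq_adjoint,
      ContinuousLinearMap.adjoint_inner_right]
  have hent : ∀ k m, star B (numberState k) m = conj (B (numberState m) k) := fun k m => by
    rw [← inner_numberState, ContinuousLinearMap.star_eq_adjoint,
      ContinuousLinearMap.adjoint_inner_right, ← inner_conj_symm, inner_numberState]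
  refine ⟨fun k => star B (numberState k), IsEnsemble.of_entry ?_ fun m n => ?_⟩
  · have h1 : ∀ n, HasSum (fun k => ‖star B (numberState k) n‖ ^ 2) (entry ρ n n).re := fun n => by
      rw [entry, hin, inner_self_eq_norm_sq_to_K]
      convert hasSum_norm_sq (B (numberState n)) using 2 with k
      · rw [hent, RCLike.norm_conj]
      · norm_cast
    have h2 := Complex.hasSum_re h.trace
    have h3 : Summable fun p : (Fin J → ℕ) × (Fin J → ℕ) => ‖star B (numberState p.2) p.1‖ ^ 2 := by
      rw [summable_prod_of_nonneg (fun _ => by positivity)]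
      exact ⟨fun n => (h1 n).summable, h2.summable.congr fun n => ((h1 n).tsum_eq).symm⟩
    have h4 := h3.hasSum.prod_fiberwise h1
    have h5 := (Equiv.prodComm _ _).hasSum_iff.2 h3.hasSum
    have h6 := h5.prod_fiberwise fun k => hasSum_norm_sq (star B (numberState k))
    rwa [h4.unique h2] at h6
  · rw [entry, hin]
    convert hasSum_inner_apply (B (numberState m)) (B (numberState n)) using 2 with k
    simp only [hent, RCLike.conj_conj]

-- Slicing each vector along the discarded modes refines the ensemble. The definition of `reduced`
-- sums over slices with the full operator inside; absolute summability of the rank-one operators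
-- allows the order to be exchanged.
open InnerProductSpace in
theorem IsEnsemble.reduced {J : ℕ} {ι : Type*} {ψ : ι → Fock J} {ρ : Op J} (h : IsEnsemble ψ ρ)
    (i : Fin J) :
    IsEnsemble (fun p : ι × ({j : Fin J // j ≠ i} → ℕ) => slice i p.2 (ψ p.1)) (reduced i ρ) := by
  have hs : Summable fun p : ι × ({j : Fin J // j ≠ i} → ℕ) => ‖slice i p.2 (ψ p.1)‖ ^ 2 := by
    rw [summable_prod_of_nonneg (fun _ => by positivity)]
    exact ⟨fun k => (hasSum_slice i (ψ k)).summable,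
      h.norm.summable.congr fun k => ((hasSum_slice i (ψ k)).tsum_eq).symm⟩
  have hn := hs.hasSum
  rw [(hn.prod_fiberwise fun k => hasSum_slice i (ψ k)).unique h.norm] at hn
  refine ⟨hn, ?_⟩
  have h1 := (Equiv.prodComm _ _).hasSum_iff.2 (IsEnsemble.summable_rankOne hs).hasSum
  have h2 := h1.prod_fiberwise (g := fun k => (slice i k) ∘L ρ ∘L (slice i k).adjoint) fun k => by
    have h3 := (h.sum.mapL ((ContinuousLinearMap.compL ℂ (Fock 1) (Fock J) (Fock J)).flip
      (slice i k).adjoint)).mapL (ContinuousLinearMap.compL ℂ (Fock 1) (Fock J) (Fock 1) (slice i k))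
    refine h3.congr_fun fun l => ?_
    simp only [Function.comp_apply, Equiv.prodComm_apply, Prod.swap_prod_mk,
      ContinuousLinearMap.flip_apply, ContinuousLinearMap.compL_apply]
    rw [rankOne_comp, comp_rankOne, ContinuousLinearMap.adjoint_adjoint]
  rw [Bosonic.reduced, h2.tsum_eq]
  exact (IsEnsemble.summable_rankOne hs).hasSum

theorem IsEnsemble.meanExcitation_eq {ι : Type*} {ψ : ι → Fock 1} {ρ : Op 1}
    (h : IsEnsemble ψ ρ) :
    meanExcitation ρ = ∑' i, ∑' n : ℕ, ENNReal.ofReal (n * ‖ψ i fun _ => n‖ ^ 2) := by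
  rw [ENNReal.tsum_comm, meanExcitation]
  congr! 2 with n
  rw [ENNReal.ofReal_mul (by positivity), ← h.hasSum_diag_ennreal, ← ENNReal.tsum_mul_left]
  congr! 2 with i
  rw [ENNReal.ofReal_mul (by positivity)]

theorem IsEnsemble.meanExcitation_eq_annihilate {ι : Type*} {ψ : ι → excitationDomain 1} {ρ : Op 1}
    (h : IsEnsemble (fun i => (ψ i : Fock 1)) ρ) :
    meanExcitation ρ = ∑' i, ENNReal.ofReal (‖annihilate 0 (ψ i)‖ ^ 2) := by
  rw [h.meanExcitation_eq]
  congr! 2 with i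
  have h1 := hasSum_norm_sq_annihilate 0 (ψ i)
  rw [← (Equiv.funUnique (Fin 1) ℕ).symm.hasSum_iff] at h1
  rw [← h1.tsum_eq, ENNReal.ofReal_tsum_of_nonneg _ h1.summable]
  · rfl
  · intro n
    simp only [Function.comp_apply]
    positivity

/-! ### Rapidly decreasing sequences -/

/-- The rapidly decreasing sequences, an invariant domain of the ladder operators of one mode. -/
def rapid : Submodule ℂ (ℕ → ℂ) where
  carrier := {f | ∀ k : ℕ, ∃ K : ℝ, ∀ n : ℕ, ((n : ℝ) + 1) ^ k * ‖f n‖ ≤ K}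
  zero_mem' := fun k => ⟨0, fun n => by simp⟩
  add_mem' := by
    intro f g hf hg k
    obtain ⟨K, hK⟩ := hf k
    obtain ⟨L, hL⟩ := hg k
    refine ⟨K + L, fun n => ?_⟩
    have h1 : ‖(f + g) n‖ ≤ ‖f n‖ + ‖g n‖ := norm_add_le _ _
    have h2 := mul_le_mul_of_nonneg_left h1 (by positivity : 0 ≤ ((n : ℝ) + 1) ^ k)
    linarith [hK n, hL n]
  smul_mem' := by
    intro c f hf k
    obtain ⟨K, hK⟩ := hf k
    refine ⟨‖c‖ * K, fun n => ?_⟩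
    have h1 : ‖(c • f) n‖ = ‖c‖ * ‖f n‖ := norm_mul _ _
    rw [h1, mul_left_comm]
    exact mul_le_mul_of_nonneg_left (hK n) (norm_nonneg _)

theorem sqrt_add_one_le (n : ℕ) : Real.sqrt ((n : ℝ) + 1) ≤ (n : ℝ) + 1 := by
  rw [Real.sqrt_le_left (by positivity)]
  nlinarith [(Nat.cast_nonneg n : (0 : ℝ) ≤ n)]

/-- The annihilation operator on rapidly decreasing sequences. -/
def lower : rapid →ₗ[ℂ] rapid where
  toFun f := ⟨fun n => (Real.sqrt (n + 1) : ℂ) * f.1 (n + 1), fun k => by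
    obtain ⟨K, hK⟩ := f.2 (k + 1)
    refine ⟨K, fun n => le_trans ?_ (hK (n + 1))⟩
    rw [norm_mul, Complex.norm_real, Real.norm_of_nonneg (Real.sqrt_nonneg _), ← mul_assoc]
    gcongr
    rw [pow_succ]
    have := sqrt_add_one_le n
    push_cast
    gcongr
    · linarith
    · linarith⟩
  map_add' f g := Subtype.ext (funext fun n => mul_add _ _ _)
  map_smul' c f := Subtype.ext (funext fun n => mul_left_comm _ _ _)

/-- The creation operator on rapidly decreasing sequences. -/
def raise : rapid →ₗ[ℂ] rapid where
  toFun f := ⟨fun n => (Real.sqrt n : ℂ) * f.1 (n - 1), fun k => by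
    obtain ⟨K, hK⟩ := f.2 (k + 1)
    refine ⟨2 ^ (k + 1) * K, fun n => ?_⟩
    have hK0 : 0 ≤ K := le_trans (by positivity) (hK 0)
    rcases n with _ | n
    · simp
      positivity
    · refine le_trans ?_ (mul_le_mul_of_nonneg_left (hK n) (by positivity))
      rw [norm_mul, Complex.norm_real, Real.norm_of_nonneg (Real.sqrt_nonneg _), ← mul_assoc,
        ← mul_assoc, ← mul_pow, Nat.add_sub_cancel]
      gcongr
      rw [pow_succ]
      have := sqrt_add_one_le n
      push_cast
      gcongr
      · linarith [(Nat.cast_nonneg n : (0 : ℝ) ≤ n)]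
      · linarith [(Nat.cast_nonneg n : (0 : ℝ) ≤ n)]⟩
  map_add' f g := Subtype.ext (funext fun n => mul_add _ _ _)
  map_smul' c f := Subtype.ext (funext fun n => mul_left_comm _ _ _)

theorem lower_apply (f : rapid) (n : ℕ) :
    (lower f).1 n = (Real.sqrt (n + 1) : ℂ) * f.1 (n + 1) := rfl

theorem raise_apply (f : rapid) (n : ℕ) : (raise f).1 n = (Real.sqrt n : ℂ) * f.1 (n - 1) := rfl

theorem ofReal_sqrt_mul_self {x : ℝ} (hx : 0 ≤ x) :
    (Real.sqrt x : ℂ) * (Real.sqrt x : ℂ) = x := by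
  rw [← Complex.ofReal_mul, Real.mul_self_sqrt hx]

theorem lower_raise (f : rapid) : lower (raise f) = raise (lower f) + f := by
  refine Subtype.ext (funext fun n => ?_)
  change (lower (raise f)).1 n = (raise (lower f)).1 n + f.1 n
  rw [lower_apply, raise_apply, raise_apply, lower_apply, ← mul_assoc, Nat.add_sub_cancel]
  push_cast
  rw [ofReal_sqrt_mul_self (by positivity)]
  rcases n with _ | n
  · simp
  · have h := ofReal_sqrt_mul_self (x := (n : ℝ) + 1) (by positivity)
    rw [Nat.add_sub_cancel, ← mul_assoc]
    push_cast
    push_cast at h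
    rw [h]
    ring

theorem summable_rapid (f : rapid) : Summable fun n : ℕ => ‖f.1 n‖ := by
  obtain ⟨K, hK⟩ := f.2 2
  have h := ((summable_nat_add_iff 1).2 (Real.summable_one_div_nat_pow.2 one_lt_two)).mul_left K
  refine Summable.of_nonneg_of_le (fun _ => norm_nonneg _) (fun n => ?_) h
  rw [mul_one_div, le_div_iff₀ (by positivity), mul_comm]
  simpa using hK n

theorem summable_rapid_sq (f : rapid) : Summable fun n : ℕ => (n : ℝ) * ‖f.1 n‖ ^ 2 := by
  obtain ⟨K, hK⟩ := f.2 1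
  refine Summable.of_nonneg_of_le (fun _ => by positivity) (fun n => ?_)
    ((summable_rapid f).mul_left K)
  have h1 := mul_le_mul_of_nonneg_right (hK n) (norm_nonneg (f.1 n))
  nlinarith [sq_nonneg ‖f.1 n‖]

theorem summable_rapid_norm_sq (f : rapid) : Summable fun n : ℕ => ‖f.1 n‖ ^ 2 := by
  obtain ⟨K, hK⟩ := f.2 0
  refine Summable.of_nonneg_of_le (fun _ => by positivity) (fun n => ?_)
    ((summable_rapid f).mul_left K)
  have h1 := mul_le_mul_of_nonneg_right (hK n) (norm_nonneg (f.1 n))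
  nlinarith

/-- A rapidly decreasing sequence as a vector of the Fock space of one mode. -/
def ofRapid : rapid →ₗ[ℂ] excitationDomain 1 where
  toFun f := ⟨⟨fun n => f.1 (n 0), (memlp_iff _).2
      ((Equiv.funUnique (Fin 1) ℕ).summable_iff.2 (summable_rapid_norm_sq f))⟩, by
    change Summable _
    refine ((Equiv.funUnique (Fin 1) ℕ).summable_iff.2 (summable_rapid_sq f)).congr fun n => ?_
    simp⟩
  map_add' _ _ := rfl
  map_smul' _ _ := rfl

theorem ofRapid_apply (f : rapid) (n : Fin 1 → ℕ) : (ofRapid f : Fock 1) n = f.1 (n 0) := rfl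

theorem annihilate_ofRapid (f : rapid) : annihilate 0 (ofRapid f) = ofRapid (lower f) := by
  ext n
  rw [annihilate_apply, ofRapid_apply, ofRapid_apply, lower_apply]
  simp

theorem create_ofRapid (f : rapid) : create 0 (ofRapid f) = ofRapid (raise f) := by
  ext n
  rw [create_apply, ofRapid_apply, ofRapid_apply, raise_apply]
  simp

/-- The operator `c a + s a† + d` on rapidly decreasing sequences. -/
def rapidField (c s d : ℂ) : rapid →ₗ[ℂ] rapid := c • lower + s • raise + d • LinearMap.id

theorem rapidField_apply (c s d : ℂ) (f : rapid) :
    rapidField c s d f = c • lower f + s • raise f + d • f := rfl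

theorem field_one (c s d : ℂ) (ψ : excitationDomain 1) :
    field (fun _ => c) (fun _ => s) d ψ =
      c • annihilate 0 ψ + s • create 0 ψ + d • (ψ : Fock 1) := by
  simp [field_apply]

theorem field_ofRapid (c s d : ℂ) (f : rapid) :
    field (fun _ => c) (fun _ => s) d (ofRapid f) = ofRapid (rapidField c s d f) := by
  rw [field_one, annihilate_ofRapid, create_ofRapid, rapidField_apply, map_add, map_add, map_smul,
    map_smul, map_smul]
  rfl

theorem inner_rapidField (c s d : ℂ) (f g : rapid) :
    ⟪(ofRapid (rapidField c s d f) : Fock 1), (ofRapid g : Fock 1)⟫_ℂ =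
      ⟪(ofRapid f : Fock 1), (ofRapid (rapidField (conj s) (conj c) (conj d) g) : Fock 1)⟫_ℂ := by
  rw [← field_ofRapid, ← field_ofRapid, inner_field]
  rfl

/-- The commutator of `b = c a + s a† + d` with `b†` is `|c|² - |s|²`, so `b` satisfies the same
relation as `a`. -/
theorem rapidField_comm {c s : ℂ} (h : ‖c‖ ^ 2 - ‖s‖ ^ 2 = 1) (d : ℂ) (f : rapid) :
    rapidField c s d (rapidField (conj s) (conj c) (conj d) f) =
      rapidField (conj s) (conj c) (conj d) (rapidField c s d f) + f := by
  have h' : c * conj c - s * conj s = 1 := by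
    rw [Complex.mul_conj, Complex.mul_conj, Complex.normSq_eq_norm_sq, Complex.normSq_eq_norm_sq]
    exact_mod_cast h
  simp only [rapidField_apply, map_add, map_smul, lower_raise, smul_add, smul_smul]
  have : f = (c * conj c - s * conj s) • f := by rw [h', one_smul]
  conv_rhs => arg 2; rw [this]
  module

/-- Inverse of the Bogoliubov transformation: the coefficient matrix of `b`, `b†` in terms of `a`,
`a†` has determinant `|c|² - |s|² = 1`. -/
theorem lower_eq {c s : ℂ} (h : ‖c‖ ^ 2 - ‖s‖ ^ 2 = 1) (d : ℂ) (f : rapid) :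
    lower f = conj c • rapidField c s d f - s • rapidField (conj s) (conj c) (conj d) f +
      (s * conj d - conj c * d) • f := by
  have h' : conj c * c - s * conj s = 1 := by
    rw [mul_comm, Complex.mul_conj, Complex.mul_conj, Complex.normSq_eq_norm_sq, Complex.normSq_eq_norm_sq]
    exact_mod_cast h
  simp only [rapidField_apply]
  have : lower f = (conj c * c - s * conj s) • lower f := by rw [h', one_smul]
  nth_rw 1 [this]
  module

theorem raise_eq {c s : ℂ} (h : ‖c‖ ^ 2 - ‖s‖ ^ 2 = 1) (d : ℂ) (f : rapid) :
    raise f = c • rapidField (conj s) (conj c) (conj d) f - conj s • rapidField c s d f +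
      (conj s * d - c * conj d) • f := by
  have h' : c * conj c - conj s * s = 1 := by
    rw [mul_comm (conj s), Complex.mul_conj, Complex.mul_conj, Complex.normSq_eq_norm_sq, Complex.normSq_eq_norm_sq]
    exact_mod_cast h
  simp only [rapidField_apply]
  have : raise f = (c * conj c - conj s * s) • raise f := by rw [h', one_smul]
  nth_rw 1 [this]
  module

/-! ### Vacuum vectors of Bogoliubov modes -/

/-- The solution of `(c a + s a† + d) u = 0` with `u 0 = 1`. -/
def vacuumSeq (c s d : ℂ) : ℕ → ℂ
  | 0 => 1
  | 1 => -d / c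
  | n + 2 => -(s * Real.sqrt (n + 1) * vacuumSeq c s d n + d * vacuumSeq c s d (n + 1)) /
      (c * Real.sqrt (n + 2))

/-- The condition `t + ε r ≤ r²` makes `K r ^ n` a supersolution of the two-step recursion, so a
bound on two consecutive terms propagates. -/
theorem exists_geometric_bound {u : ℕ → ℝ} {t r ε : ℝ} {N : ℕ} (hr : 0 < r)
    (ht : 0 ≤ t) (hε : 0 ≤ ε) (hr2 : t + ε * r ≤ r ^ 2)
    (h : ∀ n ≥ N, u (n + 2) ≤ t * u n + ε * u (n + 1)) :
    ∃ K, ∀ n ≥ N, u n ≤ K * r ^ n := by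
  -- Joining with `0` keeps `K` nonnegative, so inequalities may be multiplied by it.
  set K := max (u N / r ^ N) (u (N + 1) / r ^ (N + 1)) ⊔ 0
  refine ⟨K, fun n hn => ?_⟩
  have key : ∀ m, u (N + m) ≤ K * r ^ (N + m) ∧ u (N + m + 1) ≤ K * r ^ (N + m + 1) := by
    intro m
    induction m with
    | zero =>
      constructor
      · exact (div_le_iff₀ (by positivity)).1 (le_sup_of_le_left (le_max_left _ _))
      · exact (div_le_iff₀ (by positivity)).1 (le_sup_of_le_left (le_max_right _ _))
    | succ m ih =>
      refine ⟨ih.2, ?_⟩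
      have h1 := h (N + m) (by omega)
      have hK : 0 ≤ K := le_max_right _ _
      calc u (N + m + 2) ≤ t * u (N + m) + ε * u (N + m + 1) := h1
        _ ≤ t * (K * r ^ (N + m)) + ε * (K * r ^ (N + m + 1)) := by
          gcongr
          exacts [ih.1, ih.2]
        _ = (K * r ^ (N + m)) * (t + ε * r) := by ring
        _ ≤ (K * r ^ (N + m)) * r ^ 2 := by gcongr
        _ = K * r ^ (N + m + 2) := by ring
  obtain ⟨m, rfl⟩ := Nat.exists_eq_add_of_le hn
  exact (key m).1

open Filter Topology in
theorem mem_rapid_of_geometric {f : ℕ → ℂ} {K r : ℝ} {N : ℕ} (hr : 0 < r) (hr1 : r < 1)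
    (h : ∀ n ≥ N, ‖f n‖ ≤ K * r ^ n) : f ∈ rapid := by
  intro k
  have h1 := tendsto_pow_const_mul_const_pow_of_abs_lt_one k (r := r)
    (by rwa [abs_of_pos hr])
  have h2 := ((h1.comp (tendsto_add_atTop_nat 1)).const_mul (K / r))
  have h3 : Tendsto (fun n : ℕ => ((n : ℝ) + 1) ^ k * ‖f n‖) atTop (𝓝 0) := by
    rw [mul_zero] at h2
    refine squeeze_zero' (Eventually.of_forall fun n => by positivity) ?_ h2
    filter_upwards [eventually_ge_atTop N] with n hn
    simp only [Function.comp_apply]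
    push_cast
    calc ((n : ℝ) + 1) ^ k * ‖f n‖ ≤ ((n : ℝ) + 1) ^ k * (K * r ^ n) := by
          gcongr; exact h n hn
      _ = K / r * (((n : ℝ) + 1) ^ k * r ^ (n + 1)) := by
          field_simp
          ring
  obtain ⟨L, hL⟩ := h3.bddAbove_range
  exact ⟨L, fun n => hL ⟨n, rfl⟩⟩

-- In the recursion the coefficient of the term two steps back is at most `|s| / |c| < 1`, and that
-- of the previous term tends to zero like `1 / √n`. The solution therefore decays geometrically,
-- whatever `d` is.
open Filter Topology in
theorem vacuumSeq_mem {c s : ℂ} (h : ‖s‖ < ‖c‖) (d : ℂ) : vacuumSeq c s d ∈ rapid := by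
  have hc : 0 < ‖c‖ := (norm_nonneg _).trans_lt h
  set t := ‖s‖ / ‖c‖ with ht
  have ht0 : 0 ≤ t := by positivity
  have ht1 : t < 1 := (div_lt_one hc).2 h
  -- With `ε = (1 - t) / 2` one has `t + ε = r²`, and `r < 1` gives the condition `t + ε r ≤ r²`.
  set r := Real.sqrt ((1 + t) / 2) with hr
  have hr2 : r ^ 2 = (1 + t) / 2 := Real.sq_sqrt (by positivity)
  have hr0 : 0 < r := Real.sqrt_pos.2 (by positivity)
  have hr1 : r < 1 := by nlinarith
  set ε := (1 - t) / 2 with hε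
  have hε0 : 0 < ε := by linarith
  have hlim : Tendsto (fun n : ℕ => ‖d‖ / ‖c‖ / Real.sqrt ((n : ℝ) + 2)) atTop (𝓝 0) := by
    refine Tendsto.const_div_atTop ?_ _
    exact Real.tendsto_sqrt_atTop.comp
      (tendsto_atTop_add_const_right _ _ tendsto_natCast_atTop_atTop)
  obtain ⟨N, hN⟩ := eventually_atTop.1 (hlim.eventually_le_const hε0)
  obtain ⟨K, hK⟩ := exists_geometric_bound (u := fun n => ‖vacuumSeq c s d n‖) (N := N) hr0 ht0
    hε0.le (by rw [hr2]; nlinarith) (fun n hn => by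
      have hs2 : 0 < Real.sqrt ((n : ℝ) + 2) := Real.sqrt_pos.2 (by positivity)
      have hs : Real.sqrt ((n : ℝ) + 1) ≤ Real.sqrt ((n : ℝ) + 2) :=
        Real.sqrt_le_sqrt (by linarith)
      simp only [vacuumSeq]
      rw [norm_div, norm_neg, norm_mul c, Complex.norm_real, Real.norm_of_nonneg hs2.le,
        div_le_iff₀ (by positivity)]
      refine (norm_add_le _ _).trans ?_
      rw [norm_mul, norm_mul, norm_mul, Complex.norm_real,
        Real.norm_of_nonneg (Real.sqrt_nonneg _), add_mul]
      have h1 : ‖d‖ ≤ ε * (‖c‖ * Real.sqrt ((n : ℝ) + 2)) := by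
        have := hN n hn
        rw [div_div, div_le_iff₀ (by positivity)] at this
        exact this
      have h2 : ‖s‖ = t * ‖c‖ := by rw [ht]; field_simp
      gcongr ?_ + ?_
      · rw [h2]
        calc _ ≤ t * ‖c‖ * Real.sqrt ((n : ℝ) + 2) * ‖vacuumSeq c s d n‖ := by gcongr
          _ = _ := by ring
      · calc _ ≤ ε * (‖c‖ * Real.sqrt ((n : ℝ) + 2)) * ‖vacuumSeq c s d (n + 1)‖ := by gcongr
          _ = _ := by ring)
  exact mem_rapid_of_geometric hr0 hr1 hK

theorem rapidField_vacuumSeq {c s : ℂ} (h : ‖s‖ < ‖c‖) (d : ℂ) :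
    rapidField c s d ⟨vacuumSeq c s d, vacuumSeq_mem h d⟩ = 0 := by
  have hc : c ≠ 0 := norm_pos_iff.1 ((norm_nonneg _).trans_lt h)
  refine Subtype.ext (funext fun n => ?_)
  change c * (_ * vacuumSeq c s d (n + 1)) + s * (_ * vacuumSeq c s d (n - 1)) +
    d * vacuumSeq c s d n = 0
  rcases n with _ | n
  · simp [vacuumSeq]
    field_simp
    ring
  · have hs : (Real.sqrt ((n : ℝ) + 2) : ℂ) ≠ 0 :=
      Complex.ofReal_ne_zero.2 (Real.sqrt_pos.2 (by positivity)).ne'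
    have : ((n + 1 : ℕ) : ℝ) + 1 = (n : ℝ) + 2 := by push_cast; ring
    rw [this, Nat.add_sub_cancel, vacuumSeq]
    push_cast
    field_simp
    ring

theorem exists_vacuum {c s : ℂ} (h : ‖s‖ < ‖c‖) (d : ℂ) :
    ∃ f : rapid, ‖(ofRapid f : Fock 1)‖ = 1 ∧ rapidField c s d f = 0 := by
  let u : rapid := ⟨vacuumSeq c s d, vacuumSeq_mem h d⟩
  have h0 : (ofRapid u : Fock 1) ≠ 0 := fun h0 => by
    have h1 : (ofRapid u : Fock 1) 0 = 0 := by rw [h0]; rfl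
    exact one_ne_zero h1
  refine ⟨((‖(ofRapid u : Fock 1)‖ : ℂ)⁻¹) • u, ?_, by rw [map_smul, rapidField_vacuumSeq h d, smul_zero]⟩
  rw [map_smul, Submodule.coe_smul, norm_smul, norm_inv, Complex.norm_real, norm_norm,
    inv_mul_cancel₀ (norm_ne_zero_iff.2 h0)]

/-! ### Number states of Bogoliubov modes -/

/-- The states `(b†)^n f / √n!` for `b = c a + s a† + d`. -/
def ladder (c s d : ℂ) (f : rapid) : ℕ → rapid
  | 0 => f
  | n + 1 => ((Real.sqrt (n + 1) : ℂ)⁻¹) •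
      rapidField (conj s) (conj c) (conj d) (ladder c s d f n)

theorem ofReal_sqrt_ne_zero {x : ℝ} (hx : 0 < x) : (Real.sqrt x : ℂ) ≠ 0 :=
  Complex.ofReal_ne_zero.2 (Real.sqrt_pos.2 hx).ne'

section

variable {c s d : ℂ} {f : rapid}

theorem rapidField_star_ladder (n : ℕ) :
    rapidField (conj s) (conj c) (conj d) (ladder c s d f n) =
      (Real.sqrt (n + 1) : ℂ) • ladder c s d f (n + 1) := by
  rw [ladder, smul_smul, mul_inv_cancel₀ (ofReal_sqrt_ne_zero (by positivity)), one_smul]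

variable (h : ‖c‖ ^ 2 - ‖s‖ ^ 2 = 1) (hf : rapidField c s d f = 0)

theorem rapidField_ladder_zero (hf : rapidField c s d f = 0) :
    rapidField c s d (ladder c s d f 0) = 0 := hf

include h hf

/-- Induction with the commutator gives `b b† φ_n = (n + 1) φ_n`; dividing by the normalisation `√(n
+ 1)` leaves the same root. -/
theorem rapidField_ladder_succ (n : ℕ) :
    rapidField c s d (ladder c s d f (n + 1)) = (Real.sqrt (n + 1) : ℂ) • ladder c s d f n := by
  have key : ∀ n, rapidField c s d (rapidField (conj s) (conj c) (conj d) (ladder c s d f n)) =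
      ((n : ℂ) + 1) • ladder c s d f n := by
    intro n
    induction n with
    | zero => rw [rapidField_comm h, rapidField_ladder_zero hf]; simp
    | succ n ih =>
      rw [rapidField_comm h]
      nth_rw 1 [ladder]
      rw [map_smul, ih, smul_comm, map_smul, map_smul, rapidField_star_ladder,
        smul_smul (_)⁻¹, inv_mul_cancel₀ (ofReal_sqrt_ne_zero (by positivity)), one_smul]
      push_cast
      rw [add_smul ((n : ℂ) + 1) 1, one_smul]
  rw [ladder, map_smul, key, smul_smul]
  congr 1
  have h1 := ofReal_sqrt_ne_zero (x := (n : ℝ) + 1) (by positivity)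
  have h2 := ofReal_sqrt_mul_self (x := (n : ℝ) + 1) (by positivity)
  push_cast at h2
  rw [inv_mul_eq_div, div_eq_iff h1, h2]

/-- Moving one `b†` to the other side as `b` lowers both indices by one, down to the vacuum, which
`b` kills. -/
theorem inner_ladder (hn : ‖(ofRapid f : Fock 1)‖ = 1) (m n : ℕ) :
    ⟪(ofRapid (ladder c s d f m) : Fock 1), (ofRapid (ladder c s d f n) : Fock 1)⟫_ℂ =
      if m = n then 1 else 0 := by
  have step : ∀ m n : ℕ, (Real.sqrt (m + 1) : ℂ) * ⟪(ofRapid (ladder c s d f (m + 1)) : Fock 1),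
      (ofRapid (ladder c s d f n) : Fock 1)⟫_ℂ = ⟪(ofRapid (ladder c s d f m) : Fock 1),
      (ofRapid (rapidField c s d (ladder c s d f n)) : Fock 1)⟫_ℂ := by
    intro m n
    have := inner_rapidField (conj s) (conj c) (conj d) (ladder c s d f m) (ladder c s d f n)
    rw [rapidField_star_ladder, map_smul, Submodule.coe_smul, inner_smul_left, Complex.conj_ofReal]
      at this
    simpa using this
  have hz : ∀ m, ⟪(ofRapid (ladder c s d f (m + 1)) : Fock 1),
      (ofRapid (ladder c s d f 0) : Fock 1)⟫_ℂ = 0 := by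
    intro m
    have := step m 0
    rw [rapidField_ladder_zero hf, map_zero, Submodule.coe_zero, inner_zero_right] at this
    exact (mul_eq_zero.1 this).resolve_left (ofReal_sqrt_ne_zero (by positivity))
  induction m generalizing n with
  | zero =>
    rcases n with _ | n
    · rw [if_pos rfl, inner_self_eq_norm_sq_to_K]
      change ((‖(ofRapid f : Fock 1)‖ : ℂ)) ^ 2 = 1
      rw [hn]; simp
    · rw [← inner_conj_symm, hz]; simp
  | succ m ih =>
    rcases n with _ | n
    · rw [hz]; simp
    · have h1 := step m (n + 1)
      rw [rapidField_ladder_succ h hf, map_smul, Submodule.coe_smul, inner_smul_right, ih] at h1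
      by_cases hmn : m = n
      · subst hmn
        simp only [if_true, mul_one] at h1 ⊢
        exact mul_left_cancel₀ (ofReal_sqrt_ne_zero (by positivity)) (h1.trans (mul_one _).symm)
      · rw [if_neg hmn, mul_zero] at h1
        rw [if_neg (by omega)]
        exact (mul_eq_zero.1 h1).resolve_left (ofReal_sqrt_ne_zero (by positivity))

theorem orthonormal_ladder (hn : ‖(ofRapid f : Fock 1)‖ = 1) :
    Orthonormal ℂ fun n : Fin 1 → ℕ => (ofRapid (ladder c s d f (n 0)) : Fock 1) := by
  rw [orthonormal_iff_ite]
  intro m n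
  rw [inner_ladder h hf hn]
  have : m 0 = n 0 ↔ m = n := (Equiv.funUnique (Fin 1) ℕ).apply_eq_iff_eq
  simp only [this]

end

theorem norm_ladder {c s d : ℂ} {f : rapid} (h : ‖c‖ ^ 2 - ‖s‖ ^ 2 = 1) (hf : rapidField c s d f = 0)
    (hn : ‖(ofRapid f : Fock 1)‖ = 1) (n : ℕ) : ‖(ofRapid (ladder c s d f n) : Fock 1)‖ = 1 :=
  (orthonormal_ladder h hf hn).1 fun _ => n

theorem hasSum_apply {J : ℕ} {ι : Type*} {φ : ι → Fock J} {ψ : Fock J} (h : HasSum φ ψ)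
    (n : Fin J → ℕ) : HasSum (fun i => φ i n) (ψ n) := by
  simpa [inner_numberState] using h.mapL (innerSL ℂ (numberState n))

/-- The superposition `∑ n, g n • (b†)^n f / √n!`. -/
def superpose (c s d : ℂ) (f g : rapid) : Fock 1 :=
  ∑' n : ℕ, g.1 n • (ofRapid (ladder c s d f n) : Fock 1)

section

variable {c s d : ℂ} {f : rapid} (h : ‖c‖ ^ 2 - ‖s‖ ^ 2 = 1) (hf : rapidField c s d f = 0)
  (hn : ‖(ofRapid f : Fock 1)‖ = 1)

include h hf hn

theorem hasSum_superpose (g : rapid) :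
    HasSum (fun n : ℕ => g.1 n • (ofRapid (ladder c s d f n) : Fock 1))
      (superpose c s d f g) := by
  refine (Summable.of_norm ((summable_rapid g).congr fun n => ?_)).hasSum
  rw [norm_smul, norm_ladder h hf hn, mul_one]

/-- In ladder coordinates `b` acts as `lower`: it kills the term `n = 0` and shifts the others. The
statement concerns the termwise image, so no closedness of an unbounded operator is needed. -/
theorem hasSum_superpose_lower (g : rapid) :
    HasSum (fun n : ℕ => g.1 n • (ofRapid (rapidField c s d (ladder c s d f n)) : Fock 1))
      (superpose c s d f (lower g)) := by
  rw [← hasSum_nat_add_iff' 1]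
  simp only [Finset.sum_range_one, rapidField_ladder_zero hf, map_zero, Submodule.coe_zero,
    smul_zero, sub_zero]
  refine (hasSum_superpose h hf hn (lower g)).congr_fun fun n => ?_
  rw [rapidField_ladder_succ h hf, map_smul, Submodule.coe_smul, smul_smul, lower_apply, mul_comm]

theorem hasSum_superpose_raise (g : rapid) :
    HasSum (fun n : ℕ => g.1 n • (ofRapid (rapidField (conj s) (conj c) (conj d)
      (ladder c s d f n)) : Fock 1)) (superpose c s d f (raise g)) := by
  have h1 := hasSum_superpose h hf hn (raise g)
  rw [← hasSum_nat_add_iff' 1] at h1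
  simp only [Finset.sum_range_one, raise_apply, Nat.cast_zero, Real.sqrt_zero, Complex.ofReal_zero,
    zero_mul, zero_smul, sub_zero, Nat.add_sub_cancel, Nat.cast_add, Nat.cast_one] at h1
  refine h1.congr_fun fun n => ?_
  rw [rapidField_star_ladder, map_smul, Submodule.coe_smul, smul_smul, mul_comm]

theorem superpose_linear (k₁ k₂ k₃ : ℂ) (g₁ g₂ g₃ : rapid) :
    superpose c s d f (k₁ • g₁ + k₂ • g₂ + k₃ • g₃) = k₁ • superpose c s d f g₁ +
      k₂ • superpose c s d f g₂ + k₃ • superpose c s d f g₃ := by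
  refine (hasSum_superpose h hf hn _).unique ?_
  refine (((hasSum_superpose h hf hn g₁).const_smul k₁).add
    ((hasSum_superpose h hf hn g₂).const_smul k₂) |>.add
    ((hasSum_superpose h hf hn g₃).const_smul k₃)).congr_fun fun n => ?_
  change (k₁ * g₁.1 n + k₂ * g₂.1 n + k₃ * g₃.1 n) • _ = _
  simp only [smul_smul, add_smul]

theorem hasSum_superpose_apply (g : rapid) (m : Fin 1 → ℕ) :
    HasSum (fun n : ℕ => g.1 n * (ladder c s d f n).1 (m 0)) (superpose c s d f g m) :=
  hasSum_apply (hasSum_superpose h hf hn g) m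

/-- Expressing `a` through `b` and `b†` by `lower_eq` shows that, in ladder coordinates, `a` is
again a Bogoliubov combination, with the inverse coefficients. Each component is computed
separately, which reduces the claim to numerical series. -/
theorem lower_superpose (g : rapid) (m : ℕ) :
    (Real.sqrt (m + 1) : ℂ) * superpose c s d f g (fun _ => m + 1) =
      superpose c s d f (rapidField (conj c) (-s) (s * conj d - conj c * d) g) fun _ => m := by
  have h1 := (hasSum_superpose_apply h hf hn g fun _ => m + 1).mul_left (Real.sqrt (m + 1) : ℂ)
  refine h1.unique ?_
  rw [rapidField_apply, superpose_linear h hf hn]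
  have h2 := ((hasSum_superpose_lower h hf hn g).const_smul (conj c)).add
    ((hasSum_superpose_raise h hf hn g).const_smul (-s)) |>.add
    ((hasSum_superpose h hf hn g).const_smul (s * conj d - conj c * d))
  refine (hasSum_apply h2 fun _ => m).congr_fun fun n => ?_
  have h3 := congrArg (fun F : rapid => F.1 m) (lower_eq h d (ladder c s d f n))
  change (Real.sqrt (m + 1) : ℂ) * (ladder c s d f n).1 (m + 1) = conj c * _ - s * _ + _ * _ at h3
  change _ = conj c * (g.1 n * _) + (-s) * (g.1 n * _) + _ * (g.1 n * _)
  rw [mul_left_comm, h3]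
  simp only [ofRapid_apply]
  ring

theorem raise_superpose (g : rapid) (m : ℕ) :
    (Real.sqrt m : ℂ) * superpose c s d f g (fun _ => m - 1) =
      superpose c s d f (rapidField (-conj s) c (conj s * d - c * conj d) g) fun _ => m := by
  have h1 := (hasSum_superpose_apply h hf hn g fun _ => m - 1).mul_left (Real.sqrt m : ℂ)
  refine h1.unique ?_
  rw [rapidField_apply, superpose_linear h hf hn]
  have h2 := ((hasSum_superpose_lower h hf hn g).const_smul (-conj s)).add
    ((hasSum_superpose_raise h hf hn g).const_smul c) |>.add
    ((hasSum_superpose h hf hn g).const_smul (conj s * d - c * conj d))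
  refine (hasSum_apply h2 fun _ => m).congr_fun fun n => ?_
  have h3 := congrArg (fun F : rapid => F.1 m) (raise_eq h d (ladder c s d f n))
  change (Real.sqrt m : ℂ) * (ladder c s d f n).1 (m - 1) = c * _ - conj s * _ + _ * _ at h3
  change _ = (-conj s) * (g.1 n * _) + c * (g.1 n * _) + _ * (g.1 n * _)
  rw [mul_left_comm, h3]
  simp only [ofRapid_apply]
  ring

theorem inner_ladder_superpose (g : rapid) (n : ℕ) :
    ⟪(ofRapid (ladder c s d f n) : Fock 1), superpose c s d f g⟫_ℂ = g.1 n := by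
  have h1 := (hasSum_superpose h hf hn g).mapL (innerSL ℂ (ofRapid (ladder c s d f n) : Fock 1))
  have h2 := hasSum_single (f := fun k => (innerSL ℂ (ofRapid (ladder c s d f n) : Fock 1))
    (g.1 k • (ofRapid (ladder c s d f k) : Fock 1))) n fun k hk => by
      simp [inner_ladder h hf hn, hk.symm]
  refine (h1.unique h2).trans ?_
  simp [norm_ladder h hf hn]

/-- Completeness of the ladder, by reversing the roles of the two modes: the vacuum of `a` is sought
as a superposition of ladder states, its coefficients being a vacuum of the inverse Bogoliubov
combination. The higher number states follow by applying `a†` in ladder coordinates. -/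
theorem exists_superpose_eq_numberState (m : ℕ) :
    ∃ g : rapid, superpose c s d f g = numberState fun _ => m := by
  have hcs : ‖-s‖ < ‖conj c‖ := by
    rw [norm_neg, RCLike.norm_conj]
    nlinarith [norm_nonneg s, norm_nonneg c]
  have hpt : ∀ n : Fin 1 → ℕ, n = fun _ => n 0 := fun n => by
    funext i; rw [Subsingleton.elim i 0]
  induction m with
  | zero =>
    obtain ⟨g, hg1, hg⟩ := exists_vacuum hcs (s * conj d - conj c * d)
    -- The superposition is annihilated by `a`, so only its component on `|0⟩` can be nonzero.
    have h1 : ∀ m : ℕ, superpose c s d f g (fun _ => m + 1) = 0 := fun m => by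
      have := lower_superpose h hf hn g m
      rw [hg] at this
      have h0 : superpose c s d f 0 = 0 := by simp [superpose]
      rw [h0] at this
      exact (mul_eq_zero.1 this).resolve_left (ofReal_sqrt_ne_zero (by positivity))
    have h2 : superpose c s d f g = superpose c s d f g 0 • numberState fun _ => 0 := by
      ext n
      change _ = superpose c s d f g 0 * (numberState (fun _ => 0) : Fock 1) n
      rw [numberState_apply]
      rcases hn0 : n 0 with _ | k
      · have : n = fun _ => 0 := by rw [hpt n, hn0]
        rw [if_pos this, this, mul_one]; rfl
      · rw [if_neg (fun hz => by rw [hz] at hn0; simp at hn0), mul_zero, hpt n, hn0, h1]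
    -- Otherwise the superposition vanishes, and orthonormality of the ladder forces `g = 0`,
    -- against its normalisation.
    have h3 : superpose c s d f g 0 ≠ 0 := fun h3 => by
      rw [h3, zero_smul] at h2
      have h4 : g = 0 := Subtype.ext (funext fun n => by
        rw [← inner_ladder_superpose h hf hn g n, h2, inner_zero_right]; rfl)
      rw [h4] at hg1
      simp at hg1
    refine ⟨(superpose c s d f g 0)⁻¹ • g, ?_⟩
    have h5 := superpose_linear h hf hn (superpose c s d f g 0)⁻¹ 0 0 g 0 0
    simp only [smul_zero, add_zero, zero_smul] at h5
    rw [h5, h2, smul_smul]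
    rw [← h2, inv_mul_cancel₀ h3, one_smul]
  | succ m ih =>
    obtain ⟨g, hg⟩ := ih
    refine ⟨(Real.sqrt (m + 1) : ℂ)⁻¹ • rapidField (-conj s) c (conj s * d - c * conj d) g, ?_⟩
    have h5 := superpose_linear h hf hn (Real.sqrt (m + 1) : ℂ)⁻¹ 0 0
      (rapidField (-conj s) c (conj s * d - c * conj d) g) 0 0
    simp only [smul_zero, add_zero, zero_smul] at h5
    rw [h5]
    ext n
    change (Real.sqrt (m + 1) : ℂ)⁻¹ * _ = _
    have h6 := raise_superpose h hf hn g (n 0)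
    rw [← hpt n, hg, numberState_apply] at h6
    rw [← h6, numberState_apply]
    have h7 : (n = fun _ => m + 1) ↔ n 0 = m + 1 :=
      ⟨fun h => by rw [h], fun h => by rw [hpt n, h]⟩
    have h8 : ((fun _ => n 0 - 1 : Fin 1 → ℕ) = fun _ => m) ↔ n 0 - 1 = m :=
      ⟨fun h => congrFun h 0, fun h => by rw [h]⟩
    rw [if_congr h7 rfl rfl, if_congr h8 rfl rfl]
    rcases n 0 with _ | k
    · simp
    · by_cases hk : k = m
      · subst hk
        simp only [Nat.add_sub_cancel, if_true, mul_one]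
        push_cast
        exact inv_mul_cancel₀ (ofReal_sqrt_ne_zero (by positivity))
      · simp [hk]

/-- The number states of a Bogoliubov mode form a Hilbert basis. -/
def ladderBasis : HilbertBasis (Fin 1 → ℕ) ℂ (Fock 1) :=
  HilbertBasis.mkOfOrthogonalEqBot (orthonormal_ladder h hf hn) (by
    rw [Submodule.eq_bot_iff]
    intro ψ hψ
    rw [Submodule.mem_orthogonal'] at hψ
    have h1 : ∀ n : ℕ, ⟪ψ, (ofRapid (ladder c s d f n) : Fock 1)⟫_ℂ = 0 := fun n =>
      hψ _ (Submodule.subset_span ⟨fun _ => n, rfl⟩)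
    refine ext_inner_numberState fun m => ?_
    obtain ⟨g, hg⟩ := exists_superpose_eq_numberState h hf hn (m 0)
    have h2 : (fun _ => m 0) = m := funext fun i => by rw [Subsingleton.elim i 0]
    rw [h2] at hg
    rw [← inner_conj_symm, ← hg, inner_zero_right]
    have h3 := (hasSum_superpose h hf hn g).mapL (innerSL ℂ ψ)
    have h4 : ⟪ψ, superpose c s d f g⟫_ℂ = 0 := by
      refine h3.unique (hasSum_zero.congr_fun fun n => ?_)
      simp [h1]
    rw [h4, map_zero])

theorem ladderBasis_repr (ψ : Fock 1) (n : Fin 1 → ℕ) :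
    (ladderBasis h hf hn).repr ψ n = ⟪(ofRapid (ladder c s d f (n 0)) : Fock 1), ψ⟫_ℂ := by
  rw [HilbertBasis.repr_apply_apply, ladderBasis, HilbertBasis.coe_mkOfOrthogonalEqBot]

end

/-! ### Existence of single-mode Gaussian unitary operators -/

theorem mem_unitary_linearIsometryEquiv {J : ℕ} (e : Fock J ≃ₗᵢ[ℂ] Fock J) :
    (e : Fock J →L[ℂ] Fock J) ∈ unitary (Op J) := by
  rw [← Unitary.coe_symm_linearIsometryEquiv_apply]
  exact (Unitary.linearIsometryEquiv.symm e).2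

section

variable {c s d : ℂ} {f : rapid} (h : ‖c‖ ^ 2 - ‖s‖ ^ 2 = 1) (hf : rapidField c s d f = 0)
  (hn : ‖(ofRapid f : Fock 1)‖ = 1)

/-- The unitary operator which maps the number states of a Bogoliubov mode to those of the mode. -/
def ladderUnitary : Op 1 := ((ladderBasis h hf hn).repr.toContinuousLinearEquiv : Fock 1 →L[ℂ] Fock 1)

theorem ladderUnitary_apply (ψ : Fock 1) (n : Fin 1 → ℕ) :
    ladderUnitary h hf hn ψ n = ⟪(ofRapid (ladder c s d f (n 0)) : Fock 1), ψ⟫_ℂ :=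
  ladderBasis_repr h hf hn ψ n

/-- The components of the image are inner products with ladder states; `b` moved to the left becomes
`b†`, which raises the index. -/
theorem ladderUnitary_lower (ψ : excitationDomain 1) (n : Fin 1 → ℕ) :
    (Real.sqrt (n 0 + 1) : ℂ) * ladderUnitary h hf hn ψ (n + Pi.single 0 1) =
      ladderUnitary h hf hn (field (fun _ => c) (fun _ => s) d ψ) n := by
  rw [ladderUnitary_apply, ladderUnitary_apply]
  have h1 := inner_field (fun _ => conj s) (fun _ => conj c) (conj d)
    (ofRapid (ladder c s d f (n 0))) ψ
  rw [field_ofRapid, rapidField_star_ladder, map_smul, Submodule.coe_smul, inner_smul_left,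
    Complex.conj_ofReal] at h1
  simp only [Pi.add_apply, Pi.single_eq_same]
  rw [h1, RCLike.conj_conj]
  congr 3 <;> funext i <;> simp

theorem ladderUnitary_raise (ψ : excitationDomain 1) (n : Fin 1 → ℕ) :
    (Real.sqrt (n 0) : ℂ) * ladderUnitary h hf hn ψ (n - Pi.single 0 1) =
      ladderUnitary h hf hn (field (fun _ => conj s) (fun _ => conj c) (conj d) ψ) n := by
  rw [ladderUnitary_apply, ladderUnitary_apply]
  have h1 := inner_field (fun _ => c) (fun _ => s) d (ofRapid (ladder c s d f (n 0))) ψ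
  rw [field_ofRapid] at h1
  refine Eq.trans ?_ (h1.trans ?_)
  · simp only [Pi.sub_apply, Pi.single_eq_same]
    rcases n 0 with _ | k
    · rw [rapidField_ladder_zero hf]; simp
    · rw [rapidField_ladder_succ h hf, map_smul, Submodule.coe_smul, inner_smul_left,
        Complex.conj_ofReal, Nat.add_sub_cancel]
      push_cast
      rfl
  · rfl

theorem ladderUnitary_mem {ψ : Fock 1} (hψ : ψ ∈ excitationDomain 1) :
    ladderUnitary h hf hn ψ ∈ excitationDomain 1 := by
  rw [mem_excitationDomain_iff]
  intro j
  rw [Subsingleton.elim j 0]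
  refine ((injective_add_single 0).summable_iff fun n hn => by
    simp [notMem_range_add_single hn]).1 ?_
  refine (summable_sq (ladderUnitary h hf hn (field (fun _ => c) (fun _ => s) d ⟨ψ, hψ⟩))).congr
    fun n => ?_
  rw [← ladderUnitary_lower, norm_mul, mul_pow, Complex.norm_real, Real.norm_eq_abs, sq_abs,
    Real.sq_sqrt (by positivity)]
  simp

theorem annihilate_ladderUnitary (ψ : excitationDomain 1) :
    annihilate 0 ⟨ladderUnitary h hf hn ψ, ladderUnitary_mem h hf hn ψ.2⟩ =
      ladderUnitary h hf hn (field (fun _ => c) (fun _ => s) d ψ) := by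
  ext n
  rw [annihilate_apply, ← ladderUnitary_lower]

theorem create_ladderUnitary (ψ : excitationDomain 1) :
    create 0 ⟨ladderUnitary h hf hn ψ, ladderUnitary_mem h hf hn ψ.2⟩ =
      ladderUnitary h hf hn (field (fun _ => conj s) (fun _ => conj c) (conj d) ψ) := by
  ext n
  rw [create_apply, ← ladderUnitary_raise]

theorem inner_ladderUnitary (φ ψ : Fock 1) :
    ⟪ladderUnitary h hf hn φ, ladderUnitary h hf hn ψ⟫_ℂ = ⟪φ, ψ⟫_ℂ :=
  (ladderBasis h hf hn).repr.inner_map_map φ ψ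

/-- The transformation of affine combinations of the ladder operators. -/
theorem field_ladderUnitary (p q e : ℂ) (ψ : excitationDomain 1) :
    field (fun _ => p) (fun _ => q) e ⟨ladderUnitary h hf hn ψ, ladderUnitary_mem h hf hn ψ.2⟩ =
      ladderUnitary h hf hn (field (fun _ => p * c + q * conj s) (fun _ => p * s + q * conj c)
        (p * d + q * conj d + e) ψ) := by
  rw [field_one, annihilate_ladderUnitary, create_ladderUnitary]
  change _ + e • ladderUnitary h hf hn ψ = _
  simp only [← map_smul, ← map_add]
  congr 1
  simp only [field_one, map_smul]
  module

/-- The vector `ω` is the preimage of the inverse Bogoliubov combination applied to the image of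
`ψ`, so it ought to be `a ψ`. Testing against number states, which lie in the domain, confirms this
componentwise without assuming `ψ` in the domain; square-summability of `ω` is then the domain
condition. -/
theorem mem_of_ladderUnitary_mem {ψ : Fock 1}
    (hψ : ladderUnitary h hf hn ψ ∈ excitationDomain 1) : ψ ∈ excitationDomain 1 := by
  have h' : c * conj c - s * conj s = 1 := by
    rw [Complex.mul_conj, Complex.mul_conj, Complex.normSq_eq_norm_sq, Complex.normSq_eq_norm_sq]
    exact_mod_cast h
  set ω : Fock 1 := (ladderBasis h hf hn).repr.symm
    (field (fun _ => conj c) (fun _ => -s) (s * conj d - conj c * d) ⟨_, hψ⟩) with hω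
  have hWω : ladderUnitary h hf hn ω =
      field (fun _ => conj c) (fun _ => -s) (s * conj d - conj c * d) ⟨_, hψ⟩ :=
    (ladderBasis h hf hn).repr.apply_symm_apply _
  have key : ∀ n : Fin 1 → ℕ, (Real.sqrt (n 0 + 1) : ℂ) * ψ (n + Pi.single 0 1) = ω n := by
    intro n
    have h1 : create 0 ⟨numberState n, numberState_mem n⟩ =
        (Real.sqrt (n 0 + 1) : ℂ) • numberState (n + Pi.single 0 1) := by
      ext m
      change _ = (Real.sqrt (n 0 + 1) : ℂ) * (numberState (n + Pi.single 0 1) : Fock 1) m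
      rw [create_apply, numberState_apply, numberState_apply]
      by_cases hm : m = n + Pi.single 0 1
      · subst hm
        simp
      · rw [if_neg hm]
        by_cases h0 : m 0 = 0
        · simp [h0]
        · rw [if_neg, mul_zero, mul_zero]
          intro h2
          refine hm ?_
          rw [← h2]
          funext i
          rw [Subsingleton.elim i 0]
          simp only [Pi.add_apply, Pi.sub_apply, Pi.single_eq_same]
          omega
    rw [← inner_numberState n ω, ← inner_ladderUnitary h hf hn, hWω,
      ← inner_numberState (n + Pi.single 0 1) ψ]
    have h2 := inner_field (fun _ => -conj s) (fun _ => c) (conj s * d - c * conj d)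
      ⟨_, ladderUnitary_mem h hf hn (numberState_mem n)⟩ ⟨_, hψ⟩
    have h3 := field_ladderUnitary h hf hn (-conj s) c (conj s * d - c * conj d)
      ⟨_, numberState_mem n⟩
    -- The coefficients were chosen so that the transformed combination is exactly `a†`.
    have e1 : -conj s * c + c * conj s = 0 := by ring
    have e2 : -conj s * s + c * conj c = 1 := by rw [← h']; ring
    have e3 : -conj s * d + c * conj d + (conj s * d - c * conj d) = 0 := by ring
    rw [h3, e1, e2, e3, inner_ladderUnitary, field_one, zero_smul, zero_smul, one_smul, zero_add,
      add_zero, h1, inner_smul_left, Complex.conj_ofReal] at h2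
    rw [h2]
    simp only [map_sub, map_mul, RCLike.conj_conj]
    congr 3
    funext i
    simp
  rw [mem_excitationDomain_iff]
  intro j
  rw [Subsingleton.elim j 0]
  refine ((injective_add_single 0).summable_iff fun n hn => by
    simp [notMem_range_add_single hn]).1 ?_
  refine (summable_sq ω).congr fun n => ?_
  rw [← key, norm_mul, mul_pow, Complex.norm_real, Real.norm_eq_abs, sq_abs,
    Real.sq_sqrt (by positivity)]
  simp

theorem ladderUnitary_mem_unitary : ladderUnitary h hf hn ∈ unitary (Op 1) :=
  mem_unitary_linearIsometryEquiv _

theorem isGaussianUnitary_ladderUnitary : IsGaussianUnitary (ladderUnitary h hf hn) where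
  unitary := ladderUnitary_mem_unitary h hf hn
  mem_iff _ := ⟨mem_of_ladderUnitary_mem h hf hn, ladderUnitary_mem h hf hn⟩
  bogoliubov := by
    refine ⟨Matrix.of fun _ _ => conj c, Matrix.of fun _ _ => s, fun _ => d, ?_, ?_,
      fun j ψ => ?_⟩
    · ext i j
      rw [Subsingleton.elim i 0, Subsingleton.elim j 0]
      simp [Matrix.mul_apply]
      rw [mul_comm, mul_comm _ s, Complex.mul_conj, Complex.mul_conj, Complex.normSq_eq_norm_sq,
        Complex.normSq_eq_norm_sq]
      exact_mod_cast h
    · ext i j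
      rw [Subsingleton.elim i j]
      rfl
    · rw [Subsingleton.elim j 0, annihilate_ladderUnitary, field_apply]
      simp

end

/-- Every affine Bogoliubov transformation of one mode is implemented by a Gaussian unitary
operator. -/
theorem exists_gaussianUnitary {c s : ℂ} (h : ‖c‖ ^ 2 - ‖s‖ ^ 2 = 1) (d : ℂ) :
    ∃ W : Op 1, ∃ hW : IsGaussianUnitary W, ∀ ψ : excitationDomain 1,
      annihilate 0 ⟨W ψ, (hW.mem_iff ψ).2 ψ.2⟩ = W (field (fun _ => c) (fun _ => s) d ψ) := by
  obtain ⟨f, hn, hf⟩ := exists_vacuum (c := c) (s := s)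
    (by nlinarith [norm_nonneg s, norm_nonneg c]) d
  exact ⟨_, isGaussianUnitary_ladderUnitary h hf hn, annihilate_ladderUnitary h hf hn⟩

/-! ### Displacement operators -/

/-- The divided power `x ^ (m - k) / (m - k)!`, which is zero if `m < k`. -/
def dividedPow (x : ℂ) (m k : ℕ) : ℂ := if k ≤ m then x ^ (m - k) / (m - k).factorial else 0

theorem dividedPow_succ_succ (x : ℂ) (m k : ℕ) :
    dividedPow x (m + 1) (k + 1) = dividedPow x m k := by
  simp [dividedPow]

/-- Split `m + 1 = (m + 1 - k) + k`; the first part cancels a factor of the factorial. -/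
theorem succ_mul_dividedPow (x : ℂ) (m k : ℕ) :
    ((m : ℂ) + 1) * dividedPow x (m + 1) k = x * dividedPow x m k + k * dividedPow x (m + 1) k := by
  unfold dividedPow
  rcases lt_trichotomy k (m + 1) with hk | rfl | hk
  · obtain ⟨l, rfl⟩ := Nat.exists_eq_add_of_le (Nat.lt_succ_iff.1 hk)
    have h1 : k + l + 1 - k = l + 1 := by omega
    have h2 : k + l - k = l := by omega
    rw [if_pos (by omega), if_pos (by omega), h1, h2, Nat.factorial_succ]
    have : (l.factorial : ℂ) ≠ 0 := by exact_mod_cast l.factorial_ne_zero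
    have : ((l : ℂ) + 1) ≠ 0 := by exact_mod_cast l.succ_ne_zero
    push_cast
    field_simp
    ring
  · simp
  · rw [if_neg (by omega), if_neg (by omega)]; simp

/-- The polynomial factor of the matrix elements of a displacement operator. -/
def displacementPoly (x y : ℂ) (m n : ℕ) : ℂ :=
  ∑ k ∈ Finset.range (n + 1), dividedPow x m k * dividedPow y n k / k.factorial

theorem displacementEntry_eq (ξ : ℂ) (m n : ℕ) :
    displacementEntry ξ m n = Complex.exp (-(‖ξ‖ ^ 2 / 2 : ℝ)) *
      (Real.sqrt (m.factorial * n.factorial) * displacementPoly ξ (-conj ξ) m n) := by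
  rw [displacementEntry]
  congr 1
  rw [displacementPoly, Finset.mul_sum]
  have hsub : Finset.range (min m n + 1) ⊆ Finset.range (n + 1) := by
    intro k; simp only [Finset.mem_range]; omega
  refine Eq.trans (Finset.sum_congr rfl fun k hk => ?_)
    (Finset.sum_subset hsub fun k hk hk' => ?_)
  · rw [Finset.mem_range] at hk
    rw [dividedPow, dividedPow, if_pos (by omega), if_pos (by omega)]
    have h1 : ((m - k).factorial : ℂ) ≠ 0 := by exact_mod_cast (m - k).factorial_ne_zero
    have h2 : ((n - k).factorial : ℂ) ≠ 0 := by exact_mod_cast (n - k).factorial_ne_zero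
    have h3 : (k.factorial : ℂ) ≠ 0 := by exact_mod_cast k.factorial_ne_zero
    field_simp
  · rw [Finset.mem_range] at hk hk'
    rw [dividedPow, if_neg (by omega)]
    simp

theorem displacementPoly_succ (x y : ℂ) (m n : ℕ) :
    ((m : ℂ) + 1) * displacementPoly x y (m + 1) n =
      (if n = 0 then 0 else displacementPoly x y m (n - 1)) + x * displacementPoly x y m n := by
  have h1 : ((m : ℂ) + 1) * displacementPoly x y (m + 1) n =
      (∑ k ∈ Finset.range (n + 1),
        k * dividedPow x (m + 1) k * dividedPow y n k / k.factorial) +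
        x * displacementPoly x y m n := by
    rw [displacementPoly, displacementPoly, Finset.mul_sum, Finset.mul_sum,
      ← Finset.sum_add_distrib]
    refine Finset.sum_congr rfl fun k _ => ?_
    linear_combination (dividedPow y n k / k.factorial) * succ_mul_dividedPow x m k
  rw [h1, Finset.sum_range_succ']
  congr 1
  rcases n with _ | n
  · simp
  · rw [if_neg (by omega), Nat.add_sub_cancel, displacementPoly]
    simp only [Nat.cast_zero, zero_mul, zero_div, add_zero]
    refine Finset.sum_congr rfl fun k _ => ?_
    rw [dividedPow_succ_succ, dividedPow_succ_succ, Nat.factorial_succ]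
    have h3 : (k.factorial : ℂ) ≠ 0 := by exact_mod_cast k.factorial_ne_zero
    have : ((k : ℂ) + 1) ≠ 0 := by exact_mod_cast k.succ_ne_zero
    push_cast
    field_simp

/-- Matrix form of `a D(ξ) = D(ξ) (a + ξ)`. Together with the row `m = 0` it determines all matrix
elements. The truncated index `n - 1` at `n = 0` is harmless, as its factor is `√0`. -/
theorem sqrt_mul_displacementEntry_succ (ξ : ℂ) (m n : ℕ) :
    (Real.sqrt (m + 1) : ℂ) * displacementEntry ξ (m + 1) n =
      Real.sqrt n * displacementEntry ξ m (n - 1) + ξ * displacementEntry ξ m n := by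
  have h := displacementPoly_succ ξ (-conj ξ) m n
  have hs := ofReal_sqrt_mul_self (x := (m : ℝ) + 1) (by positivity)
  have h1 : (Real.sqrt ((m + 1).factorial * n.factorial) : ℂ) =
      Real.sqrt (m + 1) * Real.sqrt (m.factorial * n.factorial) := by
    rw [← Complex.ofReal_mul, ← Real.sqrt_mul (by positivity), Nat.factorial_succ]
    push_cast
    ring_nf
  push_cast at hs
  rw [displacementEntry_eq, displacementEntry_eq, displacementEntry_eq, h1]
  rcases n with _ | n
  · simp only [if_true, zero_add] at h
    simp only [Nat.cast_zero, Real.sqrt_zero, Complex.ofReal_zero, zero_mul, zero_add]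
    linear_combination (Complex.exp (-(‖ξ‖ ^ 2 / 2 : ℝ)) *
      Real.sqrt (m.factorial * Nat.factorial 0)) * h +
      Complex.exp (-(‖ξ‖ ^ 2 / 2 : ℝ)) * Real.sqrt (m.factorial * Nat.factorial 0) *
      displacementPoly ξ (-conj ξ) (m + 1) 0 * hs
  · rw [if_neg (by omega)] at h
    have h2 : (Real.sqrt (m.factorial * (n + 1).factorial) : ℂ) =
        Real.sqrt (n + 1) * Real.sqrt (m.factorial * n.factorial) := by
      rw [← Complex.ofReal_mul, ← Real.sqrt_mul (by positivity), Nat.factorial_succ]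
      push_cast
      ring_nf
    rw [Nat.add_sub_cancel] at h ⊢
    rw [h2]
    push_cast
    set X := (Real.sqrt (m.factorial * n.factorial) : ℂ)
    set Y := (Real.sqrt ((n : ℝ) + 1) : ℂ)
    set Z := (Real.sqrt ((m : ℝ) + 1) : ℂ)
    set E := Complex.exp (-((‖ξ‖ : ℂ) ^ 2 / 2))
    linear_combination (E * X * Y) * h +
      E * X * Y * displacementPoly ξ (-conj ξ) (m + 1) (n + 1) * hs

theorem displacementEntry_zero_left (ξ : ℂ) (n : ℕ) :
    displacementEntry ξ 0 n =
      Complex.exp (-(‖ξ‖ ^ 2 / 2 : ℝ)) * ((-conj ξ) ^ n / Real.sqrt n.factorial) := by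
  rw [displacementEntry]
  simp only [Nat.zero_min, zero_add, Finset.sum_range_one]
  congr 1
  have h1 : (Real.sqrt n.factorial : ℂ) ≠ 0 := ofReal_sqrt_ne_zero (by positivity)
  have h2 := ofReal_sqrt_mul_self (x := (n.factorial : ℝ)) (by positivity)
  have h3 : (n.factorial : ℂ) ≠ 0 := by exact_mod_cast n.factorial_ne_zero
  push_cast at h2
  simp only [Nat.factorial_zero, Nat.cast_one, one_mul, Nat.sub_zero, pow_zero, mul_one]
  field_simp
  rw [sq, h2]

theorem vacuumSeq_one_zero (ξ : ℂ) (n : ℕ) :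
    vacuumSeq 1 0 ξ n = (-ξ) ^ n / Real.sqrt n.factorial := by
  induction n with
  | zero => simp [vacuumSeq]
  | succ n ih =>
    rcases n with _ | n
    · simp [vacuumSeq]
    · rw [vacuumSeq, ih]
      have h1 : (Real.sqrt (n + 1 + 1).factorial : ℂ) =
          Real.sqrt (n + 2) * Real.sqrt (n + 1).factorial := by
        rw [← Complex.ofReal_mul, ← Real.sqrt_mul (by positivity), Nat.factorial_succ (n + 1)]
        push_cast
        ring_nf
      rw [h1]
      have h2 : (Real.sqrt (n + 1).factorial : ℂ) ≠ 0 := ofReal_sqrt_ne_zero (by positivity)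
      have h3 : (Real.sqrt ((n : ℝ) + 2) : ℂ) ≠ 0 := ofReal_sqrt_ne_zero (by positivity)
      field_simp
      ring

/-- The displacement operators are unitary. -/
theorem exists_displacement (ξ : ℂ) :
    ∃ D ∈ unitary (Op 1), ∀ m n : ℕ, entry D (fun _ => m) (fun _ => n) = displacementEntry ξ m n := by
  have hlt : ‖(0 : ℂ)‖ < ‖(1 : ℂ)‖ := by simp
  -- The displacement operator is the ladder unitary of `b = a + ξ`, whose vacuum is the coherent
  -- state of amplitude `-ξ`. The explicit factor `E` fixes both norm and phase, which must agree
  -- with `displacementEntry`.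
  set u : rapid := ⟨vacuumSeq 1 0 ξ, vacuumSeq_mem hlt ξ⟩ with hu
  set E : ℂ := Complex.exp (-(‖ξ‖ ^ 2 / 2 : ℝ)) with hE
  have hEr : E = (Real.exp (-(‖ξ‖ ^ 2 / 2)) : ℝ) := by rw [hE]; push_cast; rfl
  have hf : rapidField 1 0 ξ (E • u) = 0 := by
    rw [map_smul, rapidField_vacuumSeq hlt ξ, smul_zero]
  have hn : ‖(ofRapid (E • u) : Fock 1)‖ = 1 := by
    have h1 : HasSum (fun n : ℕ => ‖u.1 n‖ ^ 2) (Real.exp (‖ξ‖ ^ 2)) := by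
      rw [Real.exp_eq_exp_ℝ]
      refine (NormedSpace.expSeries_div_hasSum_exp (‖ξ‖ ^ 2)).congr_fun fun n => ?_
      change ‖vacuumSeq 1 0 ξ n‖ ^ 2 = _
      rw [vacuumSeq_one_zero, norm_div, norm_pow, norm_neg, Complex.norm_real,
        Real.norm_of_nonneg (Real.sqrt_nonneg _), div_pow, Real.sq_sqrt (by positivity)]
      ring
    have h2 : ‖(ofRapid u : Fock 1)‖ ^ 2 = Real.exp (‖ξ‖ ^ 2) := by
      refine (hasSum_norm_sq _).unique ?_
      exact (Equiv.funUnique (Fin 1) ℕ).hasSum_iff.2 h1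
    rw [map_smul, Submodule.coe_smul, norm_smul, hEr, Complex.norm_real,
      Real.norm_of_nonneg (Real.exp_pos _).le, ← pow_left_inj₀ (by positivity) zero_le_one two_ne_zero,
      mul_pow, h2, ← Real.exp_nat_mul, ← Real.exp_add, one_pow, Real.exp_eq_one_iff]
    push_cast
    ring
  have h : ‖(1 : ℂ)‖ ^ 2 - ‖(0 : ℂ)‖ ^ 2 = 1 := by simp
  -- The conjugated ladder states are the rows of the unitary, and they obey the recursion of the
  -- displacement entries.
  have hentry : ∀ m n : ℕ, conj ((ladder 1 0 ξ (E • u) m).1 n) = displacementEntry ξ m n := by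
    intro m
    induction m with
    | zero =>
      intro n
      rw [displacementEntry_zero_left, ← hE]
      change conj (E * vacuumSeq 1 0 ξ n) = _
      rw [vacuumSeq_one_zero, map_mul, map_div₀, map_pow, map_neg, Complex.conj_ofReal, hEr,
        Complex.conj_ofReal]
    | succ m ih =>
      intro n
      have h1 := congrArg (fun F : rapid => conj (F.1 n))
        (rapidField_star_ladder (c := 1) (s := 0) (d := ξ) (f := E • u) m)
      simp only [rapidField_apply, map_zero, map_one, zero_smul, one_smul, zero_add] at h1
      change conj ((raise _).1 n + conj ξ * (ladder 1 0 ξ (E • u) m).1 n) =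
        conj ((Real.sqrt (m + 1) : ℂ) * (ladder 1 0 ξ (E • u) (m + 1)).1 n) at h1
      rw [raise_apply, map_add, map_mul, map_mul, map_mul, Complex.conj_ofReal, Complex.conj_ofReal,
        RCLike.conj_conj, ih, ih, ← sqrt_mul_displacementEntry_succ] at h1
      exact (mul_left_cancel₀ (ofReal_sqrt_ne_zero (by positivity)) h1).symm
  refine ⟨_, ladderUnitary_mem_unitary h hf hn, fun m n => ?_⟩
  rw [entry_eq, ladderUnitary_apply, ← inner_conj_symm, inner_numberState, ← hentry]
  rfl

/-! ### Gaussian states have a finite mean excitation number -/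

theorem hasSum_joint {α ι : Type*} {v : ι → lp (fun _ : α => ℂ) 2} {x : ℝ}
    (h : HasSum (fun i => ‖v i‖ ^ 2) x) : HasSum (fun p : ι × α => ‖v p.1 p.2‖ ^ 2) x := by
  have h1 : Summable fun p : ι × α => ‖v p.1 p.2‖ ^ 2 := by
    rw [summable_prod_of_nonneg (fun _ => by positivity)]
    exact ⟨fun i => summable_sq (v i), h.summable.congr fun i => norm_sq_eq (v i)⟩
  have h2 := h1.hasSum.prod_fiberwise fun i => hasSum_norm_sq (v i)
  rw [← h2.unique h]
  exact h1.hasSum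

theorem eq_const (n : Fin 1 → ℕ) : (fun _ => n 0) = n :=
  funext fun i => by rw [Subsingleton.elim i 0]

/-- The iterated sums defining `charFun` must be exchanged with the ensemble sum. The terms are
products of a component of `ψ_i` and the conjugate of one of `D† ψ_i`, so they are dominated by
`|ψ_i(n)|² + |(D† ψ_i)(n)|²`, which is jointly summable. -/
theorem IsEnsemble.hasSum_charFun {ι : Type*} {ψ : ι → Fock 1} {ρ : Op 1} (h : IsEnsemble ψ ρ)
    {D : Op 1} {ξ : ℂ} (hD : D ∈ unitary (Op 1))
    (hent : ∀ m n : ℕ, entry D (fun _ => m) (fun _ => n) = displacementEntry ξ m n) :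
    HasSum (fun i => ⟪ψ i, D (ψ i)⟫_ℂ) (charFun ρ ξ) := by
  have h1 : ∀ n : ℕ, ∑' m : ℕ, entry ρ (fun _ => n) (fun _ => m) * displacementEntry ξ m n =
      ⟪numberState fun _ => n, ρ (D (numberState fun _ => n))⟫_ℂ := by
    intro n
    have h2 := (((hasSum_smul_numberState (D (numberState fun _ => n))).mapL ρ).mapL
      (innerSL ℂ (numberState fun _ => n)))
    rw [← (Equiv.funUnique (Fin 1) ℕ).symm.hasSum_iff] at h2
    refine (h2.congr_fun fun m => ?_).tsum_eq
    rw [← hent, entry_eq D, entry, Function.comp_apply, map_smul, map_smul, smul_eq_mul, mul_comm]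
    rfl
  have h2 : ∀ n : Fin 1 → ℕ, HasSum (fun i => ψ i n * ⟪ψ i, D (numberState n)⟫_ℂ)
      ⟪numberState n, ρ (D (numberState n))⟫_ℂ := fun n => by
    simpa only [inner_numberState] using h.hasSum_inner (numberState n) (D (numberState n))
  have h3 : ∀ i, HasSum (fun n => ψ i n * ⟪ψ i, D (numberState n)⟫_ℂ) ⟪ψ i, D (ψ i)⟫_ℂ := by
    intro i
    refine (((hasSum_smul_numberState (ψ i)).mapL D).mapL (innerSL ℂ (ψ i))).congr_fun fun n => ?_
    rw [map_smul, map_smul, smul_eq_mul]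
    rfl
  have h4 : Summable fun p : ι × (Fin 1 → ℕ) =>
      ψ p.1 p.2 * ⟪ψ p.1, D (numberState p.2)⟫_ℂ := by
    have h5 : HasSum (fun i => ‖star D (ψ i)‖ ^ 2) 1 := by
      simpa only [ContinuousLinearMap.norm_map_of_mem_unitary (Unitary.star_mem hD)] using h.norm
    refine Summable.of_norm_bounded ((hasSum_joint h.norm).summable.add
      (hasSum_joint h5).summable) fun p => ?_
    rw [norm_mul, ← ContinuousLinearMap.adjoint_inner_left, ← inner_conj_symm, inner_numberState,
      RCLike.norm_conj, ← ContinuousLinearMap.star_eq_adjoint]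
    nlinarith [sq_nonneg (‖ψ p.1 p.2‖ - ‖star D (ψ p.1) p.2‖),
      sq_nonneg (‖ψ p.1 p.2‖ + ‖star D (ψ p.1) p.2‖)]
  have h5 := h4.hasSum.prod_fiberwise h3
  have h6 := ((Equiv.prodComm _ _).hasSum_iff.2 h4.hasSum).prod_fiberwise h2
  rw [← (Equiv.funUnique (Fin 1) ℕ).symm.hasSum_iff] at h6
  have h7 : charFun ρ ξ = ∑' p : ι × (Fin 1 → ℕ), ψ p.1 p.2 * ⟪ψ p.1, D (numberState p.2)⟫_ℂ := by
    rw [charFun, ← h6.tsum_eq]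
    exact tsum_congr h1
  rwa [h7]

/-- Expanding the square turns the real part of the characteristic function into the mean squared
distance by which the displacement moves the ensemble. -/
theorem IsEnsemble.hasSum_norm_sq_sub {ι : Type*} {ψ : ι → Fock 1} {ρ : Op 1} (h : IsEnsemble ψ ρ)
    {D : Op 1} {ξ : ℂ} (hD : D ∈ unitary (Op 1))
    (hent : ∀ m n : ℕ, entry D (fun _ => m) (fun _ => n) = displacementEntry ξ m n) :
    HasSum (fun i => ‖D (ψ i) - ψ i‖ ^ 2) (2 - 2 * (charFun ρ ξ).re) := by
  have h1 := (h.norm.mul_left 2).sub ((Complex.hasSum_re (h.hasSum_charFun hD hent)).mul_left 2)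
  rw [mul_one] at h1
  refine h1.congr_fun fun i => ?_
  rw [norm_sub_sq (𝕜 := ℂ), ContinuousLinearMap.norm_map_of_mem_unitary hD, ← inner_conj_symm]
  simp only [RCLike.conj_re, RCLike.re_to_complex]
  rw [← inner_conj_symm]
  simp
  ring

-- A bounded family that converges weakly on a total set converges weakly: approximate `ψ` by a
-- finite combination of number states.
open Filter Topology in
theorem tendsto_inner_of_tendsto_apply {α : Type*} {l : Filter α} {J : ℕ} {v : α → Fock J}
    {w : Fock J} {M : ℝ} (hM : ∀ᶠ t in l, ‖v t‖ ≤ M)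
    (h : ∀ n, Tendsto (fun t => ⟪v t, numberState n⟫_ℂ) l (𝓝 ⟪w, numberState n⟫_ℂ)) (ψ : Fock J) :
    Tendsto (fun t => ⟪v t, ψ⟫_ℂ) l (𝓝 ⟪w, ψ⟫_ℂ) := by
  have hM' : ∀ᶠ t in l, ‖v t‖ ≤ |M| := hM.mono fun t ht => ht.trans (le_abs_self M)
  rw [Metric.tendsto_nhds]
  intro ε hε
  set K := |M| + ‖w‖ + 1 with hK
  have hK0 : 0 < K := by positivity
  obtain ⟨s, hs⟩ := ((hasSum_smul_numberState ψ).eventually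
    (Metric.ball_mem_nhds ψ (show 0 < ε / (2 * K) by positivity))).exists
  set χ := ∑ n ∈ s, ψ n • (numberState n : Fock J) with hχ
  have h1 : Tendsto (fun t => ⟪v t, χ⟫_ℂ) l (𝓝 ⟪w, χ⟫_ℂ) := by
    simp only [hχ, inner_sum, inner_smul_right]
    exact tendsto_finsetSum _ fun n _ => (h n).const_mul _
  filter_upwards [hM', Metric.tendsto_nhds.1 h1 (ε / 2) (by positivity)] with t ht ht2
  rw [dist_eq_norm] at ht2 ⊢
  have hd : ‖ψ - χ‖ < ε / (2 * K) := by
    rw [← dist_eq_norm, dist_comm]; exact hs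
  have e1 : ⟪v t, ψ⟫_ℂ - ⟪w, ψ⟫_ℂ = (⟪v t, χ⟫_ℂ - ⟪w, χ⟫_ℂ) + ⟪v t - w, ψ - χ⟫_ℂ := by
    simp only [inner_sub_left, inner_sub_right]; ring
  have e2 : ‖⟪v t - w, ψ - χ⟫_ℂ‖ ≤ K * (ε / (2 * K)) := by
    refine (norm_inner_le_norm _ _).trans ?_
    have : ‖v t - w‖ ≤ K := (norm_sub_le _ _).trans (by rw [hK]; linarith)
    gcongr
  have e3 : K * (ε / (2 * K)) = ε / 2 := by field_simp
  rw [e1]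
  refine (norm_add_le _ _).trans_lt ?_
  linarith

/-- The matrix elements of `ξ a† - conj ξ a`. -/
def generatorEntry (ξ : ℂ) (m n : ℕ) : ℂ :=
  ξ * Real.sqrt m * (if m = n + 1 then 1 else 0) - conj ξ * Real.sqrt n * (if n = m + 1 then 1 else 0)

theorem displacementEntry_zero (m n : ℕ) : displacementEntry 0 m n = if m = n then 1 else 0 := by
  induction m generalizing n with
  | zero =>
    rw [displacementEntry_zero_left]
    rcases n with _ | n <;> simp
  | succ m ih =>
    have h := sqrt_mul_displacementEntry_succ 0 m n
    rw [zero_mul, add_zero, ih] at h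
    have hm : (Real.sqrt ((m : ℝ) + 1) : ℂ) ≠ 0 := ofReal_sqrt_ne_zero (by positivity)
    rcases n with _ | n
    · simp only [Nat.cast_zero, Real.sqrt_zero, Complex.ofReal_zero, zero_mul] at h
      rw [(mul_eq_zero.1 h).resolve_left hm]; simp
    · rw [Nat.add_sub_cancel] at h
      by_cases hmn : m = n
      · subst hmn
        simp only [if_true] at h ⊢
        push_cast at h
        exact mul_left_cancel₀ hm h
      · rw [if_neg hmn, mul_zero] at h
        rw [(mul_eq_zero.1 h).resolve_left hm, if_neg (by omega)]

/-- Differentiating the recursion in `m` gives a recursion for the derivatives, which the entries of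
`ξ a† - conj ξ a` satisfy by the commutation relation. -/
theorem hasDerivAt_displacementEntry (ξ : ℂ) (m n : ℕ) :
    HasDerivAt (fun t : ℝ => displacementEntry (t * ξ) m n) (generatorEntry ξ m n) 0 := by
  have hid : HasDerivAt (fun t : ℝ => (t : ℂ)) 1 0 := Complex.ofRealCLM.hasDerivAt
  induction m generalizing n with
  | zero =>
    simp only [displacementEntry_zero_left]
    have h1 : HasDerivAt (fun t : ℝ => Complex.exp (-(‖t * ξ‖ ^ 2 / 2 : ℝ))) 0 0 := by
      have h2 : HasDerivAt (fun t : ℝ => Complex.exp (-((t : ℂ) ^ 2 * ((‖ξ‖ ^ 2 / 2 : ℝ) : ℂ))))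
          (Complex.exp (-(((0 : ℝ) : ℂ) ^ 2 * ((‖ξ‖ ^ 2 / 2 : ℝ) : ℂ))) *
            -((2 : ℕ) * ((0 : ℝ) : ℂ) ^ (2 - 1) * 1 * ((‖ξ‖ ^ 2 / 2 : ℝ) : ℂ))) 0 :=
        (((hid.pow 2).mul_const _).neg).cexp
      have h6 : (fun t : ℝ => Complex.exp (-(‖t * ξ‖ ^ 2 / 2 : ℝ))) =
          fun t : ℝ => Complex.exp (-((t : ℂ) ^ 2 * ((‖ξ‖ ^ 2 / 2 : ℝ) : ℂ))) := by
        funext t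
        congr 2
        rw [norm_mul, Complex.norm_real, mul_pow, Real.norm_eq_abs, sq_abs]
        push_cast
        ring
      rw [h6]
      exact h2.congr_deriv (by simp)
    have h3 : HasDerivAt (fun t : ℝ => (-conj (t * ξ)) ^ n / (Real.sqrt n.factorial : ℂ))
        (((n : ℂ) * (-conj (((0 : ℝ) : ℂ) * ξ)) ^ (n - 1) * -(1 * conj ξ)) / Real.sqrt n.factorial)
        0 := by
      have h4 : HasDerivAt (fun t : ℝ => -conj (t * ξ)) (-(1 * conj ξ)) 0 := by
        have h5 : (fun t : ℝ => -conj ((t : ℂ) * ξ)) = fun t : ℝ => -((t : ℂ) * conj ξ) := by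
          funext t
          simp
        rw [h5]
        exact (hid.mul_const (conj ξ)).neg
      exact (h4.pow n).div_const _
    refine (h1.mul h3).congr_deriv ?_
    unfold generatorEntry
    rcases n with _ | _ | n
    · simp
    · simp
    · simp
  | succ m ih =>
    have hm : (Real.sqrt ((m : ℝ) + 1) : ℂ) ≠ 0 := ofReal_sqrt_ne_zero (by positivity)
    have h1 : (fun t : ℝ => displacementEntry (t * ξ) (m + 1) n) = fun t : ℝ =>
        (Real.sqrt n * displacementEntry (t * ξ) m (n - 1) +
          t * ξ * displacementEntry (t * ξ) m n) / Real.sqrt (m + 1) := by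
      funext t
      rw [eq_div_iff hm, mul_comm, sqrt_mul_displacementEntry_succ]
    rw [h1]
    have h2 := (((ih (n - 1)).const_mul (Real.sqrt n : ℂ)).add
      ((hid.mul_const ξ).mul (ih n))).div_const (Real.sqrt (m + 1) : ℂ)
    refine h2.congr_deriv ?_
    symm
    rw [eq_div_iff hm]
    simp only [Complex.ofReal_zero, zero_mul, displacementEntry_zero, add_zero, one_mul]
    simp only [generatorEntry]
    have hs := ofReal_sqrt_mul_self (x := (m : ℝ) + 1) (by positivity)
    push_cast at hs ⊢
    rcases n with _ | n
    · by_cases h0 : m = 0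
      · subst h0; simp
      · simp [h0]
    · rw [Nat.add_sub_cancel]
      have hsn := ofReal_sqrt_mul_self (x := (n : ℝ) + 1) (by positivity)
      push_cast at hsn ⊢
      by_cases h3 : m = n + 1
      · subst h3
        have h5 : n ≠ n + 1 + 1 := by omega
        simp [h5]
        push_cast at hs
        linear_combination ξ * hs - ξ * hsn
      · by_cases h4 : n = m + 1
        · subst h4
          simp [h3]
          ring
        · simp [h3, h4]

open Filter Topology in
/-- The displaced number states approach the number states at a linear rate. -/
theorem eventually_displacementEntry_diag (ξ : ℂ) (m : ℕ) :
    ∃ M : ℝ, ∀ᶠ t : ℝ in 𝓝 0, 2 - 2 * (displacementEntry (t * ξ) m m).re ≤ M * t ^ 2 := by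
  -- The diagonal entry depends on `t` only through `t²`; differentiability of `F` at `0` thus gives
  -- a quadratic bound.
  set F : ℝ → ℝ := fun u => Real.exp (-(u * (‖ξ‖ ^ 2 / 2))) *
    ∑ k ∈ Finset.range (m + 1), (Real.sqrt (m.factorial * m.factorial) /
      (k.factorial * (m - k).factorial * (m - k).factorial)) * (-(u * ‖ξ‖ ^ 2)) ^ (m - k) with hF
  have h1 : ∀ t : ℝ, displacementEntry (t * ξ) m m = F (t ^ 2) := by
    intro t
    have e1 : ((t : ℂ) * ξ) * (-conj ((t : ℂ) * ξ)) = ((-(t ^ 2 * ‖ξ‖ ^ 2) : ℝ) : ℂ) := by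
      rw [mul_neg, Complex.mul_conj, Complex.normSq_eq_norm_sq, norm_mul, Complex.norm_real,
        mul_pow, Real.norm_eq_abs, sq_abs]
      push_cast; ring
    rw [displacementEntry, hF, min_self]
    simp only [mul_assoc (_ / _), ← mul_pow, e1]
    rw [norm_mul, Complex.norm_real, mul_pow, Real.norm_eq_abs, sq_abs, mul_div_assoc]
    push_cast
    rfl
  have h2 : DifferentiableAt ℝ F 0 := by fun_prop
  have h3 : F 0 = 1 := by
    have := h1 0
    rw [Complex.ofReal_zero, zero_mul, displacementEntry_zero, if_pos rfl] at this
    have h4 : ((0 : ℝ) ^ 2) = 0 := by norm_num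
    rw [h4] at this
    exact_mod_cast this.symm
  obtain ⟨M, hM⟩ := (h2.isBigO_sub).bound
  refine ⟨2 * M, ?_⟩
  have h5 : Tendsto (fun t : ℝ => t ^ 2) (𝓝 0) (𝓝 0) := by
    have : Continuous fun t : ℝ => t ^ 2 := by fun_prop
    simpa using this.tendsto 0
  filter_upwards [h5.eventually hM] with t ht
  rw [h1, Complex.ofReal_re]
  rw [h3, sub_zero, Real.norm_eq_abs, Real.norm_eq_abs, abs_of_nonneg (sq_nonneg t)] at ht
  linarith [neg_abs_le (F (t ^ 2) - 1)]

/-- The linear part of the exponent is purely imaginary, so the real part is `exp (κ t²) cos (β t)`,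
which differs from `1` by `O(t²)`. This is where the Gaussian form enters. -/
theorem IsGaussianState.charFun_le {ρ : Op 1} (h : IsGaussianState ρ) (ξ : ℂ) :
    ∃ M : ℝ, ∀ t : ℝ, |t| ≤ 1 → 2 - 2 * (charFun ρ (t * ξ)).re ≤ M * t ^ 2 := by
  obtain ⟨α, ν, μ, hχ⟩ := h.gaussian
  set κ := -μ * ‖ξ‖ ^ 2 + (ν * conj ξ ^ 2).re with hκ
  set β := (ξ * conj α - conj ξ * α).im with hβ
  -- From `1 - e cos = (1 - e) + e (1 - cos)` with `e = exp (κ t²) ≤ exp |κ|`.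
  refine ⟨2 * (|κ| + Real.exp |κ| * β ^ 2 / 2), fun t ht => ?_⟩
  have h0 : (ξ * conj α - conj ξ * α).re = 0 := by simp [mul_comm]
  have h1 : (t * ξ) * conj α - conj (t * ξ) * α - μ * (‖t * ξ‖ ^ 2 : ℝ) +
      ((ν * conj (t * ξ) ^ 2).re : ℝ) = ((κ * t ^ 2 : ℝ) : ℂ) + ((β * t : ℝ) : ℂ) * Complex.I := by
    have e1 : ξ * conj α - conj ξ * α = (β : ℂ) * Complex.I := by
      apply Complex.ext
      · rw [h0]; simp
      · simp [hβ]
    have e2 : (ν * conj ((t : ℂ) * ξ) ^ 2).re = t ^ 2 * (ν * conj ξ ^ 2).re := by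
      rw [map_mul, Complex.conj_ofReal, mul_pow, mul_left_comm, ← Complex.ofReal_pow,
        Complex.re_ofReal_mul]
    rw [e2, norm_mul, Complex.norm_real, mul_pow, Real.norm_eq_abs, sq_abs, map_mul,
      Complex.conj_ofReal, hκ]
    push_cast
    linear_combination (t : ℂ) * e1
  rw [hχ, h1, Complex.exp_re]
  simp only [Complex.add_re, Complex.ofReal_re, Complex.mul_re, Complex.I_re, mul_zero,
    Complex.ofReal_im, Complex.I_im, sub_zero, add_zero, Complex.add_im, Complex.mul_im,
    mul_one, zero_add]
  have ht2 : t ^ 2 ≤ 1 := by rw [← sq_abs]; exact pow_le_one₀ (abs_nonneg _) ht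
  have e1 := Real.add_one_le_exp (κ * t ^ 2)
  have e2 := Real.one_sub_sq_div_two_le_cos (x := β * t)
  have e3 : κ * t ^ 2 ≤ |κ| := by
    calc κ * t ^ 2 ≤ |κ| * t ^ 2 := by gcongr; exact le_abs_self _
      _ ≤ |κ| * 1 := by gcongr
      _ = |κ| := mul_one _
  have e4 := Real.exp_le_exp.2 e3
  have e5 : -(|κ| * t ^ 2) ≤ κ * t ^ 2 := by
    have := mul_le_mul_of_nonneg_right (neg_abs_le κ) (sq_nonneg t); linarith
  have e6 : Real.exp (κ * t ^ 2) * (1 - Real.cos (β * t)) ≤ Real.exp |κ| * ((β * t) ^ 2 / 2) :=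
    mul_le_mul e4 (by linarith) (by linarith [Real.cos_le_one (β * t)]) (Real.exp_pos _).le
  nlinarith

/-- The vector with `⟪generatorVec ξ m, ψ⟫ = ((ξ a† - conj ξ a) ψ)(m)`. -/
def generatorVec (ξ : ℂ) (m : Fin 1 → ℕ) : Fock 1 :=
  (conj ξ * Real.sqrt (m 0)) • numberState (m - Pi.single 0 1) -
    (ξ * Real.sqrt (m 0 + 1)) • numberState (m + Pi.single 0 1)

theorem inner_generatorVec (ξ : ℂ) (m : Fin 1 → ℕ) (ψ : Fock 1) :
    ⟪generatorVec ξ m, ψ⟫_ℂ = ξ * (Real.sqrt (m 0) * ψ (m - Pi.single 0 1)) -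
      conj ξ * (Real.sqrt (m 0 + 1) * ψ (m + Pi.single 0 1)) := by
  rw [generatorVec, inner_sub_left, inner_smul_left, inner_smul_left, inner_numberState,
    inner_numberState, map_mul, map_mul, Complex.conj_ofReal, Complex.conj_ofReal, RCLike.conj_conj,
    mul_assoc, mul_assoc]

theorem inner_generatorVec_numberState (ξ : ℂ) (m n : Fin 1 → ℕ) :
    ⟪generatorVec ξ m, numberState n⟫_ℂ = generatorEntry ξ (m 0) (n 0) := by
  have hext : ∀ k l : Fin 1 → ℕ, k = l ↔ k 0 = l 0 := fun k l =>
    ⟨fun h => by rw [h], fun h => by rw [← eq_const k, h, eq_const l]⟩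
  rw [inner_generatorVec, numberState_apply, numberState_apply, generatorEntry]
  simp only [hext, Pi.sub_apply, Pi.add_apply, Pi.single_eq_same]
  congr 1
  · rcases m 0 with _ | k
    · simp
    · rw [Nat.add_sub_cancel, mul_assoc]
      congr 2
      exact if_congr (by omega) rfl rfl
  · by_cases h : n 0 = m 0 + 1
    · simp [h]
    · simp [h, Ne.symm h]

-- Here `ψ` need not lie in the domain: the difference quotient is moved to `t⁻¹ (D† - 1) |m⟩`,
-- which stays bounded by the diagonal estimate and converges weakly to `generatorVec ξ m`.
open Filter Topology in
theorem tendsto_displacement_sub (ξ : ℂ) {D : ℝ → Op 1} (hD : ∀ t, D t ∈ unitary (Op 1))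
    (hent : ∀ t : ℝ, ∀ m n : ℕ, entry (D t) (fun _ => m) (fun _ => n) =
      displacementEntry (t * ξ) m n) (ψ : Fock 1) (m : Fin 1 → ℕ) :
    Tendsto (fun t : ℝ => (t : ℂ)⁻¹ * (D t ψ - ψ) m) (𝓝[≠] 0) (𝓝 ⟪generatorVec ξ m, ψ⟫_ℂ) := by
  set v : ℝ → Fock 1 := fun t => (t : ℂ)⁻¹ • (star (D t) (numberState m) - numberState m) with hv
  have hin : ∀ (t : ℝ) (φ : Fock 1), ⟪v t, φ⟫_ℂ = (t : ℂ)⁻¹ * (D t φ - φ) m := by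
    intro t φ
    rw [hv, inner_smul_left, map_inv₀, Complex.conj_ofReal, inner_sub_left, inner_numberState,
      ContinuousLinearMap.star_eq_adjoint, ContinuousLinearMap.adjoint_inner_left, inner_numberState]
    rfl
  have hmm : ∀ t, ⟪numberState m, D t (numberState m)⟫_ℂ = displacementEntry (t * ξ) (m 0) (m 0) := by
    intro t
    rw [← hent, eq_const]
    rfl
  obtain ⟨M, hM⟩ := eventually_displacementEntry_diag ξ (m 0)
  have hb : ∀ᶠ t : ℝ in 𝓝[≠] 0, ‖v t‖ ≤ Real.sqrt M := by
    filter_upwards [hM.filter_mono nhdsWithin_le_nhds, self_mem_nhdsWithin] with t ht ht0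
    have ht0' : 0 < t ^ 2 := by have : t ≠ 0 := ht0; positivity
    refine Real.le_sqrt_of_sq_le ?_
    rw [hv, norm_smul, mul_pow, norm_inv, Complex.norm_real, inv_pow, Real.norm_eq_abs, sq_abs,
      inv_mul_le_iff₀ ht0', norm_sub_sq (𝕜 := ℂ),
      ContinuousLinearMap.norm_map_of_mem_unitary (Unitary.star_mem (hD t)),
      ContinuousLinearMap.star_eq_adjoint, ContinuousLinearMap.adjoint_inner_left, hmm]
    have h1 : ‖(numberState m : Fock 1)‖ = 1 := by
      rw [numberState, lp.norm_single (by norm_num)]; simp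
    rw [h1]
    simp only [RCLike.re_to_complex]
    linarith
  have h1 : ∀ n, Tendsto (fun t => ⟪v t, numberState n⟫_ℂ) (𝓝[≠] 0)
      (𝓝 ⟪generatorVec ξ m, numberState n⟫_ℂ) := by
    intro n
    have h2 := (hasDerivAt_iff_tendsto_slope.1 (hasDerivAt_displacementEntry ξ (m 0) (n 0)))
    rw [inner_generatorVec_numberState]
    refine h2.congr fun t => ?_
    rw [hin, slope_def_module, sub_zero, Complex.ofReal_zero, zero_mul, displacementEntry_zero,
      ← hent, eq_const, eq_const, entry_eq]
    change _ = _ * (D t (numberState n) m - (numberState n : Fock 1) m)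
    rw [numberState_apply, ← Complex.ofReal_inv, ← Complex.real_smul]
    congr 2
    refine if_congr ⟨fun h => ?_, fun h => by rw [h]⟩ rfl rfl
    rw [← eq_const m, h, eq_const n]
  exact (tendsto_inner_of_tendsto_apply hb h1 ψ).congr fun t => hin t ψ

-- A Fatou argument: finite sums of squared difference quotients are at most `(2 - 2 Re χ(tξ)) / t²
-- ≤ M`, and the bound survives `t → 0`.
open Filter Topology in
theorem IsGaussianState.exists_sum_generator_le {ι : Type*} {ψ : ι → Fock 1} {ρ : Op 1}
    (hρ : IsGaussianState ρ) (h : IsEnsemble ψ ρ) (ξ : ℂ) :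
    ∃ M : ℝ, ∀ u : Finset (ι × (Fin 1 → ℕ)),
      ∑ p ∈ u, ‖⟪generatorVec ξ p.2, ψ p.1⟫_ℂ‖ ^ 2 ≤ M := by
  obtain ⟨M, hM⟩ := hρ.charFun_le ξ
  choose D hD hent using fun t : ℝ => exists_displacement (t * ξ)
  refine ⟨M, fun u => ?_⟩
  have hlim : Tendsto (fun t : ℝ => ∑ p ∈ u, ‖(t : ℂ)⁻¹ * (D t (ψ p.1) - ψ p.1) p.2‖ ^ 2) (𝓝[≠] 0)
      (𝓝 (∑ p ∈ u, ‖⟪generatorVec ξ p.2, ψ p.1⟫_ℂ‖ ^ 2)) :=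
    tendsto_finsetSum _ fun p _ =>
      ((tendsto_displacement_sub ξ hD hent (ψ p.1) p.2).norm).pow 2
  refine le_of_tendsto hlim ?_
  have h1 : ∀ᶠ t : ℝ in 𝓝 0, |t| ≤ 1 := by
    have := Metric.closedBall_mem_nhds (0 : ℝ) one_pos
    filter_upwards [this] with t ht
    simpa using ht
  filter_upwards [h1.filter_mono nhdsWithin_le_nhds, self_mem_nhdsWithin] with t ht ht0
  have ht0' : 0 < t ^ 2 := by have : t ≠ 0 := ht0; positivity
  have h2 := hasSum_joint (h.hasSum_norm_sq_sub (hD t) (hent t))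
  have h3 := sum_le_hasSum u (fun p _ => by positivity) h2
  simp only [norm_mul, mul_pow, norm_inv, Complex.norm_real, inv_pow, Real.norm_eq_abs, sq_abs]
  rw [← Finset.mul_sum, inv_mul_le_iff₀ ht0', mul_comm]
  exact h3.trans (hM t ht)

/-- With `x`, `y` the components of `a† ψ` and `a ψ`, the generators for `ξ = 1` and `ξ = i` give `x
- y` and `i (x + y)`. By the parallelogram law their squares add to `2 (|x|² + |y|²)`, which bounds
`|y|²`. -/
theorem IsGaussianState.summable_joint {ι : Type*} {ψ : ι → Fock 1} {ρ : Op 1}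
    (hρ : IsGaussianState ρ) (h : IsEnsemble ψ ρ) :
    Summable fun p : ι × (Fin 1 → ℕ) => (p.2 0 : ℝ) * ‖ψ p.1 p.2‖ ^ 2 := by
  have hinj : Function.Injective fun p : ι × (Fin 1 → ℕ) => (p.1, p.2 + Pi.single 0 1) :=
    fun p q h => Prod.ext (Prod.mk.inj h).1 (injective_add_single 0 (Prod.mk.inj h).2)
  refine (hinj.summable_iff fun p hp => ?_).1 ?_
  · have : p.2 0 = 0 := notMem_range_add_single fun ⟨m, hm⟩ =>
      hp ⟨(p.1, m), Prod.ext rfl hm⟩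
    simp [this]
  · obtain ⟨M₁, hM₁⟩ := hρ.exists_sum_generator_le h 1
    obtain ⟨M₂, hM₂⟩ := hρ.exists_sum_generator_le h Complex.I
    refine summable_of_sum_le (c := (M₁ + M₂) / 2)
      (fun p => by simp only [Function.comp_apply]; positivity) fun u => ?_
    have h1 : ∀ p : ι × (Fin 1 → ℕ),
        2 * (((fun p : ι × (Fin 1 → ℕ) => (p.2 0 : ℝ) * ‖ψ p.1 p.2‖ ^ 2) ∘
          fun p : ι × (Fin 1 → ℕ) => (p.1, p.2 + Pi.single 0 1)) p) ≤
        ‖⟪generatorVec 1 p.2, ψ p.1⟫_ℂ‖ ^ 2 + ‖⟪generatorVec Complex.I p.2, ψ p.1⟫_ℂ‖ ^ 2 := by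
      intro p
      rw [inner_generatorVec, inner_generatorVec]
      set x := (Real.sqrt (p.2 0) : ℂ) * ψ p.1 (p.2 - Pi.single 0 1)
      set y := (Real.sqrt (p.2 0 + 1) : ℂ) * ψ p.1 (p.2 + Pi.single 0 1) with hy
      have e1 : Complex.I * x - conj Complex.I * y = Complex.I * (x + y) := by
        rw [Complex.conj_I]; ring
      have e2 := parallelogram_law_with_norm ℝ x y
      have e3 : ‖y‖ ^ 2 = (p.2 0 + 1 : ℝ) * ‖ψ p.1 (p.2 + Pi.single 0 1)‖ ^ 2 := by
        rw [hy, norm_mul, mul_pow, Complex.norm_real, Real.norm_eq_abs, sq_abs,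
          Real.sq_sqrt (by positivity)]
      rw [e1, map_one, one_mul, one_mul, norm_mul, Complex.norm_I, one_mul]
      simp only [Function.comp_apply, Pi.add_apply, Pi.single_eq_same, Nat.cast_add, Nat.cast_one]
      rw [← e3]
      nlinarith [sq_nonneg ‖x‖]
    have h2 := (Finset.sum_le_sum fun p (_ : p ∈ u) => h1 p)
    rw [Finset.sum_add_distrib, ← Finset.mul_sum] at h2
    linarith [hM₁ u, hM₂ u]

/-- Every ensemble of a Gaussian state consists of vectors of the domain and has a finite mean
excitation number. -/
theorem IsGaussianState.mem_and_summable {ι : Type*} {ψ : ι → Fock 1} {ρ : Op 1}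
    (hρ : IsGaussianState ρ) (h : IsEnsemble ψ ρ) :
    ∃ hψ : ∀ i, ψ i ∈ excitationDomain 1, Summable fun i => ‖annihilate 0 ⟨ψ i, hψ i⟩‖ ^ 2 := by
  have h1 := (summable_prod_of_nonneg (fun p => by positivity)).1 (hρ.summable_joint h)
  have hψ : ∀ i, ψ i ∈ excitationDomain 1 := fun i => mem_excitationDomain_iff.2 fun j => by
    rw [Subsingleton.elim j 0]; exact h1.1 i
  exact ⟨hψ, h1.2.congr fun i => (hasSum_norm_sq_annihilate 0 ⟨ψ i, hψ i⟩).tsum_eq⟩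

/-! ### Minimisation over the affine Bogoliubov transformations of one mode -/

section

variable {H : Type*} [NormedAddCommGroup H] [InnerProductSpace ℂ H]

theorem inner_sub_proj {f : H} (hf : ‖f‖ = 1) (z : H) : ⟪f, z - ⟪f, z⟫_ℂ • f⟫_ℂ = 0 := by
  rw [inner_sub_right, inner_smul_right, inner_self_eq_norm_sq_to_K, hf]
  simp

theorem norm_sq_sub_proj {f : H} (hf : ‖f‖ = 1) (z : H) :
    ‖z - ⟪f, z⟫_ℂ • f‖ ^ 2 = ‖z‖ ^ 2 - ‖⟪f, z⟫_ℂ‖ ^ 2 := by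
  have h := norm_add_sq_eq_norm_sq_add_norm_sq_of_inner_eq_zero (𝕜 := ℂ) (z - ⟪f, z⟫_ℂ • f)
    (⟪f, z⟫_ℂ • f) (by rw [inner_smul_right, inner_eq_zero_symm.1 (inner_sub_proj hf z), mul_zero])
  rw [sub_add_cancel, norm_smul, hf, mul_one] at h
  nlinarith

theorem norm_sq_comb (c s : ℂ) (x y : H) :
    ‖c • x + s • y‖ ^ 2 =
      ‖c‖ ^ 2 * ‖x‖ ^ 2 + ‖s‖ ^ 2 * ‖y‖ ^ 2 + 2 * (conj c * s * ⟪x, y⟫_ℂ).re := by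
  rw [norm_add_sq (𝕜 := ℂ), norm_smul, norm_smul, inner_smul_left, inner_smul_right]
  simp only [RCLike.re_to_complex, mul_pow, mul_assoc]
  ring

/-- Put `A = |c|² + |s|²` and `B = 2 |c| |s|`, so `A² - B² = 1`. For the best phase the value is `A
μ - B |ν| - 1/2`, and the reversed Cauchy–Schwarz inequality for the Lorentz form bounds it below by
`√(μ² - |ν|²) - 1/2`. The root is positive by Cauchy–Schwarz for `x` and `y`. -/
theorem exists_isMin_bogoliubov_of_centered {x y : H} (hy : ‖y‖ ^ 2 = ‖x‖ ^ 2 + 1) :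
    ∃ c s : ℂ, ‖c‖ ^ 2 - ‖s‖ ^ 2 = 1 ∧ ∀ c' s' : ℂ, ‖c'‖ ^ 2 - ‖s'‖ ^ 2 = 1 →
      ‖c • x + s • y‖ ^ 2 ≤ ‖c' • x + s' • y‖ ^ 2 := by
  set ν := ⟪x, y⟫_ℂ with hν
  set μ := ‖x‖ ^ 2 + 1 / 2 with hμ
  have hν2 : ‖ν‖ ^ 2 ≤ μ ^ 2 - 1 / 4 := by
    have h1 := pow_le_pow_left₀ (norm_nonneg _) (norm_inner_le_norm (𝕜 := ℂ) x y) 2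
    rw [mul_pow, hy] at h1
    rw [hμ]
    linarith
  have hμ0 : 0 < μ := by positivity
  set r := Real.sqrt (μ ^ 2 - ‖ν‖ ^ 2) with hr
  have hr2 : r ^ 2 = μ ^ 2 - ‖ν‖ ^ 2 := Real.sq_sqrt (by linarith)
  have hr0 : 0 < r := Real.sqrt_pos.2 (by linarith)
  -- Equality requires `A = μ / r`, hence `|c|² = (A + 1) / 2 = k²`; the phase of `s` makes the
  -- cross term negative.
  set k := Real.sqrt ((μ + r) / (2 * r)) with hk
  have hk2 : k ^ 2 = (μ + r) / (2 * r) := Real.sq_sqrt (by positivity)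
  have hk0 : 0 < k := Real.sqrt_pos.2 (by positivity)
  have hs2 : ‖-conj ν / ((2 * r * k : ℝ) : ℂ)‖ ^ 2 = (μ - r) / (2 * r) := by
    rw [norm_div, norm_neg, RCLike.norm_conj, Complex.norm_real, div_pow, Real.norm_eq_abs, sq_abs,
      mul_pow, hk2]
    have : ‖ν‖ ^ 2 = (μ - r) * (μ + r) := by linarith
    rw [this]
    field_simp
  have hval : ∀ c s : ℂ, ‖c‖ ^ 2 - ‖s‖ ^ 2 = 1 → ‖c • x + s • y‖ ^ 2 =
      (‖c‖ ^ 2 + ‖s‖ ^ 2) * μ - 1 / 2 + 2 * (conj c * s * ν).re := by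
    intro c s hcs
    rw [norm_sq_comb, hy, hμ]
    linear_combination (-1 / 2 : ℝ) * hcs
  have hcs : ‖(k : ℂ)‖ ^ 2 - ‖-conj ν / ((2 * r * k : ℝ) : ℂ)‖ ^ 2 = 1 := by
    rw [hs2, Complex.norm_real, Real.norm_eq_abs, sq_abs, hk2]
    field_simp
    ring
  refine ⟨(k : ℂ), -conj ν / ((2 * r * k : ℝ) : ℂ), hcs, fun c' s' h' => ?_⟩
  have hmin : ‖(k : ℂ) • x + (-conj ν / ((2 * r * k : ℝ) : ℂ)) • y‖ ^ 2 = r - 1 / 2 := by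
    rw [hval _ _ hcs, hs2, Complex.norm_real, Real.norm_eq_abs, sq_abs, hk2]
    have h1 : conj (k : ℂ) * (-conj ν / ((2 * r * k : ℝ) : ℂ)) * ν =
        ((-‖ν‖ ^ 2 / (2 * r) : ℝ) : ℂ) := by
      have h2 : conj ν * ν = ((‖ν‖ ^ 2 : ℝ) : ℂ) := by
        rw [mul_comm, Complex.mul_conj, Complex.normSq_eq_norm_sq]
      have h3 : (k : ℂ) ≠ 0 := Complex.ofReal_ne_zero.2 hk0.ne'
      have h4 : (r : ℂ) ≠ 0 := Complex.ofReal_ne_zero.2 hr0.ne'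
      rw [Complex.conj_ofReal]
      push_cast at h2 ⊢
      field_simp
      linear_combination -h2
    rw [h1, Complex.ofReal_re]
    field_simp
    nlinarith
  rw [hmin, hval c' s' h']
  have h1 : -(‖c'‖ * ‖s'‖ * ‖ν‖) ≤ (conj c' * s' * ν).re := by
    have h2 := (abs_le.1 (Complex.abs_re_le_norm (conj c' * s' * ν))).1
    rwa [norm_mul, norm_mul, RCLike.norm_conj] at h2
  have hle : ‖ν‖ ≤ μ := by
    refine le_of_sq_le_sq ?_ hμ0.le
    linarith
  -- The difference of the squares of the two sides is `(A |ν| - B μ)²`.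
  have h3 : r ≤ (‖c'‖ ^ 2 + ‖s'‖ ^ 2) * μ - 2 * (‖c'‖ * ‖s'‖) * ‖ν‖ := by
    refine le_of_sq_le_sq ?_ ?_
    · have e : (‖c'‖ ^ 2 + ‖s'‖ ^ 2) ^ 2 - (2 * (‖c'‖ * ‖s'‖)) ^ 2 = 1 := by
        have : (‖c'‖ ^ 2 - ‖s'‖ ^ 2) ^ 2 = 1 := by rw [h']; norm_num
        linarith
      have e2 : r ^ 2 = ((‖c'‖ ^ 2 + ‖s'‖ ^ 2) ^ 2 - (2 * (‖c'‖ * ‖s'‖)) ^ 2) *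
          (μ ^ 2 - ‖ν‖ ^ 2) := by rw [e, hr2, one_mul]
      rw [e2]
      nlinarith [sq_nonneg ((‖c'‖ ^ 2 + ‖s'‖ ^ 2) * ‖ν‖ - 2 * (‖c'‖ * ‖s'‖) * μ)]
    · have e : 2 * (‖c'‖ * ‖s'‖) ≤ ‖c'‖ ^ 2 + ‖s'‖ ^ 2 := by
        nlinarith [sq_nonneg (‖c'‖ - ‖s'‖)]
      have := mul_le_mul e hle (norm_nonneg _) (by positivity)
      linarith
  linarith

/-- The optimal `d` cancels the component along `f`. The components of `x` and `y` along `f` have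
equal modulus, so centring preserves `‖y‖² = ‖x‖² + 1`. -/
theorem exists_isMin_bogoliubov {f x y : H} (hf : ‖f‖ = 1) (hy : ‖y‖ ^ 2 = ‖x‖ ^ 2 + 1)
    (hfy : ⟪f, y⟫_ℂ = conj ⟪f, x⟫_ℂ) :
    ∃ c s d : ℂ, ‖c‖ ^ 2 - ‖s‖ ^ 2 = 1 ∧ ∀ c' s' d' : ℂ, ‖c'‖ ^ 2 - ‖s'‖ ^ 2 = 1 →
      ‖c • x + s • y + d • f‖ ^ 2 ≤ ‖c' • x + s' • y + d' • f‖ ^ 2 := by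
  have hx' := norm_sq_sub_proj hf x
  have hy' := norm_sq_sub_proj hf y
  rw [hfy, RCLike.norm_conj, hy] at hy'
  obtain ⟨c, s, hcs, hmin⟩ := exists_isMin_bogoliubov_of_centered
    (x := x - ⟪f, x⟫_ℂ • f) (y := y - conj ⟪f, x⟫_ℂ • f) (by linarith)
  refine ⟨c, s, -(c * ⟪f, x⟫_ℂ + s * conj ⟪f, x⟫_ℂ), hcs, fun c' s' d' h' => ?_⟩
  have h1 : ∀ c s : ℂ, ⟪f, c • (x - ⟪f, x⟫_ℂ • f) + s • (y - conj ⟪f, x⟫_ℂ • f)⟫_ℂ = 0 := by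
    intro c s
    rw [← hfy, inner_add_right, inner_smul_right, inner_smul_right, inner_sub_proj hf,
      inner_sub_proj hf]
    simp
  have e1 : c • x + s • y + (-(c * ⟪f, x⟫_ℂ + s * conj ⟪f, x⟫_ℂ)) • f =
      c • (x - ⟪f, x⟫_ℂ • f) + s • (y - conj ⟪f, x⟫_ℂ • f) := by module
  have e2 : c' • x + s' • y + d' • f =
      (c' • (x - ⟪f, x⟫_ℂ • f) + s' • (y - conj ⟪f, x⟫_ℂ • f)) +
        (d' + (c' * ⟪f, x⟫_ℂ + s' * conj ⟪f, x⟫_ℂ)) • f := by module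
  have e3 := norm_add_sq_eq_norm_sq_add_norm_sq_of_inner_eq_zero (𝕜 := ℂ)
    (c' • (x - ⟪f, x⟫_ℂ • f) + s' • (y - conj ⟪f, x⟫_ℂ • f))
    ((d' + (c' * ⟪f, x⟫_ℂ + s' * conj ⟪f, x⟫_ℂ)) • f)
    (by rw [inner_smul_right, inner_eq_zero_symm.1 (h1 c' s'), mul_zero])
  rw [e1, e2]
  refine (hmin c' s' h').trans ?_
  nlinarith [sq_nonneg ‖(d' + (c' * ⟪f, x⟫_ℂ + s' * conj ⟪f, x⟫_ℂ)) • f‖]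

end

/-! ### Action of Gaussian unitary operators on the ladder operators -/

theorem IsGaussianUnitary.inner_map {J : ℕ} {W : Op J} (hW : IsGaussianUnitary W) (φ ψ : Fock J) :
    ⟪W φ, W ψ⟫_ℂ = ⟪φ, ψ⟫_ℂ := by
  rw [← ContinuousLinearMap.adjoint_inner_right, ← ContinuousLinearMap.star_eq_adjoint,
    ← mul_apply_eq_comp, Unitary.star_mul_self_of_mem hW.unitary]
  rfl

/-- The image of a domain vector under a Gaussian unitary operator. -/
def IsGaussianUnitary.map {J : ℕ} {W : Op J} (hW : IsGaussianUnitary W) (ψ : excitationDomain J) :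
    excitationDomain J := ⟨W ψ, (hW.mem_iff ψ).2 ψ.2⟩

theorem IsGaussianUnitary.exists_annihilate {J : ℕ} {W : Op J} (hW : IsGaussianUnitary W)
    (j : Fin J) :
    ∃ (p q : Fin J → ℂ) (d : ℂ), ∑ k, (‖p k‖ ^ 2 - ‖q k‖ ^ 2) = 1 ∧
      ∀ ψ, annihilate j (hW.map ψ) = W (field p q d ψ) := by
  obtain ⟨C, S, d, h1, -, h3⟩ := hW.bogoliubov
  refine ⟨fun k => conj (C j k), S j, d j, ?_, fun ψ => ?_⟩
  · have := congrFun (congrFun h1 j) j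
    rw [Matrix.sub_apply, Matrix.map_apply, Matrix.mul_apply, Matrix.mul_apply, Matrix.one_apply_eq,
      map_sum, ← Finset.sum_sub_distrib] at this
    have h4 := congrArg Complex.re this
    rw [Complex.re_sum, Complex.one_re] at h4
    rw [← h4]
    refine Finset.sum_congr rfl fun k _ => ?_
    simp only [Matrix.conjTranspose_apply, RCLike.star_def]
    rw [map_mul, RCLike.conj_conj, mul_comm (conj (S j k)), Complex.mul_conj, Complex.mul_conj,
      Complex.normSq_eq_norm_sq, Complex.normSq_eq_norm_sq, RCLike.norm_conj,
      Complex.sub_re, Complex.ofReal_re, Complex.ofReal_re]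
  · rw [field_apply]
    exact h3 j ψ

/-- Adjoint of the relation for `a_j`, tested against number states; their preimages under `W` lie
in the domain. -/
theorem IsGaussianUnitary.create_map {J : ℕ} {W : Op J} (hW : IsGaussianUnitary W) {j : Fin J}
    {p q : Fin J → ℂ} {d : ℂ} (h : ∀ ψ, annihilate j (hW.map ψ) = W (field p q d ψ))
    (ψ : excitationDomain J) :
    create j (hW.map ψ) = W (field (star q) (star p) (conj d) ψ) := by
  refine ext_inner_numberState fun n => ?_
  have h1 : W (star W (numberState n)) = numberState n := by
    rw [← mul_apply_eq_comp, Unitary.mul_star_self_of_mem hW.unitary]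
    rfl
  have h2 : star W (numberState n) ∈ excitationDomain J := by
    rw [← hW.mem_iff, h1]
    exact numberState_mem n
  have h3 := inner_annihilate j (hW.map ⟨_, h2⟩) (hW.map ψ)
  rw [h] at h3
  change _ = ⟪W (star W (numberState n)), _⟫_ℂ at h3
  change ⟪W _, W ψ⟫_ℂ = _ at h3
  rw [hW.inner_map, inner_field, h1] at h3
  rw [← h3]
  nth_rw 2 [← h1]
  rw [hW.inner_map]

/-! ### Attainment of the thermal excitation -/

/-- A square-summable family as an element of the direct sum of Hilbert spaces. -/
def directSum {ι E : Type*} [NormedAddCommGroup E] (v : ι → E) (h : Summable fun i => ‖v i‖ ^ 2) :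
    lp (fun _ : ι => E) 2 :=
  ⟨v, (memℓp_gen_iff (by norm_num)).2 (by simpa using h)⟩

theorem hasSum_norm_sq_lp {ι E : Type*} [NormedAddCommGroup E] (v : lp (fun _ : ι => E) 2) :
    HasSum (fun i => ‖v i‖ ^ 2) (‖v‖ ^ 2) := by
  simpa using lp.hasSum_norm (p := 2) (by norm_num) v

section

variable {ι : Type*} {χ : ι → excitationDomain 1} {ρ : Op 1}

theorem IsEnsemble.meanExcitation_evolve (h : IsEnsemble (fun i => (χ i : Fock 1)) ρ) {W : Op 1}
    (hW : IsGaussianUnitary W) {p q : Fin 1 → ℂ} {d : ℂ}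
    (hf : ∀ ψ, annihilate 0 (hW.map ψ) = W (field p q d ψ)) :
    meanExcitation (Bosonic.evolve W ρ) = ∑' i, ENNReal.ofReal (‖field p q d (χ i)‖ ^ 2) := by
  rw [IsEnsemble.meanExcitation_eq_annihilate (ψ := fun i => hW.map (χ i)) (h.evolve hW.unitary)]
  congr! 3 with i
  rw [hf, ContinuousLinearMap.norm_map_of_mem_unitary hW.unitary]

/-- The families `χ_i`, `a χ_i` and `a† χ_i` become the vectors `f`, `x`, `y` of one direct sum, so
second moments of the mixed state are inner products. -/
theorem IsEnsemble.exists_moments (h : IsEnsemble (fun i => (χ i : Fock 1)) ρ)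
    (ha : Summable fun i => ‖annihilate 0 (χ i)‖ ^ 2) :
    ∃ f x y : lp (fun _ : ι => Fock 1) 2, ‖f‖ = 1 ∧ ‖y‖ ^ 2 = ‖x‖ ^ 2 + 1 ∧
      ⟪f, y⟫_ℂ = conj ⟪f, x⟫_ℂ ∧ ∀ c s d : ℂ,
      HasSum (fun i => ‖field (fun _ => c) (fun _ => s) d (χ i)‖ ^ 2)
        (‖c • x + s • y + d • f‖ ^ 2) := by
  have hc : HasSum (fun i => ‖create 0 (χ i)‖ ^ 2) ((∑' i, ‖annihilate 0 (χ i)‖ ^ 2) + 1) :=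
    (ha.hasSum.add h.norm).congr_fun fun i => norm_sq_create 0 (χ i)
  set f := directSum (fun i => (χ i : Fock 1)) h.norm.summable
  set x := directSum (fun i => annihilate 0 (χ i)) ha
  set y := directSum (fun i => create 0 (χ i)) hc.summable
  have hf1 : ‖f‖ ^ 2 = 1 := (hasSum_norm_sq_lp f).unique h.norm
  refine ⟨f, x, y, ?_, ?_, ?_, fun c s d => ?_⟩
  · rw [← pow_left_inj₀ (norm_nonneg _) zero_le_one two_ne_zero, hf1, one_pow]
  · rw [(hasSum_norm_sq_lp x).unique ha.hasSum]
    exact (hasSum_norm_sq_lp y).unique hc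
  · rw [inner_conj_symm]
    refine (lp.hasSum_inner f y).unique ?_
    exact (lp.hasSum_inner x f).congr_fun fun i => (inner_annihilate 0 (χ i) (χ i)).symm
  · refine (hasSum_norm_sq_lp _).congr_fun fun i => ?_
    rw [field_one]
    rfl

/-- Each Gaussian unitary yields an admissible triple `(c, s, d)`, and the minimising triple is
realised by a unitary; hence the infimum over unitaries is the minimum of the quadratic expression.
-/
theorem IsEnsemble.isLeast_thermalExcitation (h : IsEnsemble (fun i => (χ i : Fock 1)) ρ)
    (ha : Summable fun i => ‖annihilate 0 (χ i)‖ ^ 2) :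
    thermalExcitation ρ ≠ ⊤ ∧
      IsLeast ((fun U => meanExcitation (Bosonic.evolve U ρ)) '' gaussianUnitaries 1)
        (thermalExcitation ρ) := by
  obtain ⟨f, x, y, hf, hy, hfy, hsum⟩ := h.exists_moments ha
  have hval : ∀ (W : Op 1) (hW : IsGaussianUnitary W) (c s d : ℂ),
      (∀ ψ, annihilate 0 (hW.map ψ) = W (field (fun _ => c) (fun _ => s) d ψ)) →
      meanExcitation (Bosonic.evolve W ρ) = ENNReal.ofReal (‖c • x + s • y + d • f‖ ^ 2) := by
    intro W hW c s d hWf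
    rw [h.meanExcitation_evolve hW hWf, ← (hsum c s d).tsum_eq,
      ENNReal.ofReal_tsum_of_nonneg (fun _ => by positivity) (hsum c s d).summable]
  obtain ⟨c, s, d, hcs, hmin⟩ := exists_isMin_bogoliubov hf hy hfy
  obtain ⟨W, hW, hWf⟩ := exists_gaussianUnitary hcs d
  have hle : ∀ U ∈ gaussianUnitaries 1,
      meanExcitation (Bosonic.evolve W ρ) ≤ meanExcitation (Bosonic.evolve U ρ) := by
    intro U hU
    obtain ⟨p, q, e, hpq, hUf⟩ := IsGaussianUnitary.exists_annihilate hU 0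
    have hp : p = fun _ => p 0 := funext fun i => by rw [Subsingleton.elim i 0]
    have hq : q = fun _ => q 0 := funext fun i => by rw [Subsingleton.elim i 0]
    rw [hp, hq] at hUf
    rw [hval W hW c s d hWf, hval U hU _ _ _ hUf]
    exact ENNReal.ofReal_le_ofReal (hmin _ _ _ (by simpa using hpq))
  have heq : thermalExcitation ρ = meanExcitation (Bosonic.evolve W ρ) :=
    le_antisymm (iInf₂_le W hW) (le_iInf₂ hle)
  rw [heq]
  refine ⟨?_, ⟨W, hW, rfl⟩, ?_⟩
  · rw [hval W hW c s d hWf]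
    exact ENNReal.ofReal_ne_top
  · rintro _ ⟨U, hU, rfl⟩
    exact hle U hU

theorem IsEnsemble.thermalExcitation_le (h : IsEnsemble (fun i => (χ i : Fock 1)) ρ)
    {c s : ℂ} (hcs : ‖c‖ ^ 2 - ‖s‖ ^ 2 = 1) (d : ℂ) :
    thermalExcitation ρ ≤
      ∑' i, ENNReal.ofReal (‖field (fun _ => c) (fun _ => s) d (χ i)‖ ^ 2) := by
  obtain ⟨W, hW, hWf⟩ := exists_gaussianUnitary hcs d
  rw [← h.meanExcitation_evolve hW hWf]
  exact iInf₂_le W hW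

end

/-! ### Product vectors and tensor products -/

theorem summable_norm_and_hasSum_prod {R : Type*} [NormedField R] [CompleteSpace R] {α : Type*}
    {J : ℕ} (f : Fin J → α → R) (hf : ∀ j, Summable fun a => ‖f j a‖) :
    (Summable fun x : Fin J → α => ‖∏ j, f j (x j)‖) ∧
      HasSum (fun x : Fin J → α => ∏ j, f j (x j)) (∏ j, ∑' a, f j a) := by
  induction J with
  | zero => exact ⟨(hasSum_unique _).summable, by simp⟩
  | succ J ih =>
    obtain ⟨h1, h2⟩ := ih (fun j => f j.succ) fun j => hf j.succ
    have e : ∀ p : α × (Fin J → α), ∏ j, f j (Fin.consEquiv (fun _ => α) p j) =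
        f 0 p.1 * ∏ j : Fin J, f j.succ (p.2 j) := fun p => by
      rw [Fin.prod_univ_succ]; rfl
    have h3 := (hf 0).mul_norm h1
    refine ⟨(Fin.consEquiv fun _ => α).summable_iff.1 (h3.congr fun p => ?_),
      (Fin.consEquiv fun _ => α).hasSum_iff.1 ?_⟩
    · rw [Function.comp_apply, e]
    · have h4 := (Summable.of_norm h3).hasSum
      rw [← tsum_mul_tsum_of_summable_norm (hf 0) h1, h2.tsum_eq] at h4
      rw [Fin.prod_univ_succ]
      exact h4.congr_fun fun p => e p

theorem hasSum_prod {R : Type*} [NormedField R] [CompleteSpace R] {α : Type*} {J : ℕ}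
    {f : Fin J → α → R} {x : Fin J → R} (hf : ∀ j, Summable fun a => ‖f j a‖)
    (hx : ∀ j, HasSum (f j) (x j)) :
    HasSum (fun k : Fin J → α => ∏ j, f j (k j)) (∏ j, x j) := by
  have := (summable_norm_and_hasSum_prod f hf).2
  simpa only [(hx _).tsum_eq] using this

theorem hasSum_prod_real {α : Type*} {J : ℕ} {f : Fin J → α → ℝ} {x : Fin J → ℝ}
    (hx : ∀ j, HasSum (f j) (x j)) :
    HasSum (fun k : Fin J → α => ∏ j, f j (k j)) (∏ j, x j) :=
  hasSum_prod (fun j => (hx j).summable.norm) hx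

theorem hasSum_nat_apply {φ : Fock 1} :
    HasSum (fun n : ℕ => ‖φ fun _ => n‖ ^ 2) (‖φ‖ ^ 2) :=
  (Equiv.funUnique (Fin 1) ℕ).symm.hasSum_iff.2 (hasSum_norm_sq φ)

theorem hasSum_prod_norm_sq {J : ℕ} (v : Fin J → Fock 1) :
    HasSum (fun m : Fin J → ℕ => ‖∏ j, v j fun _ => m j‖ ^ 2) (∏ j, ‖v j‖ ^ 2) := by
  simp only [norm_prod, ← Finset.prod_pow]
  exact hasSum_prod_real (f := fun j (n : ℕ) => ‖v j fun _ => n‖ ^ 2)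
    fun j => hasSum_nat_apply

/-- The product vector `v_1 ⊗ ⋯ ⊗ v_J`. -/
def prodVec {J : ℕ} (v : Fin J → Fock 1) : Fock J :=
  ⟨fun m => ∏ j, v j fun _ => m j, (memlp_iff _).2 (hasSum_prod_norm_sq v).summable⟩

theorem prodVec_apply {J : ℕ} (v : Fin J → Fock 1) (m : Fin J → ℕ) :
    prodVec v m = ∏ j, v j fun _ => m j := rfl

theorem norm_sq_prodVec {J : ℕ} (v : Fin J → Fock 1) : ‖prodVec v‖ ^ 2 = ∏ j, ‖v j‖ ^ 2 :=
  (hasSum_norm_sq _).unique (hasSum_prod_norm_sq v)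

theorem inner_prodVec {J : ℕ} (v w : Fin J → Fock 1) :
    ⟪prodVec v, prodVec w⟫_ℂ = ∏ j, ⟪v j, w j⟫_ℂ := by
  have h : ∀ j, HasSum (fun n : ℕ => conj (v j fun _ => n) * w j fun _ => n) ⟪v j, w j⟫_ℂ :=
    fun j => (Equiv.funUnique (Fin 1) ℕ).symm.hasSum_iff.2 (hasSum_inner_apply (v j) (w j))
  refine (hasSum_inner_apply _ _).unique ?_
  refine (hasSum_prod (fun j => (h j).summable.norm) h).congr_fun fun m => ?_
  rw [prodVec_apply, prodVec_apply, map_prod, ← Finset.prod_mul_distrib]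

theorem prodVec_update_apply {J : ℕ} (v : Fin J → Fock 1) (j : Fin J) (z : Fock 1)
    (m : Fin J → ℕ) :
    prodVec (Function.update v j z) m =
      (z fun _ => m j) * ∏ i ∈ Finset.univ.erase j, v i fun _ => m i := by
  rw [prodVec_apply, ← Finset.mul_prod_erase _ _ (Finset.mem_univ j), Function.update_self]
  congr 1
  refine Finset.prod_congr rfl fun i hi => ?_
  rw [Function.update_of_ne (Finset.ne_of_mem_erase hi)]

theorem prodVec_eq_mul {J : ℕ} (v : Fin J → Fock 1) (j : Fin J) (m : Fin J → ℕ) :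
    prodVec v m = (v j fun _ => m j) * ∏ i ∈ Finset.univ.erase j, v i fun _ => m i := by
  rw [← prodVec_update_apply, Function.update_eq_self]

theorem prodVec_mem {J : ℕ} {v : Fin J → Fock 1} (h : ∀ j, v j ∈ excitationDomain 1) :
    prodVec v ∈ excitationDomain J := by
  rw [mem_excitationDomain_iff]
  intro j
  -- The weight `m j` is itself a product over the modes, with factor `1` away from `j`.
  have h1 : ∀ i, Summable fun n : ℕ => (if i = j then (n : ℝ) else 1) * ‖v i fun _ => n‖ ^ 2 := by
    intro i
    split_ifs with hi
    · have h2 := (Equiv.funUnique (Fin 1) ℕ).symm.summable_iff.2 (summable_mode 0 (h i))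
      exact h2.congr fun n => rfl
    · simpa only [one_mul] using hasSum_nat_apply.summable
  refine (hasSum_prod_real fun i => (h1 i).hasSum).summable.congr fun m => ?_
  rw [Finset.prod_mul_distrib, prodVec_apply, norm_prod, Finset.prod_pow]
  simp

theorem annihilate_prodVec {J : ℕ} {v : Fin J → Fock 1} (h : ∀ j, v j ∈ excitationDomain 1)
    (j : Fin J) :
    annihilate j ⟨prodVec v, prodVec_mem h⟩ =
      prodVec (Function.update v j (annihilate 0 ⟨v j, h j⟩)) := by
  ext m
  rw [annihilate_apply, prodVec_update_apply, annihilate_apply, prodVec_eq_mul v j, mul_assoc]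
  congr 2
  · refine congrArg (fun x => v j x) (funext fun i => ?_)
    rw [Subsingleton.elim i 0]
    simp
  · refine Finset.prod_congr rfl fun i hi => ?_
    simp [Finset.ne_of_mem_erase hi]

theorem create_prodVec {J : ℕ} {v : Fin J → Fock 1} (h : ∀ j, v j ∈ excitationDomain 1)
    (j : Fin J) :
    create j ⟨prodVec v, prodVec_mem h⟩ =
      prodVec (Function.update v j (create 0 ⟨v j, h j⟩)) := by
  ext m
  rw [create_apply, prodVec_update_apply, create_apply, prodVec_eq_mul v j, mul_assoc]
  congr 2
  · refine congrArg (fun x => v j x) (funext fun i => ?_)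
    rw [Subsingleton.elim i 0]
    simp
  · refine Finset.prod_congr rfl fun i hi => ?_
    simp [Finset.ne_of_mem_erase hi]

theorem prodVec_update_field {J : ℕ} {v : Fin J → Fock 1} (h : ∀ j, v j ∈ excitationDomain 1)
    (j : Fin J) (p q d : ℂ) :
    prodVec (Function.update v j (field (fun _ => p) (fun _ => q) d ⟨v j, h j⟩)) =
      p • annihilate j ⟨prodVec v, prodVec_mem h⟩ + q • create j ⟨prodVec v, prodVec_mem h⟩ +
        d • prodVec v := by
  rw [annihilate_prodVec h, create_prodVec h, field_one]
  ext m
  change _ = p * prodVec _ m + q * prodVec _ m + d * prodVec _ m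
  rw [prodVec_update_apply, prodVec_update_apply, prodVec_update_apply, prodVec_eq_mul v j]
  change (p * _ + q * _ + d * _) * _ = _
  ring

theorem splitMode_symm_apply {J : ℕ} (i : Fin J) (p : Fin 1 → ℕ) (n : Fin J → ℕ) :
    (splitMode i).symm (p, (splitMode i n).2) = Function.update n i (p 0) := by
  rw [Equiv.symm_apply_eq]
  refine Prod.ext ?_ ?_
  · funext k
    rw [Subsingleton.elim k 0]
    change p 0 = Function.update n i (p 0) i
    simp
  · funext k
    change n k = Function.update n i (p 0) k
    rw [Function.update_of_ne k.2]

theorem slice_apply {J : ℕ} (i : Fin J) (k : {j : Fin J // j ≠ i} → ℕ) (ψ : Fock J)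
    (m : Fin 1 → ℕ) : slice i k ψ m = ψ ((splitMode i).symm (m, k)) := rfl

/-- Induction over the modes already acted on, the others contributing Kronecker deltas.
Distinctness ensures that mode `i` is still in `|n_i⟩` when its operator is applied. -/
theorem prod_onMode_apply {J : ℕ} (ρ : Fin J → Op 1) (n : Fin J → ℕ) {l : List (Fin J)}
    (hl : l.Nodup) (m : Fin J → ℕ) :
    (l.map fun i => onMode i (ρ i)).prod (numberState n) m =
      ∏ j, if j ∈ l then entry (ρ j) (fun _ => m j) (fun _ => n j)
        else if m j = n j then 1 else 0 := by
  induction l generalizing m with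
  | nil =>
    simp only [List.map_nil, List.prod_nil, List.not_mem_nil, if_false]
    change (numberState n : Fock J) m = _
    rw [numberState_apply, Finset.prod_ite_zero]
    simp [funext_iff]
  | cons i l ih =>
    obtain ⟨hi, hl⟩ := List.nodup_cons.1 hl
    rw [List.map_cons, List.prod_cons, mul_apply_eq_comp]
    set χ := (l.map fun i => onMode i (ρ i)).prod (numberState n)
    set c : ℂ := ∏ j ∈ Finset.univ.erase i, if j ∈ l then
      entry (ρ j) (fun _ => m j) (fun _ => n j) else if m j = n j then 1 else 0 with hc
    have h1 : slice i (splitMode i m).2 χ = c • numberState fun _ => n i := by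
      ext p
      change _ = c * (numberState (fun _ => n i) : Fock 1) p
      rw [slice_apply, splitMode_symm_apply, ih hl, ← Finset.mul_prod_erase _ _ (Finset.mem_univ i),
        if_neg hi, Function.update_self, numberState_apply, mul_comm, hc]
      congr 1
      · refine Finset.prod_congr rfl fun j hj => ?_
        rw [Function.update_of_ne (Finset.ne_of_mem_erase hj)]
      · refine if_congr ⟨fun h => ?_, fun h => by rw [h]⟩ rfl rfl
        rw [← eq_const p, h]
    change ρ i (slice i (splitMode i m).2 χ) (splitMode i m).1 = _
    rw [h1, map_smul, ← Finset.mul_prod_erase _ _ (Finset.mem_univ i), if_pos List.mem_cons_self,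
      entry_eq]
    change c * _ = _
    rw [mul_comm]
    congr 1
    rw [hc]
    refine Finset.prod_congr rfl fun j hj => ?_
    simp only [List.mem_cons, Finset.ne_of_mem_erase hj, false_or]

theorem entry_tensor {J : ℕ} (ρ : Fin J → Op 1) (m n : Fin J → ℕ) :
    entry (tensor ρ) m n = ∏ j, entry (ρ j) (fun _ => m j) (fun _ => n j) := by
  rw [entry_eq, tensor, List.ofFn_eq_map, prod_onMode_apply ρ n (List.nodup_finRange J)]
  simp

theorem IsEnsemble.tensor {J : ℕ} {ι : Type*} {β : Fin J → ι → Fock 1} {ρ : Fin J → Op 1}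
    (h : ∀ j, IsEnsemble (β j) (ρ j)) :
    IsEnsemble (fun k : Fin J → ι => prodVec fun j => β j (k j)) (tensor ρ) := by
  refine IsEnsemble.of_entry ?_ fun m n => ?_
  · have h1 := hasSum_prod_real (f := fun j i => ‖β j i‖ ^ 2) fun j => (h j).norm
    rw [Finset.prod_const_one] at h1
    exact h1.congr_fun fun k => norm_sq_prodVec _
  · rw [entry_tensor]
    have h1 := fun j => (h j).hasSum_entry (fun _ => m j) (fun _ => n j)
    refine (hasSum_prod (fun j => (h1 j).summable.norm) h1).congr_fun fun k => ?_
    rw [prodVec_apply, prodVec_apply, map_prod, ← Finset.prod_mul_distrib]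

/-! ### The mean excitation number of a Bogoliubov mode in a product state -/

theorem sum_norm_sq_le_of_orthogonal {H : Type*} [NormedAddCommGroup H] [InnerProductSpace ℂ H]
    {J : ℕ} {z : Fin J → H} {f : H} (hz : ∀ j l, j ≠ l → ⟪z j, z l⟫_ℂ = 0)
    (hf : ∀ j, ⟪z j, f⟫_ℂ = 0) : ∑ j, ‖z j‖ ^ 2 ≤ ‖∑ j, z j + f‖ ^ 2 := by
  have h1 : ⟪∑ j, z j, f⟫_ℂ = 0 := by rw [sum_inner]; exact Finset.sum_eq_zero fun j _ => hf j
  have h2 := norm_add_sq_eq_norm_sq_add_norm_sq_of_inner_eq_zero (𝕜 := ℂ) _ _ h1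
  have h3 : ‖∑ j, z j‖ ^ 2 = ∑ j, ‖z j‖ ^ 2 := by
    have h4 : ⟪∑ j, z j, ∑ j, z j⟫_ℂ = ∑ j, ⟪z j, z j⟫_ℂ := by
      rw [sum_inner]
      refine Finset.sum_congr rfl fun j _ => ?_
      rw [inner_sum]
      exact Finset.sum_eq_single j (fun l _ hl => hz j l hl.symm) (by simp)
    simp only [inner_self_eq_norm_sq_to_K] at h4
    exact_mod_cast h4
  nlinarith [sq_nonneg ‖f‖]

/-- The correlations of centred observables of different modes vanish in a product state. -/
theorem hasSum_inner_prodVec_eq_zero {J : ℕ} {ι : Type*} {u w : Fin J → ι → Fock 1} {j : Fin J}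
    (hu : ∀ l, Summable fun i => ‖u l i‖ ^ 2) (hw : ∀ l, Summable fun i => ‖w l i‖ ^ 2)
    (h0 : HasSum (fun i => ⟪u j i, w j i⟫_ℂ) 0) :
    HasSum (fun k : Fin J → ι => ⟪prodVec fun l => u l (k l), prodVec fun l => w l (k l)⟫_ℂ) 0 := by
  have h1 : ∀ l, Summable fun i => ‖⟪u l i, w l i⟫_ℂ‖ := by
    intro l
    refine Summable.of_nonneg_of_le (fun _ => norm_nonneg _) (fun i => ?_) ((hu l).add (hw l))
    refine (norm_inner_le_norm _ _).trans ?_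
    nlinarith [sq_nonneg (‖u l i‖ - ‖w l i‖), sq_nonneg (‖u l i‖ + ‖w l i‖)]
  have h2 := (summable_norm_and_hasSum_prod (fun l i => ⟪u l i, w l i⟫_ℂ) h1).2
  rw [Finset.prod_eq_zero (Finset.mem_univ j) h0.tsum_eq] at h2
  exact h2.congr_fun fun k => inner_prodVec _ _

section

variable {J : ℕ} {ι : Type*} {β : Fin J → ι → excitationDomain 1} {ρ : Fin J → Op 1}

/-- The product ensemble, as a family of domain vectors. -/
def prodFamily (β : Fin J → ι → excitationDomain 1) (k : Fin J → ι) : excitationDomain J :=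
  ⟨prodVec fun j => (β j (k j) : Fock 1), prodVec_mem fun j => (β j (k j)).2⟩

variable (h : ∀ j, IsEnsemble (fun i => (β j i : Fock 1)) (ρ j))
  (ha : ∀ j, Summable fun i => ‖annihilate 0 (β j i)‖ ^ 2)

include h ha

theorem summable_norm_sq_field (j : Fin J) (c s d : ℂ) :
    Summable fun i => ‖field (fun _ => c) (fun _ => s) d (β j i)‖ ^ 2 := by
  obtain ⟨f, x, y, -, -, -, hsum⟩ := (h j).exists_moments (ha j)
  exact (hsum c s d).summable

/-- The sum factorises over the modes, and the ensembles of the untouched modes contribute `1` each.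
-/
theorem hasSum_norm_sq_single_field (j : Fin J) (c s d : ℂ) :
    HasSum (fun k : Fin J → ι => ‖prodVec (Function.update (fun j => (β j (k j) : Fock 1)) j
      (field (fun _ => c) (fun _ => s) d (β j (k j))))‖ ^ 2)
      (∑' i, ‖field (fun _ => c) (fun _ => s) d (β j i)‖ ^ 2) := by
  set u : Fin J → ι → Fock 1 := Function.update (fun j i => (β j i : Fock 1)) j
    fun i => field (fun _ => c) (fun _ => s) d (β j i) with hu
  have hk : ∀ k : Fin J → ι, (Function.update (fun j => (β j (k j) : Fock 1)) j
      (field (fun _ => c) (fun _ => s) d (β j (k j)))) = fun l => u l (k l) := by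
    intro k
    funext l
    by_cases hl : l = j
    · subst hl; simp [hu]
    · simp [hu, hl]
  have h1 : ∀ l, HasSum (fun i => ‖u l i‖ ^ 2) (if l = j then
      ∑' i, ‖field (fun _ => c) (fun _ => s) d (β j i)‖ ^ 2 else 1) := by
    intro l
    by_cases hl : l = j
    · subst hl
      simpa [hu] using (summable_norm_sq_field h ha l c s d).hasSum
    · simpa [hu, hl] using (h l).norm
  have h2 := hasSum_prod_real (f := fun l i => ‖u l i‖ ^ 2) h1
  rw [Finset.prod_ite_eq' Finset.univ j, if_pos (Finset.mem_univ j)] at h2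
  refine h2.congr_fun fun k => ?_
  rw [hk, norm_sq_prodVec]

end

/-- The constants `e j` are free: they allow each mode's share to be centred, the remainder being a
multiple of the product vector. -/
theorem field_prodFamily {J : ℕ} {ι : Type*} (β : Fin J → ι → excitationDomain 1) (p q e : Fin J → ℂ) (d : ℂ) (k : Fin J → ι) :
    field p q d (prodFamily β k) = ∑ j, prodVec (Function.update (fun j => (β j (k j) : Fock 1)) j
      (field (fun _ => p j) (fun _ => q j) (e j) (β j (k j)))) +
      (d - ∑ j, e j) • (prodFamily β k : Fock J) := by
  have h1 : ∀ j, prodVec (Function.update (fun j => (β j (k j) : Fock 1)) j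
      (field (fun _ => p j) (fun _ => q j) (e j) (β j (k j)))) =
      p j • annihilate j (prodFamily β k) + q j • create j (prodFamily β k) +
        e j • (prodFamily β k : Fock J) := fun j =>
    prodVec_update_field (fun j => (β j (k j)).2) j (p j) (q j) (e j)
  rw [field_apply, Finset.sum_congr rfl fun j _ => h1 j]
  simp only [Finset.sum_add_distrib, ← Finset.sum_smul, sub_smul]
  abel

section

variable {J : ℕ} {ι : Type*} {β : Fin J → ι → excitationDomain 1} {ρ : Fin J → Op 1}
  (h : ∀ j, IsEnsemble (fun i => (β j i : Fock 1)) (ρ j))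
  (ha : ∀ j, Summable fun i => ‖annihilate 0 (β j i)‖ ^ 2)

include h ha

/-- The lower bound of the mean excitation number of a Bogoliubov mode by its centred single-mode
contributions. -/
theorem exists_sum_le_field (p q : Fin J → ℂ) (d : ℂ) :
    ∃ (E : ℝ) (e : Fin J → ℂ), HasSum (fun k => ‖field p q d (prodFamily β k)‖ ^ 2) E ∧
      ∑ j, ∑' i, ‖field (fun _ => p j) (fun _ => q j) (e j) (β j i)‖ ^ 2 ≤ E := by
  have hcov : ∀ j, Summable fun i =>
      ⟪(β j i : Fock 1), field (fun _ => p j) (fun _ => q j) 0 (β j i)⟫_ℂ := by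
    intro j
    refine Summable.of_norm_bounded
      ((h j).norm.summable.add (summable_norm_sq_field h ha j (p j) (q j) 0)) fun i => ?_
    refine (norm_inner_le_norm _ _).trans ?_
    nlinarith [sq_nonneg (‖(β j i : Fock 1)‖ - ‖field (fun _ => p j) (fun _ => q j) 0 (β j i)‖),
      sq_nonneg (‖(β j i : Fock 1)‖ + ‖field (fun _ => p j) (fun _ => q j) 0 (β j i)‖)]
  -- Minus the expectation of the mode's share, so that `z j` has mean zero.
  set e : Fin J → ℂ := fun j => -∑' i,
    ⟪(β j i : Fock 1), field (fun _ => p j) (fun _ => q j) 0 (β j i)⟫_ℂ with he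
  set z : Fin J → ι → Fock 1 := fun j i => field (fun _ => p j) (fun _ => q j) (e j) (β j i) with hz
  have hz0 : ∀ j, HasSum (fun i => ⟪(β j i : Fock 1), z j i⟫_ℂ) 0 := by
    intro j
    have h2 : HasSum (fun i => ((‖(β j i : Fock 1)‖ ^ 2 : ℝ) : ℂ)) ((1 : ℝ) : ℂ) :=
      Complex.hasSum_ofReal.2 (h j).norm
    have h1 := (hcov j).hasSum.add (h2.mul_left (e j))
    rw [Complex.ofReal_one, mul_one] at h1
    have h3 : (∑' i, ⟪(β j i : Fock 1), field (fun _ => p j) (fun _ => q j) 0 (β j i)⟫_ℂ) + e j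
        = 0 := by rw [he]; ring
    rw [h3] at h1
    refine h1.congr_fun fun i => ?_
    rw [hz]
    simp only [field_one, inner_add_right, inner_smul_right, inner_self_eq_norm_sq_to_K]
    simp
  have hz0' : ∀ j, HasSum (fun i => ⟪z j i, (β j i : Fock 1)⟫_ℂ) 0 := by
    intro j
    have := (Complex.hasSum_conj'.2 (hz0 j))
    rw [map_zero] at this
    exact this.congr_fun fun i => (inner_conj_symm _ _).symm
  have hzs : ∀ j, Summable fun i => ‖z j i‖ ^ 2 := fun j =>
    summable_norm_sq_field h ha j (p j) (q j) (e j)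
  have hZs := fun j => hasSum_norm_sq_single_field h ha j (p j) (q j) (e j)
  have hF : HasSum (fun k => ‖(prodFamily β k : Fock J)‖ ^ 2) 1 := (IsEnsemble.tensor h).norm
  set Z : Fin J → lp (fun _ : Fin J → ι => Fock J) 2 := fun j => directSum _ (hZs j).summable
    with hZ
  set F : lp (fun _ : Fin J → ι => Fock J) 2 := directSum _ hF.summable with hFd
  have hupd : ∀ (j : Fin J) (k : Fin J → ι), Function.update (fun j => (β j (k j) : Fock 1)) j
      (z j (k j)) = fun l => Function.update (fun j i => (β j i : Fock 1)) j (z j) l (k l) := by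
    intro j k
    funext l
    by_cases hl : l = j
    · subst hl; simp
    · simp [hl]
  have hus : ∀ j l, Summable fun i =>
      ‖Function.update (fun j i => (β j i : Fock 1)) j (z j) l i‖ ^ 2 := by
    intro j l
    by_cases hl : l = j
    · subst hl; simpa using hzs l
    · simpa [hl] using (h l).norm.summable
  -- The factor at mode `j` pairs the centred `z j` with the unmodified vector, so its sum is zero.
  have hZZ : ∀ j l, j ≠ l → ⟪Z j, Z l⟫_ℂ = 0 := by
    intro j l hjl
    refine (lp.hasSum_inner (Z j) (Z l)).unique ?_
    refine (hasSum_inner_prodVec_eq_zero (j := j) (hus j) (hus l) ?_).congr_fun fun k => ?_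
    · simpa [hjl] using hz0' j
    · change ⟪prodVec (Function.update _ j (z j (k j))),
        prodVec (Function.update _ l (z l (k l)))⟫_ℂ = _
      rw [hupd, hupd]
  have hZF : ∀ j, ⟪Z j, (d - ∑ j, e j) • F⟫_ℂ = 0 := by
    intro j
    rw [inner_smul_right, mul_eq_zero]
    right
    refine (lp.hasSum_inner (Z j) F).unique ?_
    refine (hasSum_inner_prodVec_eq_zero (j := j) (hus j) (fun l => (h l).norm.summable)
      ?_).congr_fun fun k => ?_
    · simpa using hz0' j
    · change ⟪prodVec (Function.update _ j (z j (k j))), prodVec _⟫_ℂ = _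
      rw [hupd]
  refine ⟨‖∑ j, Z j + (d - ∑ j, e j) • F‖ ^ 2, e, ?_, ?_⟩
  · refine (hasSum_norm_sq_lp _).congr_fun fun k => ?_
    rw [field_prodFamily β p q e d k]
    congr 2
    change _ = (∑ j, Z j : lp (fun _ : Fin J → ι => Fock J) 2) k + _
    rw [lp.coeFn_sum, Finset.sum_apply]
    rfl
  · refine le_trans (le_of_eq ?_) (sum_norm_sq_le_of_orthogonal hZZ hZF)
    refine Finset.sum_congr rfl fun j _ => ?_
    exact (hZs j).unique (hasSum_norm_sq_lp (Z j))

/-- The centred contribution of one mode is bounded by its thermal excitation. -/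
theorem mul_le_single_field (j : Fin J) (p q e : ℂ) {x : ℝ} (hx : 0 ≤ x)
    (hxj : ENNReal.ofReal x ≤ thermalExcitation (ρ j)) :
    (‖p‖ ^ 2 - ‖q‖ ^ 2) * x ≤ ∑' i, ‖field (fun _ => p) (fun _ => q) e (β j i)‖ ^ 2 := by
  have hnn : 0 ≤ ∑' i, ‖field (fun _ => p) (fun _ => q) e (β j i)‖ ^ 2 :=
    tsum_nonneg fun _ => by positivity
  rcases le_or_gt (‖p‖ ^ 2 - ‖q‖ ^ 2) 0 with hle | hlt
  · exact (mul_nonpos_of_nonpos_of_nonneg hle hx).trans hnn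
  -- Dividing by `k` normalises the coefficients to an admissible triple; the square of `k` returns
  -- as the factor.
  set k := Real.sqrt (‖p‖ ^ 2 - ‖q‖ ^ 2) with hk
  have hk0 : 0 < k := Real.sqrt_pos.2 hlt
  have hk2 : k ^ 2 = ‖p‖ ^ 2 - ‖q‖ ^ 2 := Real.sq_sqrt hlt.le
  have hkc : (k : ℂ) ≠ 0 := Complex.ofReal_ne_zero.2 hk0.ne'
  have hcs : ‖(k : ℂ)⁻¹ * p‖ ^ 2 - ‖(k : ℂ)⁻¹ * q‖ ^ 2 = 1 := by
    rw [norm_mul, norm_mul, norm_inv, Complex.norm_real, Real.norm_of_nonneg hk0.le, mul_pow,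
      mul_pow, ← mul_sub, ← hk2, ← mul_pow, inv_mul_cancel₀ hk0.ne', one_pow]
  have h1 := hxj.trans ((h j).thermalExcitation_le hcs ((k : ℂ)⁻¹ * e))
  have hs := summable_norm_sq_field h ha j ((k : ℂ)⁻¹ * p) ((k : ℂ)⁻¹ * q) ((k : ℂ)⁻¹ * e)
  rw [← ENNReal.ofReal_tsum_of_nonneg (fun _ => by positivity) hs,
    ENNReal.ofReal_le_ofReal_iff (tsum_nonneg fun _ => by positivity)] at h1
  have h2 : ∀ i, ‖field (fun _ => (k : ℂ)⁻¹ * p) (fun _ => (k : ℂ)⁻¹ * q) ((k : ℂ)⁻¹ * e)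
      (β j i)‖ ^ 2 = (k ^ 2)⁻¹ * ‖field (fun _ => p) (fun _ => q) e (β j i)‖ ^ 2 := by
    intro i
    have := field_smul (J := 1) (k : ℂ)⁻¹ (fun _ => p) (fun _ => q) e
    change field (fun _ => (k : ℂ)⁻¹ * p) (fun _ => (k : ℂ)⁻¹ * q) _ = _ at this
    rw [this, LinearMap.smul_apply, norm_smul, norm_inv, Complex.norm_real,
      Real.norm_of_nonneg hk0.le, mul_pow, inv_pow]
  simp only [h2, tsum_mul_left] at h1
  rw [← hk2]
  rwa [inv_mul_eq_div, le_div_iff₀ (by positivity), mul_comm] at h1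

end

/-! ### Reduced states -/

theorem slice_mem {J : ℕ} (i : Fin J) (k : {j : Fin J // j ≠ i} → ℕ) {ψ : Fock J}
    (hψ : ψ ∈ excitationDomain J) : slice i k ψ ∈ excitationDomain 1 := by
  rw [mem_excitationDomain_iff]
  intro j
  rw [Subsingleton.elim j 0]
  have hinj : Function.Injective fun m : Fin 1 → ℕ => (splitMode i).symm (m, k) :=
    fun _ _ h => (Prod.mk.inj ((splitMode i).symm.injective h)).1
  refine ((summable_mode i hψ).comp_injective hinj).congr fun m => ?_
  rw [Function.comp_apply, slice_apply]
  congr 2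
  have := splitMode_symm_apply i m ((splitMode i).symm (m, k))
  rw [Equiv.apply_symm_apply] at this
  rw [this, Function.update_self]

/-- The slices of a domain vector, as domain vectors. -/
def sliceDom {J : ℕ} (i : Fin J) (k : {j : Fin J // j ≠ i} → ℕ) (ψ : excitationDomain J) :
    excitationDomain 1 := ⟨slice i k ψ, slice_mem i k ψ.2⟩

theorem splitMode_symm_same {J : ℕ} (i : Fin J) (m : Fin 1 → ℕ) (k : {j : Fin J // j ≠ i} → ℕ) :
    (splitMode i).symm (m, k) i = m 0 := by
  have := splitMode_symm_apply i m ((splitMode i).symm (m, k))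
  rw [Equiv.apply_symm_apply] at this
  rw [this, Function.update_self]

theorem splitMode_symm_eq_update {J : ℕ} (i : Fin J) (m m' : Fin 1 → ℕ)
    (k : {j : Fin J // j ≠ i} → ℕ) :
    (splitMode i).symm (m', k) = Function.update ((splitMode i).symm (m, k)) i (m' 0) := by
  have := splitMode_symm_apply i m' ((splitMode i).symm (m, k))
  rwa [Equiv.apply_symm_apply] at this

theorem annihilate_sliceDom {J : ℕ} (i : Fin J) (k : {j : Fin J // j ≠ i} → ℕ)
    (ψ : excitationDomain J) : annihilate 0 (sliceDom i k ψ) = slice i k (annihilate i ψ) := by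
  ext m
  rw [annihilate_apply, slice_apply, annihilate_apply, splitMode_symm_same]
  congr 1
  refine congrArg (fun x => (ψ : Fock J) x) ?_
  refine (splitMode_symm_eq_update i m (m + Pi.single 0 1) k).trans ?_
  funext l
  by_cases hl : l = i
  · subst hl; simp [splitMode_symm_same]
  · simp [hl]

theorem create_sliceDom {J : ℕ} (i : Fin J) (k : {j : Fin J // j ≠ i} → ℕ)
    (ψ : excitationDomain J) : create 0 (sliceDom i k ψ) = slice i k (create i ψ) := by
  ext m
  rw [create_apply, slice_apply, create_apply, splitMode_symm_same]
  congr 1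
  refine congrArg (fun x => (ψ : Fock J) x) ?_
  refine (splitMode_symm_eq_update i m (m - Pi.single 0 1) k).trans ?_
  funext l
  by_cases hl : l = i
  · subst hl; simp [splitMode_symm_same]
  · simp [hl]

/-- Slicing along the other modes commutes with the ladder operators of mode `i`, and the squared
norms of the slices add up to that of the vector. -/
theorem tsum_ofReal_field_sliceDom {J : ℕ} (i : Fin J) (c s d : ℂ) (ψ : excitationDomain J) :
    ∑' k, ENNReal.ofReal (‖field (fun _ => c) (fun _ => s) d (sliceDom i k ψ)‖ ^ 2) =
      ENNReal.ofReal (‖c • annihilate i ψ + s • create i ψ + d • (ψ : Fock J)‖ ^ 2) := by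
  have h := hasSum_slice i (c • annihilate i ψ + s • create i ψ + d • (ψ : Fock J))
  rw [← h.tsum_eq, ENNReal.ofReal_tsum_of_nonneg (fun _ => by positivity) h.summable]
  congr! 4 with k
  rw [field_one, annihilate_sliceDom, create_sliceDom, map_add, map_add, map_smul, map_smul,
    map_smul]
  rfl

/-- The coefficients of a composition of Bogoliubov transformations. -/
theorem sum_bogoliubov_comp {J : ℕ} {c s : ℂ} {p q : Fin J → ℂ} (hcs : ‖c‖ ^ 2 - ‖s‖ ^ 2 = 1)
    (hpq : ∑ k, (‖p k‖ ^ 2 - ‖q k‖ ^ 2) = 1) :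
    ∑ k, (‖(c • p + s • star q) k‖ ^ 2 - ‖(c • q + s • star p) k‖ ^ 2) = 1 := by
  rw [← hpq]
  refine Finset.sum_congr rfl fun k _ => ?_
  have e : ‖c * p k + s * conj (q k)‖ ^ 2 - ‖c * q k + s * conj (p k)‖ ^ 2 =
      (‖c‖ ^ 2 - ‖s‖ ^ 2) * (‖p k‖ ^ 2 - ‖q k‖ ^ 2) := by
    simp only [Complex.sq_norm, Complex.normSq_apply, Complex.add_re, Complex.add_im,
      Complex.mul_re, Complex.mul_im, Complex.conj_re, Complex.conj_im]
    ring
  rw [hcs, one_mul] at e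
  exact e

section

variable {J : ℕ} {ι : Type*} {χ : ι → excitationDomain J} {ρ : Op J}

theorem IsEnsemble.reduced_evolve (h : IsEnsemble (fun i => (χ i : Fock J)) ρ) {W : Op J}
    (hW : IsGaussianUnitary W) (j : Fin J) :
    IsEnsemble (fun p : ι × ({l : Fin J // l ≠ j} → ℕ) =>
      (sliceDom j p.2 (hW.map (χ p.1)) : Fock 1)) (Bosonic.reduced j (Bosonic.evolve W ρ)) :=
  (h.evolve hW.unitary).reduced j

/-- A local combination evaluated after the global transformation is one composed combination on the
original vectors; the creation part enters through `create_map`, which exchanges and conjugates `p`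
and `q`. -/
theorem IsEnsemble.tsum_field_reduced {W : Op J}
    (hW : IsGaussianUnitary W) {j : Fin J} {p q : Fin J → ℂ} {e : ℂ}
    (hf : ∀ ψ, annihilate j (hW.map ψ) = W (field p q e ψ)) (c s d : ℂ) :
    ∑' x : ι × ({l : Fin J // l ≠ j} → ℕ), ENNReal.ofReal
        (‖field (fun _ => c) (fun _ => s) d (sliceDom j x.2 (hW.map (χ x.1)))‖ ^ 2) =
      ∑' i, ENNReal.ofReal (‖field (c • p + s • star q) (c • q + s • star p)
        (c * e + s * conj e + d) (χ i)‖ ^ 2) := by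
  rw [ENNReal.tsum_prod (f := fun i k => ENNReal.ofReal
        (‖field (fun _ => c) (fun _ => s) d (sliceDom j k (hW.map (χ i)))‖ ^ 2))]
  congr! 2 with i
  rw [tsum_ofReal_field_sliceDom, hf, hW.create_map hf]
  change ENNReal.ofReal (‖_ + d • W (χ i)‖ ^ 2) = _
  rw [← map_smul W, ← map_smul W, ← map_smul W, ← map_add W, ← map_add W,
    ContinuousLinearMap.norm_map_of_mem_unitary hW.unitary]
  congr 3
  have h1 := field_add (c • p + s • star q) (c • q + s • star p) 0 0 (c * e + s * conj e) d
  have h2 := field_add (c • p) (c • q) (s • star q) (s • star p) (c * e) (s * conj e)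
  rw [add_zero, add_zero, h2, field_smul, field_smul] at h1
  rw [h1]
  simp [field_apply (0 : Fin J → ℂ)]

end

/-! ### Swaps of modes -/

theorem swapModes_apply {J : ℕ} (i j : Fin J) (ψ : Fock J) (n : Fin J → ℕ) :
    swapModes i j ψ n = ψ (n ∘ Equiv.swap i j) := rfl

theorem swapModes_swapModes {J : ℕ} (i j : Fin J) (ψ : Fock J) :
    swapModes i j (swapModes i j ψ) = ψ := by
  ext n
  rw [swapModes_apply, swapModes_apply]
  refine congrArg (fun x => ψ x) (funext fun l => ?_)
  simp

theorem star_swapModes {J : ℕ} (i j : Fin J) : star (swapModes i j) = swapModes i j := by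
  rw [ContinuousLinearMap.star_eq_adjoint]
  symm
  rw [ContinuousLinearMap.eq_adjoint_iff]
  intro φ ψ
  have h1 := hasSum_inner_apply φ (swapModes i j ψ)
  rw [← (Equiv.arrowCongr (Equiv.swap i j) (Equiv.refl ℕ)).hasSum_iff] at h1
  refine (hasSum_inner_apply _ _).unique (h1.congr_fun fun n => ?_)
  rw [Function.comp_apply, swapModes_apply, swapModes_apply]
  have e : (Equiv.arrowCongr (Equiv.swap i j) (Equiv.refl ℕ)) n = n ∘ Equiv.swap i j := by
    funext l
    simp
  rw [e]
  congr 1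
  refine congrArg (fun x => ψ x) (funext fun l => ?_)
  simp

theorem swapModes_mem_unitary {J : ℕ} (i j : Fin J) : swapModes i j ∈ unitary (Op J) := by
  have h : swapModes i j * swapModes i j = 1 :=
    ContinuousLinearMap.ext fun ψ => swapModes_swapModes i j ψ
  rw [Unitary.mem_iff, star_swapModes]
  exact ⟨h, h⟩

theorem swapModes_mem_excitationDomain {J : ℕ} (i j : Fin J) {ψ : Fock J}
    (hψ : ψ ∈ excitationDomain J) : swapModes i j ψ ∈ excitationDomain J := by
  change Summable _
  have h := (Equiv.arrowCongr (Equiv.swap i j) (Equiv.refl ℕ)).summable_iff.2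
    (show Summable fun n : Fin J → ℕ => ((∑ j, n j : ℕ) : ℝ) * ‖ψ n‖ ^ 2 from hψ)
  refine h.congr fun n => ?_
  have e : (Equiv.arrowCongr (Equiv.swap i j) (Equiv.refl ℕ)) n = n ∘ Equiv.swap i j := by
    funext l
    simp
  rw [Function.comp_apply, e, swapModes_apply]
  congr 2
  exact Equiv.sum_comp (Equiv.swap i j) n

theorem annihilate_swapModes {J : ℕ} (i j l : Fin J) (ψ : excitationDomain J)
    (h : swapModes i j ψ ∈ excitationDomain J) :
    annihilate l ⟨swapModes i j ψ, h⟩ =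
      swapModes i j (annihilate (Equiv.swap i j l) ψ) := by
  ext n
  rw [annihilate_apply, swapModes_apply, swapModes_apply, annihilate_apply, Function.comp_apply,
    Equiv.swap_apply_self]
  congr 1
  refine congrArg (fun x => (ψ : Fock J) x) (funext fun m => ?_)
  simp only [Function.comp_apply, Pi.add_apply, Pi.single_apply]
  congr 1
  exact if_congr (Equiv.swap_apply_eq_iff) rfl rfl

theorem isGaussianUnitary_swapModes {J : ℕ} (i j : Fin J) : IsGaussianUnitary (swapModes i j) where
  unitary := swapModes_mem_unitary i j
  mem_iff ψ := ⟨fun h => by simpa only [swapModes_swapModes] using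
    swapModes_mem_excitationDomain i j h, swapModes_mem_excitationDomain i j⟩
  bogoliubov := by
    refine ⟨(Equiv.swap i j).toPEquiv.toMatrix, 0, 0, ?_, by simp, fun l ψ => ?_⟩
    · have h1 : ((Equiv.swap i j).toPEquiv.toMatrix : Matrix (Fin J) (Fin J) ℂ).conjTranspose =
          (Equiv.swap i j).toPEquiv.toMatrix := by
        ext k l
        simp only [Matrix.conjTranspose_apply, PEquiv.toMatrix_apply, Equiv.toPEquiv_apply,
          Option.mem_some_iff]
        by_cases h : Equiv.swap i j k = l
        · rw [if_pos h, if_pos (by rw [← h, Equiv.swap_apply_self])]; simp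
        · rw [if_neg h, if_neg (fun h' => h (by rw [← h', Equiv.swap_apply_self]))]; simp
      rw [h1, ← PEquiv.toMatrix_trans, ← Equiv.toPEquiv_trans]
      simp
    · rw [annihilate_swapModes]
      congr 1
      rw [Finset.sum_eq_single (Equiv.swap i j l)]
      · simp [PEquiv.toMatrix_apply]
      · intro k _ hk
        simp [PEquiv.toMatrix_apply, hk.symm]
      · simp

theorem IsGaussianUnitary.exists_single {W : Op 1} (hW : IsGaussianUnitary W) :
    ∃ c s d : ℂ, ‖c‖ ^ 2 - ‖s‖ ^ 2 = 1 ∧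
      ∀ ψ, annihilate 0 (hW.map ψ) = W (field (fun _ => c) (fun _ => s) d ψ) := by
  obtain ⟨p, q, d, hpq, h⟩ := hW.exists_annihilate 0
  have hp : p = fun _ => p 0 := funext fun i => by rw [Subsingleton.elim i 0]
  have hq : q = fun _ => q 0 := funext fun i => by rw [Subsingleton.elim i 0]
  rw [hp, hq] at h
  exact ⟨_, _, _, by simpa using hpq, h⟩

/-! ### Thermal excitations of reduced states -/

section

variable {J : ℕ} {ι : Type*} {β : Fin J → ι → excitationDomain 1} {ρ : Fin J → Op 1}
  (h : ∀ j, IsEnsemble (fun i => (β j i : Fock 1)) (ρ j))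
  (ha : ∀ j, Summable fun i => ‖annihilate 0 (β j i)‖ ^ 2)

include h

theorem meanExcitation_reduced {W : Op J} (hW : IsGaussianUnitary W) {j : Fin J}
    {p q : Fin J → ℂ} {e : ℂ} (hf : ∀ ψ, annihilate j (hW.map ψ) = W (field p q e ψ))
    {U : Op 1} (hU : IsGaussianUnitary U) {c s d : ℂ}
    (hUf : ∀ ψ, annihilate 0 (hU.map ψ) = U (field (fun _ => c) (fun _ => s) d ψ)) :
    meanExcitation (evolve U (reduced j (evolve W (tensor ρ)))) =
      ∑' k, ENNReal.ofReal (‖field (c • p + s • star q) (c • q + s • star p)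
        (c * e + s * conj e + d) (prodFamily β k)‖ ^ 2) := by
  have hT : IsEnsemble (fun k => (prodFamily β k : Fock J)) (tensor ρ) := IsEnsemble.tensor h
  rw [(hT.reduced_evolve hW j).meanExcitation_evolve hU hUf]
  exact IsEnsemble.tsum_field_reduced hW hf c s d

include ha

theorem isLeast_thermalExcitation_reduced {W : Op J} (hW : IsGaussianUnitary W) (j : Fin J) :
    IsLeast ((fun U => meanExcitation (evolve U (reduced j (evolve W (tensor ρ))))) ''
      gaussianUnitaries 1) (thermalExcitation (reduced j (evolve W (tensor ρ)))) := by
  have hT : IsEnsemble (fun k => (prodFamily β k : Fock J)) (tensor ρ) := IsEnsemble.tensor h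
  obtain ⟨p, q, e, -, hf⟩ := hW.exists_annihilate j
  refine ((hT.reduced_evolve hW j).isLeast_thermalExcitation ?_).2
  -- The choice `c = 1`, `s = d = 0` gives the excitation of the output mode itself, whose
  -- finiteness is needed for the minimisation.
  have h1 := IsEnsemble.tsum_field_reduced (χ := prodFamily β) hW hf 1 0 0
  obtain ⟨E, -, hE, -⟩ := exists_sum_le_field h ha ((1 : ℂ) • p + (0 : ℂ) • star q)
    ((1 : ℂ) • q + (0 : ℂ) • star p) (1 * e + 0 * conj e + 0)
  rw [← ENNReal.ofReal_tsum_of_nonneg (fun _ => by positivity) hE.summable] at h1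
  have h2 := ENNReal.summable_toReal (h1.trans_ne ENNReal.ofReal_ne_top)
  refine h2.congr fun x => ?_
  rw [ENNReal.toReal_ofReal (by positivity), field_one]
  simp

/-- The composed coefficients still satisfy `∑ (|p_k|² - |q_k|²) = 1`. The expression dominates the
sum of its single-mode parts, each at least `(|p_k|² - |q_k|²) x` with `x` the minimum, so the sum
is at least `x`. -/
theorem iInf_le_meanExcitation_reduced {W : Op J} (hW : IsGaussianUnitary W) (j : Fin J)
    {U : Op 1} (hU : IsGaussianUnitary U) :
    ⨅ i, thermalExcitation (ρ i) ≤
      meanExcitation (evolve U (reduced j (evolve W (tensor ρ)))) := by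
  obtain ⟨p, q, e, hpq, hf⟩ := hW.exists_annihilate j
  obtain ⟨c, s, d, hcs, hUf⟩ := hU.exists_single
  rw [meanExcitation_reduced h hW hf hU hUf]
  obtain ⟨E, e', hE, hle⟩ := exists_sum_le_field h ha (c • p + s • star q)
    (c • q + s • star p) (c * e + s * conj e + d)
  rw [← ENNReal.ofReal_tsum_of_nonneg (fun _ => by positivity) hE.summable, hE.tsum_eq]
  have hfin : ⨅ i, thermalExcitation (ρ i) ≠ ⊤ :=
    ne_top_of_le_ne_top ((h j).isLeast_thermalExcitation (ha j)).1 (iInf_le _ j)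
  rw [← ENNReal.ofReal_toReal hfin]
  refine ENNReal.ofReal_le_ofReal (le_trans ?_ hle)
  set x := (⨅ i, thermalExcitation (ρ i)).toReal with hx
  calc x = ∑ k, (‖(c • p + s • star q) k‖ ^ 2 - ‖(c • q + s • star p) k‖ ^ 2) * x := by
        rw [← Finset.sum_mul, sum_bogoliubov_comp hcs hpq, one_mul]
    _ ≤ _ := Finset.sum_le_sum fun k _ =>
        mul_le_single_field h ha k _ _ _ ENNReal.toReal_nonneg
          ((ENNReal.ofReal_toReal hfin).trans_le (iInf_le _ k))

theorem iInf_le_thermalExcitation_reduced {W : Op J} (hW : IsGaussianUnitary W) (j : Fin J) :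
    ⨅ i, thermalExcitation (ρ i) ≤ thermalExcitation (reduced j (evolve W (tensor ρ))) :=
  le_iInf₂ fun _ hU => iInf_le_meanExcitation_reduced h ha hW j hU

/-- Swapping two modes of a product state swaps the thermal excitations. -/
theorem thermalExcitation_reduced_swapModes (i j : Fin J) :
    thermalExcitation (reduced i (evolve (swapModes i j) (tensor ρ))) =
      thermalExcitation (ρ j) := by
  have hS := isGaussianUnitary_swapModes i j
  have hf : ∀ ψ, annihilate i (hS.map ψ) = swapModes i j (field (Pi.single j 1) 0 0 ψ) := by
    intro ψ
    refine (annihilate_swapModes i j i ψ _).trans ?_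
    rw [Equiv.swap_apply_left, field_apply, Finset.sum_eq_single j]
    · simp
    · intro k _ hk; simp [hk]
    · simp
  refine iInf_congr fun U => iInf_congr fun hU => ?_
  obtain ⟨c, s, d, hcs, hUf⟩ := IsGaussianUnitary.exists_single hU
  rw [meanExcitation_reduced h hS hf hU hUf, (h j).meanExcitation_evolve hU hUf,
    ← ENNReal.ofReal_tsum_of_nonneg (fun _ => by positivity) (summable_norm_sq_field h ha j c s d)]
  have h1 := hasSum_norm_sq_single_field h ha j c s d
  rw [← h1.tsum_eq, ENNReal.ofReal_tsum_of_nonneg (fun _ => by positivity) h1.summable]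
  -- After the swap the combination involves mode `j` alone, so it modifies just the factor `j` of
  -- each product vector.
  refine tsum_congr fun k => congrArg (fun x : Fock J => ENNReal.ofReal (‖x‖ ^ 2)) ?_
  refine Eq.trans ?_ (prodVec_update_field (fun j => (β j (k j)).2) j c s d).symm
  rw [field_apply, Finset.sum_eq_single j]
  · simp [prodFamily]
  · intro l _ hl; simp [hl]
  · simp

end

end

end Bosonic

/-! ### Assembly of the theorem -/

open Bosonic in
theorem lemma1 (J : ℕ) (hJ : 0 < J) (ρ : Fin J → Op 1) (hρ : ∀ j, IsGaussianState (ρ j)) :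
    (∀ j, thermalExcitation (ρ j) ≠ ⊤ ∧
      IsLeast ((fun U => meanExcitation (evolve U (ρ j))) '' gaussianUnitaries 1)
        (thermalExcitation (ρ j))) ∧
    (∀ W ∈ gaussianUnitaries J,
      IsLeast ((fun U => meanExcitation (evolve U (reduced ⟨0, hJ⟩ (evolve W (tensor ρ))))) ''
          gaussianUnitaries 1)
        (thermalExcitation (reduced ⟨0, hJ⟩ (evolve W (tensor ρ))))) ∧
    IsLeast ((fun W => thermalExcitation (reduced ⟨0, hJ⟩ (evolve W (tensor ρ)))) ''
        gaussianUnitaries J)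
      (⨅ j, thermalExcitation (ρ j)) ∧
    (∀ j, thermalExcitation (ρ j) = ⨅ i, thermalExcitation (ρ i) →
      swapModes ⟨0, hJ⟩ j ∈ gaussianUnitaries J ∧
      thermalExcitation (reduced ⟨0, hJ⟩ (evolve (swapModes ⟨0, hJ⟩ j) (tensor ρ))) =
        ⨅ i, thermalExcitation (ρ i)) := by
  choose ψ hψ using fun j => (hρ j).toIsState.exists_isEnsemble
  choose hmem ha using fun j => (hρ j).mem_and_summable (hψ j)
  -- All modes use the same index type, as the product ensemble requires.
  have h : ∀ j, IsEnsemble (fun i => (((fun j i => ⟨ψ j i, hmem j i⟩ :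
      Fin J → (Fin 1 → ℕ) → excitationDomain 1) j i : excitationDomain 1) : Fock 1)) (ρ j) := hψ
  have hswap := thermalExcitation_reduced_swapModes h ha ⟨0, hJ⟩
  refine ⟨fun j => (h j).isLeast_thermalExcitation (ha j),
    fun W hW => isLeast_thermalExcitation_reduced h ha hW _, ⟨?_, ?_⟩, fun j hj =>
    ⟨isGaussianUnitary_swapModes _ j, (hswap j).trans hj⟩⟩
  · have : Nonempty (Fin J) := ⟨⟨0, hJ⟩⟩
    obtain ⟨j, hj⟩ := exists_eq_ciInf_of_finite (f := fun j => thermalExcitation (ρ j))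
    exact ⟨_, isGaussianUnitary_swapModes _ j, (hswap j).trans hj⟩
  · rintro _ ⟨W, hW, rfl⟩
    exact iInf_le_thermalExcitation_reduced h ha hW _
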